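/- Let $d\in\mathbb{N}$ and $\lambda\in(0,1]$. Let $(\Omega,\mathcal{F},\langle\cdot\rangle)$ be a probability space of coefficient fields $a:\mathbb{R}^d\times\mathbb{R}\to\mathbb{R}^{d\times d}$, closed under the space-time translations $a\mapsto a(\cdot+x,\cdot+t)$, with evaluation and translation jointly measurable. Assume that it is (i) stationary: for all $(x,t)\in\mathbb{R}^{d+1}$, $a$ and $a(\cdot+x,\cdot+t)$ have the same law; (ii) ergodic: every bounded random variable $F$ such that, for all $(x,t)$, $F(a)=F(a(\cdot+x,\cdot+t))$ for $\langle\cdot\rangle$-a.e. $a$, is $\langle\cdot\rangle$-a.s. constant; (iii) bounded and uniformly elliptic: for $\langle\cdot\rangle$-a.e. $a$, almost everywhere in $\mathbb{R}^{d+1}$, $|a\xi|\le|\xi|$ and $\lambda|\xi|^2\le\xi\cdot a\xi$ for all $\xi\in\mathbb{R}^d$. Then there exist a constant $C=C(d,\lambda)>0$ (independent of the ensemble) and random fields $\phi_i,\psi_i,\sigma_{ijk},\zeta_{ij}$, $i,j,k\in\{1,\dots,d\}$, on $\mathbb{R}^{d+1}$ (jointly measurable and almost surely locally integrable) with the following properties.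 1. The spatial gradients $\nabla\phi_i,\nabla\psi_i,\nabla\sigma_{ijk}$ and the time derivatives $\partial_t\zeta_{ij}$, taken in the sense of distributions, are stationary random fields, that is, of the form $X(x,t;a)=X(0,0;a(\cdot+x,\cdot+t))$, with $$\langle|\nabla\phi_i|^2\rangle+\langle|\nabla\psi_i|^2\rangle+\langle|\nabla\sigma_{ijk}|^2\rangle+\langle|\partial_t\zeta_{ij}|^2\rangle\le C,\qquad \langle\nabla\phi_i\rangle=\langle\nabla\psi_i\rangle=\langle\nabla\sigma_{ijk}\rangle=0,\quad \langle\partial_t\zeta_{ij}\rangle=0 .$$ 2. $\sigma_{ijk}=-\sigma_{ikj}$; the fields $\psi$ and $\sigma$ are stationary in time, $\psi(x,t;a)=\psi(x,0;a(\cdot,\cdot+t))$ and $\sigma(x,t;a)=\sigma(x,0;a(\cdot,\cdot+t))$ for all $x,t,a$; and $\zeta$ is constant in space. 3. Let $q_i:=a(\nabla\phi_i+e_i)$, let the homogenized matrix $\bar a\in\mathbb{R}^{d\times d}$ be defined by $\bar a e_i:=\langle q_i\rangle$, and let $\langle q_i\,|\,\mathcal{F}_{\mathbb{R}^d}\rangle$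 be the stationary field generated by the conditional expectation of $q_i(0,0)$ with respect to the $\sigma$-algebra $\mathcal{F}_{\mathbb{R}^d}\subset\mathcal{F}$ of the events that are invariant under all spatial translations of the coefficient field. For $\langle\cdot\rangle$-a.e. $a$ and all $i,j,k$, in the sense of distributions on $\mathbb{R}^{d+1}$, $$\partial_t\phi_i=\nabla\cdot a(\nabla\phi_i+e_i),\qquad \Delta\psi_i=\nabla\cdot q_i,$$ $$\nabla\cdot\sigma_i=q_i-\nabla\psi_i-\langle q_i\,|\,\mathcal{F}_{\mathbb{R}^d}\rangle,\quad\text{where } (\nabla\cdot\sigma_i)_j=\sum_{k=1}^d\partial_k\sigma_{ijk},$$ $$\Delta\sigma_{ijk}=\partial_k(q_i-\nabla\psi_i)_j-\partial_j(q_i-\nabla\psi_i)_k,$$ $$\partial_t\zeta_i=\langle q_i\,|\,\mathcal{F}_{\mathbb{R}^d}\rangle-\langle q_i\rangle=\langle q_i\,|\,\mathcal{F}_{\mathbb{R}^d}\rangle-\bar a e_i .$$ 4. The homogenized matrix is uniformly elliptic and bounded: for every $\xi\in\mathbb{R}^d$, $$\lambda|\xi|^2\le\xi\cdot\bar a\xi\qquad\text{and}\qquad|\bar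 a\xi|\le\frac1\lambda|\xi| .$$ -/

import Mathlib

open MeasureTheory
open scoped Distributions LineDeriv

noncomputable section

/-- Space-time `ℝ^d × ℝ`; a point is `(x, t)`. -/
abbrev SpaceTime (d : ℕ) : Type := EuclideanSpace ℝ (Fin d) × ℝ

/-- Coefficient fields on space-time. -/
abbrev CoeffField (d : ℕ) : Type := SpaceTime d → Matrix (Fin d) (Fin d) ℝ

/-- The unit vector `e_i` of `ℝ^d`. -/
abbrev unitVec {d : ℕ} (i : Fin d) : EuclideanSpace ℝ (Fin d) := EuclideanSpace.single i 1

/-- The `i`-th spatial direction in space-time. -/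
abbrev spaceDir {d : ℕ} (i : Fin d) : SpaceTime d := (unitVec i, 0)

/-- The time direction in space-time. -/
abbrev timeDir (d : ℕ) : SpaceTime d := (0, 1)

/-- Distributions on space-time. -/
abbrev SpaceTimeDistribution (d : ℕ) : Type := 𝓓'((⊤ : TopologicalSpace.Opens (SpaceTime d)), ℝ)

/-- The distributional spatial derivative `∂_j`. -/
abbrev dx {d : ℕ} (j : Fin d) (T : SpaceTimeDistribution d) : SpaceTimeDistribution d := ∂_{spaceDir j} T

/-- The distributional time derivative `∂_t`. -/
abbrev dt {d : ℕ} (T : SpaceTimeDistribution d) : SpaceTimeDistribution d := ∂_{timeDir d} T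

/-- The distribution on `ℝ^d × ℝ` given by a locally integrable function
(by convention zero if the function is not locally integrable). -/
def distOf {d : ℕ} (f : SpaceTime d → ℝ) : SpaceTimeDistribution d :=
  TestFunction.integralAgainstBilinCLM (ContinuousLinearMap.mul ℝ ℝ) volume f

theorem distOf_apply {d : ℕ} {f : SpaceTime d → ℝ} (hf : LocallyIntegrable f volume)
    (g : 𝓓((⊤ : TopologicalSpace.Opens (SpaceTime d)), ℝ)) :
    distOf f g = ∫ z, g z * f z := by
  have h : LocallyIntegrableOn f
      ((⊤ : TopologicalSpace.Opens (SpaceTime d)) : Set (SpaceTime d)) volume :=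
    hf.locallyIntegrableOn _
  exact TestFunction.integralAgainstBilinCLM_eq_integral h

/-- A probability space of coefficient fields: a set `Ω` of coefficient fields on space-time
(the injective map `coeff` sends an element to the field that it is) which is closed under
space-time translations, with a σ-algebra for which evaluation and translation are jointly
measurable, and with a probability measure `law`. As `coeff` is injective, `shift` is
determined by `coeff_shift`. -/
structure Ensemble (d : ℕ) where
  Ω : Type
  [measΩ : MeasurableSpace Ω]
  coeff : Ω → CoeffField d
  coeff_injective : Function.Injective coeff
  shift : SpaceTime d → Ω → Ω
  /-- `shift (x, t) a = a(· + x, · + t)`. -/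
  coeff_shift : ∀ z a w, coeff (shift z a) w = coeff a (w + z)
  measurable_coeff : ∀ i j, Measurable fun p : Ω × SpaceTime d => coeff p.1 p.2 i j
  measurable_shift : Measurable fun p : Ω × SpaceTime d => shift p.2 p.1
  law : Measure Ω
  [isProb : IsProbabilityMeasure law]

namespace Ensemble

attribute [instance] Ensemble.measΩ Ensemble.isProb

variable {d : ℕ} (E : Ensemble d)

/-- `a` and `a(· + x, · + t)` have the same law. -/
def Stationary : Prop := ∀ z : SpaceTime d, E.law.map (E.shift z) = E.law

/-- Every bounded random variable that is invariant under all translations, almost surely for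
each translation, is almost surely constant. -/
def Ergodic : Prop :=
  ∀ F : E.Ω → ℝ, Measurable F → (∃ M : ℝ, ∀ a, |F a| ≤ M) →
    (∀ z : SpaceTime d, ∀ᵐ a ∂E.law, F a = F (E.shift z a)) →
      ∃ c : ℝ, ∀ᵐ a ∂E.law, F a = c

/-- `|aξ| ≤ |ξ|` and `lam |ξ|² ≤ ξ · aξ` almost surely, almost everywhere in space-time. -/
def UniformlyElliptic (lam : ℝ) : Prop :=
  ∀ᵐ a ∂E.law, ∀ᵐ z : SpaceTime d, ∀ ξ : EuclideanSpace ℝ (Fin d),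
    ‖(E.coeff a z).toEuclideanLin ξ‖ ≤ ‖ξ‖ ∧
      lam * ‖ξ‖ ^ 2 ≤ inner ℝ ξ ((E.coeff a z).toEuclideanLin ξ)

variable {E}

/-- A random field on space-time: jointly measurable, with almost surely locally integrable
realizations. -/
def IsRandomField (f : E.Ω → SpaceTime d → ℝ) : Prop :=
  (Measurable fun p : E.Ω × SpaceTime d => f p.1 p.2) ∧
    ∀ᵐ a ∂E.law, LocallyIntegrable (f a) volume

/-- The stationary random field `X(x, t; a) = X(a(· + x, · + t))` generated by a random
variable `X`. -/
def extend {V : Type*} (X : E.Ω → V) (a : E.Ω) (z : SpaceTime d) : V := X (E.shift z a)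

/-- The random field `f` has the stationary, finite energy, mean zero spatial gradient
generated by the random vector `G`: almost surely `∇f(x, t; a) = G(a(· + x, · + t))` in the
sense of distributions on space-time, with `⟨|G|²⟩ < ∞` and `⟨G⟩ = 0`. -/
def HasStationaryGradient (f : E.Ω → SpaceTime d → ℝ) (G : E.Ω → EuclideanSpace ℝ (Fin d)) :
    Prop :=
  Measurable G ∧ MemLp G 2 E.law ∧ ∫ a, G a ∂E.law = 0 ∧
    ∀ᵐ a ∂E.law, LocallyIntegrable (extend G a) volume ∧
      ∀ k : Fin d, dx k (distOf (f a)) = distOf fun z => extend G a z k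

/-- The same for the time derivative. -/
def HasStationaryTimeDeriv (f : E.Ω → SpaceTime d → ℝ) (H : E.Ω → ℝ) : Prop :=
  Measurable H ∧ MemLp H 2 E.law ∧ ∫ a, H a ∂E.law = 0 ∧
    ∀ᵐ a ∂E.law, LocallyIntegrable (extend H a) volume ∧
      dt (distOf (f a)) = distOf (extend H a)

/-- `f` is stationary in time: `f(x, t; a) = f(x, 0; a(·, · + t))`. -/
def StationaryInTime (f : E.Ω → SpaceTime d → ℝ) : Prop :=
  ∀ (a : E.Ω) (x : EuclideanSpace ℝ (Fin d)) (t : ℝ), f a (x, t) = f (E.shift (0, t) a) (x, 0)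

/-- `f` is constant in space. -/
def ConstantInSpace (f : E.Ω → SpaceTime d → ℝ) : Prop :=
  ∀ (a : E.Ω) (x y : EuclideanSpace ℝ (Fin d)) (t : ℝ), f a (x, t) = f a (y, t)

/-- The flux `q_i = a(∇φ_i + e_i)` at the origin of space-time, where `G i` generates the
stationary gradient `∇φ_i`. -/
def flux (G : Fin d → E.Ω → EuclideanSpace ℝ (Fin d)) (i : Fin d) (a : E.Ω) :
    EuclideanSpace ℝ (Fin d) :=
  (E.coeff a 0).toEuclideanLin (G i a + unitVec i)

/-- The stationary field generated by `flux G i` is `q_i(z; a) = a(z)(∇φ_i(z; a) + e_i)`. -/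
theorem extend_flux (G : Fin d → E.Ω → EuclideanSpace ℝ (Fin d)) (i : Fin d) (a : E.Ω)
    (z : SpaceTime d) :
    extend (flux G i) a z = (E.coeff a z).toEuclideanLin (extend (G i) a z + unitVec i) := by
  simp [extend, flux, E.coeff_shift]

/-- The homogenized matrix: `ā e_i = ⟨q_i⟩`. -/
def homogenized (G : Fin d → E.Ω → EuclideanSpace ℝ (Fin d)) : Matrix (Fin d) (Fin d) ℝ :=
  Matrix.of fun j i => (∫ a, flux G i a ∂E.law) j

variable (E) in
/-- The σ-algebra of the measurable subsets of `Ω` that are invariant under all spatial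
translations of the coefficient field. -/
@[reducible] def spatialInvariants : MeasurableSpace E.Ω :=
  ⨅ x : EuclideanSpace ℝ (Fin d), MeasurableSpace.invariants (E.shift (x, 0))

variable (E) in
theorem spatialInvariants_le : E.spatialInvariants ≤ E.measΩ :=
  (iInf_le _ 0).trans (MeasurableSpace.invariants_le _)

/-- The conditional expectation `⟨q_i | F_{ℝ^d}⟩` of the flux at the origin with respect to the
spatially invariant σ-algebra; `extend (condFlux G i)` is the corresponding stationary field. -/
def condFlux (G : Fin d → E.Ω → EuclideanSpace ℝ (Fin d)) (i : Fin d) :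
    E.Ω → EuclideanSpace ℝ (Fin d) :=
  E.law[flux G i | E.spatialInvariants]

end Ensemble

end

/-!
A stationary field is determined by its value at the origin of space-time, so every statement
about the correctors is a statement about the Hilbert space `L²` of the ensemble, on which the
translations act by a strongly continuous unitary group (`Ensemble.Stationary.koopman`). The
analysis is carried out for an arbitrary such group (`UnitaryRep`). Test functions `κ` act on
vectors through the averages `∫ κ(z) U_z u dz`. Every statement in the sense of distributions is
formulated with these averages, and identities between them are turned into almost sure equations
by `Ensemble.Represents.ae_eq`, which rests on the separability of the space of test functions.
Stationary gradients are the elements of the closed span of gradients of smooth vectors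
(`UnitaryRep.potential`). A random field with such a gradient is given by integration along
segments from an anchor point, averaged over the anchor point with a weight `η`
(`UnitaryRep.lift`, `Ensemble.potentialField`); time is only a parameter of this construction.

*The parabolic corrector.* After adding a massive term and mollifying the derivatives, the
equation `∂_t φ = ∇ · a(∇φ + e)` is solved by the Lax–Milgram theorem. The time derivative is
antisymmetric, so it does not enter the energy estimate, and the gradients have a weak limit. The
approximations of `φ` need not converge, but after subtracting anchored averages the time
derivative of `φ` is a bounded linear function of `∇φ`, so the equation passes to the limit up to a
function of time (`UnitaryRep.exists_corrector`); a primitive of this function is absorbed into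
`φ` (`Ensemble.correctorField`). The bounds of the homogenized matrix come from the energy
identity of the approximations: `λ |ξ|² ≤ λ ⟨|∇φ + ξ|²⟩ ≤ ξ · ⟨q⟩`, since gradients are orthogonal
to constants, and `|⟨q⟩|² ≤ ⟨|∇φ + ξ|²⟩ ≤ λ⁻¹ ξ · ⟨q⟩`, since `|a| ≤ 1`.

*The flux.* The gradient of `ψ_i` is the orthogonal projection of `q_i` on gradients, and the
gradient of `σ_{ijk}` is the projection of `w_j e_k - w_k e_j`, where `w = q_i - ∇ψ_i` is
divergence free. Then `∇ · σ_i - w` is harmonic. A stationary square integrable harmonic field is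
invariant in space (`UnitaryRep.invariant_of_harmonic`), and gradients are orthogonal to the
invariant fields, which identifies this difference with minus the projection of `q_i` on invariant
fields (`UnitaryRep.sum_vecPotential`). That projection is the conditional expectation with
respect to the spatially invariant events, because a random variable which is invariant up to null
sets has an exactly invariant version (`Ensemble.invariantVersion`). As the conditional
expectation is constant in space, the primitive in time of its deviation from the mean is `ζ`.
-/

noncomputable section

open TopologicalSpace Set Filter
open scoped Topology ContDiff RealInnerProductSpace Convolution ENNReal BoundedContinuousFunction

set_option linter.unusedSectionVars false

/-! ### Separability of the space of test functions -/

theorem finiteDimensional_continuousMultilinearMap {E : Type*} [NormedAddCommGroup E]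
    [NormedSpace ℝ E] [FiniteDimensional ℝ E] (i : ℕ) :
    FiniteDimensional ℝ (E [×i]→L[ℝ] ℝ) :=
  Module.Finite.of_injective
    (ContinuousMultilinearMap.toMultilinearMapLinear :
      (E [×i]→L[ℝ] ℝ) →ₗ[ℝ] MultilinearMap ℝ (fun _ : Fin i => E) ℝ)
    ContinuousMultilinearMap.toMultilinearMap_injective

/-- Functions vanishing off the compact set `K` embed isometrically into `C(K, Y)`. -/
theorem isSeparable_boundedContinuousFunction_eqOn_zero {X Y : Type*} [TopologicalSpace X]
    [T2Space X] [NormedAddCommGroup Y] [SecondCountableTopology Y] {K : Set X}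
    [SecondCountableTopology K]
    (hK : IsCompact K) :
    IsSeparable {F : X →ᵇ Y | EqOn F 0 Kᶜ} := by
  have : CompactSpace K := isCompact_iff_compactSpace.1 hK
  let r : {F : X →ᵇ Y | EqOn F 0 Kᶜ} → C(K, Y) := fun F => (F.1 : C(X, Y)).restrict K
  have hr : Isometry r := by
    refine Isometry.of_dist_eq fun F G => le_antisymm ?_ ?_
    · rw [ContinuousMap.dist_le dist_nonneg]
      exact fun x => F.1.dist_coe_le_dist (g := G.1) x
    · rw [Subtype.dist_eq, BoundedContinuousFunction.dist_le dist_nonneg]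
      intro x
      by_cases hx : x ∈ K
      · exact ContinuousMap.dist_apply_le_dist (f := r F) (g := r G) ⟨x, hx⟩
      · rw [F.2 hx, G.2 hx, dist_self]
        exact dist_nonneg
  have : SecondCountableTopology {F : X →ᵇ Y | EqOn F 0 Kᶜ} :=
    hr.isEmbedding.secondCountableTopology
  exact IsSeparable.of_subtype _

/-- The topology of `𝓓_K` is induced by the iterated derivatives, which take values in separable
spaces. -/
theorem separableSpace_contDiffMapSupportedIn {E : Type*} [NormedAddCommGroup E]
    [NormedSpace ℝ E] [FiniteDimensional ℝ E] (K : Compacts E) :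
    SeparableSpace 𝓓_{K}(E, ℝ) := by
  have := fun i => finiteDimensional_continuousMultilinearMap (E := E) i
  have : ProperSpace E := FiniteDimensional.proper ℝ E
  have := fun i => FiniteDimensional.proper ℝ (E [×i]→L[ℝ] ℝ)
  have hemb := ContDiffMapSupportedIn.isUniformEmbedding_pi_structureMapCLM ℝ (E := E) (F := ℝ)
    (n := ⊤) (K := K)
  have hsep : IsSeparable (range (ContinuousLinearMap.pi
      (ContDiffMapSupportedIn.structureMapCLM ℝ (E := E) (F := ℝ) ⊤ (K := K)))) := by
    refine (IsSeparable.univ_pi fun i => isSeparable_boundedContinuousFunction_eqOn_zero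
      (X := E) (Y := E [×i]→L[ℝ] ℝ) K.isCompact).mono ?_
    rintro _ ⟨f, rfl⟩ i - x hx
    have := ContDiffMapSupportedIn.structureMapCLM_top_apply ℝ (i := i) f
    simp only [ContinuousLinearMap.coe_pi', this]
    exact f.iteratedFDeriv_zero_on_compl hx
  have := hsep.secondCountableTopology
  have h2 : SecondCountableTopology 𝓓_{K}(E, ℝ) :=
    (hemb.isEmbedding.codRestrict _ fun f => mem_range_self f).secondCountableTopology
  infer_instance

/-- Distributions are determined by countably many test functions: each space `𝓓_K` is
separable, and countably many compact sets `K` suffice. -/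
theorem exists_countable_separating_testFunctions (d : ℕ) :
    ∃ S : Set 𝓓((⊤ : Opens (SpaceTime d)), ℝ), S.Countable ∧
      ∀ T : SpaceTimeDistribution d, (∀ g ∈ S, T g = 0) → T = 0 := by
  let K : ℕ → Compacts (SpaceTime d) := fun n =>
    ⟨Metric.closedBall 0 n, isCompact_closedBall _ _⟩
  have := fun n => separableSpace_contDiffMapSupportedIn (K n)
  let ι : ∀ n, 𝓓_{K n}(SpaceTime d, ℝ) → 𝓓((⊤ : Opens (SpaceTime d)), ℝ) := fun n =>
    TestFunction.ofSupportedIn (subset_univ _)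
  refine ⟨⋃ n, ι n '' (denseSeq 𝓓_{K n}(SpaceTime d, ℝ) |> range),
    countable_iUnion fun n => (countable_range _).image _, fun T hT => ?_⟩
  ext g
  obtain ⟨n, hn⟩ : ∃ n : ℕ, tsupport g ⊆ Metric.closedBall 0 n := by
    obtain ⟨R, hR⟩ := g.hasCompactSupport.isCompact.isBounded.subset_closedBall 0
    obtain ⟨n, hn⟩ := exists_nat_ge R
    exact ⟨n, hR.trans (Metric.closedBall_subset_closedBall hn)⟩
  let f : 𝓓_{K n}(SpaceTime d, ℝ) :=
    .of_support_subset g.contDiff ((subset_tsupport _).trans hn)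
  have hcont : Continuous fun f => T (ι n f) :=
    T.continuous.comp (TestFunction.continuous_ofSupportedIn _)
  have hzero : (fun f => T (ι n f)) = fun _ => 0 :=
    Continuous.ext_on (denseRange_denseSeq _) hcont continuous_const <| by
      rintro _ ⟨m, rfl⟩
      exact hT _ (mem_iUnion.2 ⟨n, mem_image_of_mem _ (mem_range_self m)⟩)
  exact congrFun hzero f

/-- An almost sure identity between random distributions may be checked one test function at a
time. -/
theorem ae_distribution_eq {d : ℕ} {Ω : Type*} [MeasurableSpace Ω] {μ : Measure Ω}
    {T T' : Ω → SpaceTimeDistribution d} (h : ∀ g, ∀ᵐ a ∂μ, T a g = T' a g) :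
    ∀ᵐ a ∂μ, T a = T' a := by
  obtain ⟨S, hS, hsep⟩ := exists_countable_separating_testFunctions d
  have := (ae_ball_iff hS).2 fun g _ => h g
  filter_upwards [this] with a ha
  refine sub_eq_zero.1 (hsep _ fun g hg => ?_)
  have := ha g hg
  simp [this]

/-! ### Unitary representations of the translations of space-time -/

theorem testFunction_lineDeriv_apply {E : Type*} [NormedAddCommGroup E] [NormedSpace ℝ E]
    (κ : 𝓓((⊤ : Opens E), ℝ)) (m x : E) :
    (∂_{m} κ : 𝓓((⊤ : Opens E), ℝ)) x = fderiv ℝ κ x m := by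
  rw [TestFunction.lineDerivOp_eq_lineDerivCLM ℝ, TestFunction.lineDerivCLM_eq_fderivCLM,
    TestFunction.fderivCLM_apply_of_le _ (by simp)]

instance {d : ℕ} : (volume : Measure (SpaceTime d)).IsAddHaarMeasure :=
  inferInstanceAs ((volume : Measure (EuclideanSpace ℝ (Fin d))).prod
    (volume : Measure ℝ)).IsAddHaarMeasure

/-- A strongly continuous unitary (orthogonal) representation of the translation group of
space-time on a real Hilbert space. -/
structure UnitaryRep (d : ℕ) (H : Type*) [NormedAddCommGroup H] [InnerProductSpace ℝ H] where
  /-- The operator by which a space-time vector acts. -/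
  act : SpaceTime d → H →ₗᵢ[ℝ] H
  act_zero : ∀ u, act 0 u = u
  act_add : ∀ z w u, act (z + w) u = act z (act w u)
  continuous_act : ∀ u, Continuous fun z => act z u

set_option linter.unusedSectionVars false

namespace UnitaryRep

variable {d : ℕ} {H : Type*} [NormedAddCommGroup H] [InnerProductSpace ℝ H]
  (U : UnitaryRep d H)

theorem act_neg_act (z : SpaceTime d) (u : H) : U.act (-z) (U.act z u) = u := by
  rw [← U.act_add, neg_add_cancel, U.act_zero]

theorem act_comm (z w : SpaceTime d) (u : H) : U.act z (U.act w u) = U.act w (U.act z u) := by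
  rw [← U.act_add, add_comm, U.act_add]

theorem inner_act_left (z : SpaceTime d) (u v : H) : ⟪U.act z u, v⟫ = ⟪u, U.act (-z) v⟫ := by
  rw [← (U.act (-z)).inner_map_map, U.act_neg_act]

/-- `w` is the derivative of `v` in the direction `m`: the orbit map `z ↦ U_z v` has at the origin
the derivative `w` in the direction `m`. -/
def HasDeriv (m : SpaceTime d) (v w : H) : Prop :=
  HasLineDerivAt ℝ (fun z => U.act z v) w 0 m

section HasDeriv

variable {U} {m : SpaceTime d} {v w v' w' : H}

theorem HasDeriv.hasLineDerivAt (h : U.HasDeriv m v w) (z : SpaceTime d) :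
    HasLineDerivAt ℝ (fun z => U.act z v) (U.act z w) z m := by
  have h1 : HasDerivAt (fun s : ℝ => U.act (0 + s • m) v) w 0 := h
  have h2 := (U.act z).toContinuousLinearMap.hasFDerivAt.comp_hasDerivAt (0 : ℝ) h1
  refine HasDerivAt.congr_of_eventuallyEq h2 (Eventually.of_forall fun s => ?_)
  simp [U.act_add]

theorem HasDeriv.hasDerivAt (h : U.HasDeriv m v w) (z : SpaceTime d) (s : ℝ) :
    HasDerivAt (fun s : ℝ => U.act (z + s • m) v) (U.act (z + s • m) w) s := by
  have h1 : HasDerivAt (fun r : ℝ => U.act (z + s • m + r • m) v) (U.act (z + s • m) w)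
      (s - s) := by
    rw [sub_self]
    exact h.hasLineDerivAt (z + s • m)
  have h2 := HasDerivAt.scomp s h1 (h := fun r => r - s) ((hasDerivAt_id s).sub_const s)
  simp only [one_smul] at h2
  refine h2.congr_of_eventuallyEq (Eventually.of_forall fun r => ?_)
  simp [add_assoc, ← add_smul]

/-- Derivatives are antisymmetric, since translations preserve the inner product. -/
theorem HasDeriv.inner_eq_neg (h : U.HasDeriv m v w) (h' : U.HasDeriv m v' w') :
    ⟪w, v'⟫ = -⟪v, w'⟫ := by
  have h1 : HasDerivAt (fun s : ℝ => U.act (0 + s • m) v) w 0 := h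
  have h2 : HasDerivAt (fun s : ℝ => U.act (0 + s • m) v') w' 0 := h'
  have h3 := h1.inner ℝ h2
  have h4 : (fun s : ℝ => ⟪U.act (0 + s • m) v, U.act (0 + s • m) v'⟫) = fun _ => ⟪v, v'⟫ := by
    funext s
    rw [LinearIsometry.inner_map_map]
  rw [h4] at h3
  have h5 := h3.unique (hasDerivAt_const (0 : ℝ) ⟪v, v'⟫)
  simp only [zero_smul, add_zero, U.act_zero] at h5
  linarith

end HasDeriv

section Avg

variable [CompleteSpace H] {τ : Type*} [MeasurableSpace τ] {ν : Measure τ}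
  {k k' : τ → ℝ} {p : τ → SpaceTime d}

theorem stronglyMeasurable_act (hp : Measurable p) (u : H) :
    StronglyMeasurable fun x => U.act (p x) u :=
  (U.continuous_act u).stronglyMeasurable.comp_measurable hp

theorem integrable_smul_act (hk : Integrable k ν) (hp : Measurable p) (u : H) :
    Integrable (fun x => k x • U.act (p x) u) ν :=
  hk.smul_bdd ‖u‖ (U.stronglyMeasurable_act hp u).aestronglyMeasurable
    (ae_of_all _ fun x => (U.act (p x)).norm_map u |>.le)

open scoped Classical in
/-- The operator `u ↦ ∫ k(x) U_{p(x)} u dν(x)` (zero unless `k` is integrable and `p` is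
measurable). -/
def avg (ν : Measure τ) (k : τ → ℝ) (p : τ → SpaceTime d) : H →L[ℝ] H :=
  if h : Integrable k ν ∧ Measurable p then
    LinearMap.mkContinuous
      { toFun := fun u => ∫ x, k x • U.act (p x) u ∂ν
        map_add' := fun u v => by
          simp only [map_add, smul_add]
          exact integral_add (U.integrable_smul_act h.1 h.2 u) (U.integrable_smul_act h.1 h.2 v)
        map_smul' := fun c u => by
          simp only [map_smul, smul_comm _ c, integral_smul, RingHom.id_apply] }
      (∫ x, |k x| ∂ν) fun u => by
        refine (norm_integral_le_integral_norm _).trans_eq ?_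
        simp only [norm_smul, LinearIsometry.norm_map, Real.norm_eq_abs]
        rw [integral_mul_const]
  else 0

theorem avg_apply (hk : Integrable k ν) (hp : Measurable p) (u : H) :
    U.avg ν k p u = ∫ x, k x • U.act (p x) u ∂ν := by
  rw [avg, dif_pos ⟨hk, hp⟩]
  rfl

theorem inner_avg_eq_integral (hk : Integrable k ν) (hp : Measurable p) (u v : H) :
    ⟪U.avg ν k p u, v⟫ = ∫ x, k x * ⟪U.act (p x) u, v⟫ ∂ν := by
  rw [U.avg_apply hk hp, real_inner_comm,
    ← integral_inner (𝕜 := ℝ) (U.integrable_smul_act hk hp u) v]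
  refine integral_congr_ae (ae_of_all _ fun x => ?_)
  simp only [inner_smul_right, real_inner_comm v]

theorem inner_avg_left (hk : Integrable k ν) (hp : Measurable p) (u v : H) :
    ⟪U.avg ν k p u, v⟫ = ⟪u, U.avg ν k (fun x => -p x) v⟫ := by
  rw [real_inner_comm _ u, U.inner_avg_eq_integral hk hp,
    U.inner_avg_eq_integral (p := fun x => -p x) hk hp.neg]
  simp only [inner_act_left U _ u v, real_inner_comm u]

theorem act_avg (hk : Integrable k ν) (hp : Measurable p) (z : SpaceTime d) (u : H) :
    U.act z (U.avg ν k p u) = U.avg ν k p (U.act z u) := by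
  rw [U.avg_apply hk hp, U.avg_apply hk hp]
  have := (U.act z).toContinuousLinearMap.integral_comp_comm (U.integrable_smul_act hk hp u)
  simp only [LinearIsometry.coe_toContinuousLinearMap, map_smul] at this
  rw [← this]
  simp only [U.act_comm z]

theorem avg_comm {τ' : Type*} [MeasurableSpace τ'] {ν' : Measure τ'} {l : τ' → ℝ}
    {q : τ' → SpaceTime d} (hk : Integrable k ν) (hp : Measurable p) (hl : Integrable l ν')
    (hq : Measurable q) (u : H) :
    U.avg ν k p (U.avg ν' l q u) = U.avg ν' l q (U.avg ν k p u) := by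
  have := (U.avg ν' l q).integral_comp_comm (U.integrable_smul_act hk hp u)
  rw [U.avg_apply hk hp u, ← this, U.avg_apply hk hp]
  simp only [map_smul, U.act_avg hl hq]

theorem avg_add_kernel (hk : Integrable k ν) (hk' : Integrable k' ν) (hp : Measurable p) (u : H) :
    U.avg ν (fun x => k x + k' x) p u = U.avg ν k p u + U.avg ν k' p u := by
  rw [U.avg_apply hk hp, U.avg_apply hk' hp, U.avg_apply (k := fun x => k x + k' x) (hk.add hk') hp,
    ← integral_add (U.integrable_smul_act hk hp u) (U.integrable_smul_act hk' hp u)]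
  simp only [add_smul]

theorem avg_smul_kernel (c : ℝ) (hk : Integrable k ν) (hp : Measurable p) (u : H) :
    U.avg ν (fun x => c * k x) p u = c • U.avg ν k p u := by
  rw [U.avg_apply hk hp, U.avg_apply (hk.const_mul c) hp, ← integral_smul]
  simp only [mul_smul]

end Avg

/-- Integration by parts of an orbit map against a compactly supported scalar function. -/
theorem integral_smul_eq_neg_of_hasLineDerivAt {E : Type*} [NormedAddCommGroup E]
    [NormedSpace ℝ E] [FiniteDimensional ℝ E] [MeasurableSpace E] [BorelSpace E] {μ : Measure E}
    [μ.IsAddHaarMeasure] (κ : 𝓓((⊤ : Opens E), ℝ)) {f f' : E → H} {m : E} (hf : Continuous f)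
    (hf' : Continuous f') (h : ∀ x, HasLineDerivAt ℝ f (f' x) x m) :
    ∫ x, (∂_{m} κ : 𝓓((⊤ : Opens E), ℝ)) x • f x ∂μ = -∫ x, κ x • f' x ∂μ := by
  have hint : ∀ (κ : 𝓓((⊤ : Opens E), ℝ)) {f : E → H}, Continuous f →
      Integrable (fun x => ContinuousLinearMap.lsmul ℝ ℝ (κ x) (f x)) μ := fun κ f hf =>
    TestFunction.integrable_bilin _ (hf.locallyIntegrable.locallyIntegrableOn _) κ
  have := integral_bilinear_hasLineDerivAt_right_eq_neg_left_of_integrable (μ := μ)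
    (B := (ContinuousLinearMap.lsmul ℝ ℝ : ℝ →L[ℝ] H →L[ℝ] H)) (f := κ)
    (f' := (∂_{m} κ : 𝓓((⊤ : Opens E), ℝ))) (g := f) (g' := f') (v := m)
    (hint _ hf) (hint _ hf') (hint _ hf)
    (fun x _ => by
      have hd : DifferentiableAt ℝ κ x :=
        (κ.contDiff.differentiable (by simp)).differentiableAt
      rw [testFunction_lineDeriv_apply, ← hd.lineDeriv_eq_fderiv]
      exact hd.lineDifferentiableAt.hasLineDerivAt) (fun x _ => h x)
  simp only [ContinuousLinearMap.lsmul_apply] at this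
  rw [this, neg_neg]

variable [CompleteSpace H]

theorem integrable_testFunction {E : Type*} [NormedAddCommGroup E]
    [NormedSpace ℝ E] [FiniteDimensional ℝ E] [MeasurableSpace E] [BorelSpace E] {μ : Measure E}
    [IsFiniteMeasureOnCompacts μ] (κ : 𝓓((⊤ : Opens E), ℝ)) : Integrable κ μ :=
  κ.continuous.integrable_of_hasCompactSupport κ.hasCompactSupport

/-- The operator `u ↦ ∫ κ(z) U_z u dz`. -/
abbrev pair (κ : 𝓓((⊤ : Opens (SpaceTime d)), ℝ)) : H →L[ℝ] H := U.avg volume κ id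

/-- The operator `u ↦ ∫ κ(z) U_{-z} u dz`, with values in the smooth vectors; it is the adjoint
of `pair κ`. -/
abbrev smooth (κ : 𝓓((⊤ : Opens (SpaceTime d)), ℝ)) : H →L[ℝ] H :=
  U.avg volume κ fun z => -z

variable (κ κ' : 𝓓((⊤ : Opens (SpaceTime d)), ℝ))

theorem pair_apply (u : H) : U.pair κ u = ∫ z, κ z • U.act z u :=
  U.avg_apply (integrable_testFunction κ) measurable_id u

theorem smooth_apply (u : H) : U.smooth κ u = ∫ z, κ z • U.act (-z) u :=
  U.avg_apply (integrable_testFunction κ) measurable_neg u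

theorem inner_pair_left (u v : H) : ⟪U.pair κ u, v⟫ = ⟪u, U.smooth κ v⟫ :=
  U.inner_avg_left (integrable_testFunction κ) measurable_id u v

theorem smooth_comm (u : H) : U.smooth κ (U.smooth κ' u) = U.smooth κ' (U.smooth κ u) :=
  U.avg_comm (integrable_testFunction κ) measurable_neg (integrable_testFunction κ')
    measurable_neg u

theorem smooth_pair_comm (u : H) : U.smooth κ (U.pair κ' u) = U.pair κ' (U.smooth κ u) :=
  U.avg_comm (integrable_testFunction κ) measurable_neg (integrable_testFunction κ')
    measurable_id u

/-- The vectors in the range of `smooth κ` are differentiable: the orbit map of `smooth κ u` is the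
convolution of `κ` with the orbit map of `u`. -/
theorem hasDeriv_smooth (m : SpaceTime d) (u : H) :
    U.HasDeriv m (U.smooth κ u) (U.smooth (∂_{m} κ) u) := by
  have h1 := κ.hasCompactSupport.hasFDerivAt_convolution_left
    (L := (ContinuousLinearMap.lsmul ℝ ℝ : ℝ →L[ℝ] H →L[ℝ] H)) (μ := volume)
    (κ.contDiff.of_le (by simp)) (U.continuous_act u).locallyIntegrable (0 : SpaceTime d)
  have h2 : (κ ⋆[ContinuousLinearMap.lsmul ℝ ℝ, volume] fun z => U.act z u) =
      fun z => U.act z (U.smooth κ u) := by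
    funext z
    rw [smooth, U.act_avg (integrable_testFunction κ) measurable_neg, smooth_apply, convolution_def]
    simp only [ContinuousLinearMap.lsmul_apply, ← U.act_add, sub_eq_neg_add]
  rw [h2] at h1
  have hex := (κ.hasCompactSupport.fderiv ℝ).convolutionExists_left (μ := volume)
    (L := (ContinuousLinearMap.lsmul ℝ ℝ : ℝ →L[ℝ] H →L[ℝ] H).precompL (SpaceTime d))
    (κ.contDiff.continuous_fderiv (by simp)) (U.continuous_act u).locallyIntegrable 0
  have h3 := h1.hasLineDerivAt m
  rw [convolution_def, ContinuousLinearMap.integral_apply hex] at h3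
  have h4 : ∀ z, (ContinuousLinearMap.lsmul ℝ ℝ : ℝ →L[ℝ] H →L[ℝ] H).precompL (SpaceTime d)
      (fderiv ℝ κ z) (U.act (0 - z) u) m =
        (∂_{m} κ : 𝓓((⊤ : Opens (SpaceTime d)), ℝ)) z • U.act (-z) u := fun z => by
    change fderiv ℝ κ z m • U.act (0 - z) u = _
    rw [testFunction_lineDeriv_apply, zero_sub]
  simp only [h4] at h3
  rw [HasDeriv, U.smooth_apply (∂_{m} κ)]
  exact h3

/-- `pair κ v` is the pairing of the distribution `z ↦ U_z v` with `κ`, so this is the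
distributional form of `HasDeriv`. -/
theorem pair_lineDeriv {m : SpaceTime d} {v w : H} (h : U.HasDeriv m v w) :
    U.pair (∂_{m} κ) v = -U.pair κ w := by
  rw [pair_apply, pair_apply]
  exact integral_smul_eq_neg_of_hasLineDerivAt κ (U.continuous_act v) (U.continuous_act w)
    h.hasLineDerivAt

end UnitaryRep

namespace UnitaryRep

variable {d : ℕ} {H : Type*} [NormedAddCommGroup H] [InnerProductSpace ℝ H] [CompleteSpace H]
  (U : UnitaryRep d H) (κ κ' : 𝓓((⊤ : Opens (SpaceTime d)), ℝ))

/-! ### Mollification -/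

/-- Mollification commutes with differentiation. -/
theorem smooth_lineDeriv {m : SpaceTime d} {v w : H} (h : U.HasDeriv m v w) :
    U.smooth (∂_{m} κ) v = U.smooth κ w := by
  rw [smooth_apply, smooth_apply]
  have := integral_smul_eq_neg_of_hasLineDerivAt (μ := volume) κ (m := m)
    (f := fun z => U.act (-z) v)
    (f' := fun z => -U.act (-z) w) ((U.continuous_act v).comp continuous_neg)
    ((U.continuous_act w).comp continuous_neg).neg fun z => by
      have h1 : HasDerivAt (fun s : ℝ => U.act (-z + s • m) v) (U.act (-z) w) (-0) := by
        rw [neg_zero]; exact h.hasLineDerivAt (-z)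
      have h2 := HasDerivAt.scomp (0 : ℝ) h1 (h := fun r => -r) (hasDerivAt_neg 0)
      simp only [neg_smul, one_smul] at h2
      refine HasDerivAt.congr_of_eventuallyEq h2 (Eventually.of_forall fun r => ?_)
      simp [add_comm]
  rw [this]
  simp [integral_neg]

theorem smooth_add (u : H) : U.smooth (κ + κ') u = U.smooth κ u + U.smooth κ' u := by
  exact U.avg_add_kernel (integrable_testFunction κ) (integrable_testFunction κ') measurable_neg u

theorem smooth_smul (c : ℝ) (u : H) : U.smooth (c • κ) u = c • U.smooth κ u := by
  exact U.avg_smul_kernel c (integrable_testFunction κ) measurable_neg u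

theorem lineDeriv_comm (m m' : SpaceTime d) :
    (∂_{m} (∂_{m'} κ) : 𝓓((⊤ : Opens (SpaceTime d)), ℝ)) = ∂_{m'} (∂_{m} κ) := by
  ext z
  have hd : ∀ m, (⇑(∂_{m} κ : 𝓓((⊤ : Opens (SpaceTime d)), ℝ))) = fun z => fderiv ℝ κ z m :=
    fun m => funext fun z => testFunction_lineDeriv_apply κ m z
  have h2 : DifferentiableAt ℝ (fderiv ℝ κ) z :=
    ((κ.contDiff.fderiv_right (m := (⊤ : ℕ∞)) (by simp)).differentiable
      (by simp)).differentiableAt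
  rw [testFunction_lineDeriv_apply, testFunction_lineDeriv_apply, hd, hd,
    fderiv_clm_apply h2 (differentiableAt_const _), fderiv_clm_apply h2 (differentiableAt_const _)]
  simp only [fderiv_fun_const, Pi.zero_apply, ContinuousLinearMap.comp_zero, zero_add,
    ContinuousLinearMap.flip_apply]
  exact second_derivative_symmetric (f := κ)
    (fun y => ((κ.contDiff.differentiable (by simp)) y).hasFDerivAt) h2.hasFDerivAt m m'

/-- A smooth bump function of integral one. -/
def bump {E : Type*} [NormedAddCommGroup E] [NormedSpace ℝ E] [FiniteDimensional ℝ E]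
    [MeasurableSpace E] [BorelSpace E] (μ : Measure E) [μ.IsAddHaarMeasure]
    (b : ContDiffBump (0 : E)) : 𝓓((⊤ : Opens E), ℝ) where
  toFun := b.normed μ
  contDiff' := b.contDiff_normed
  hasCompactSupport' := b.hasCompactSupport_normed
  tsupport_subset' := subset_univ _

/-- A fixed sequence of mollifiers on space-time. -/
def mollifier (d n : ℕ) : 𝓓((⊤ : Opens (SpaceTime d)), ℝ) :=
  bump volume
    { rIn := 1 / ((n : ℝ) + 2), rOut := 1 / ((n : ℝ) + 1), rIn_pos := by positivity,
      rIn_lt_rOut := one_div_lt_one_div_of_lt (by positivity) (by linarith) }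

theorem tendsto_smooth_mollifier (u : H) :
    Tendsto (fun n => U.smooth (mollifier d n) u) atTop (𝓝 u) := by
  have h := ContDiffBump.convolution_tendsto_right_of_continuous (μ := volume)
    (φ := fun n : ℕ =>
      { rIn := 1 / ((n : ℝ) + 2), rOut := 1 / ((n : ℝ) + 1), rIn_pos := by positivity,
        rIn_lt_rOut := one_div_lt_one_div_of_lt (by positivity) (by linarith) })
    tendsto_one_div_add_atTop_nhds_zero_nat (U.continuous_act u) 0
  rw [U.act_zero] at h
  refine h.congr fun n => ?_
  rw [smooth_apply, convolution_def]
  simp only [zero_sub]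
  rfl

/-! ### Potential fields -/

/-- The Hilbert space of stationary vector fields, each represented by its value in `H^d` at the
origin of space-time. -/
abbrev VecField (d : ℕ) (H : Type*) [NormedAddCommGroup H] := PiLp 2 fun _ : Fin d => H

/-- The spatial gradient of the smooth vector `smooth κ u`. -/
def gradSmooth (u : H) : VecField d H :=
  WithLp.toLp 2 fun j => U.smooth (∂_{spaceDir j} κ) u

@[simp] theorem gradSmooth_apply (u : H) (j : Fin d) :
    U.gradSmooth κ u j = U.smooth (∂_{spaceDir j} κ) u := rfl

/-- The space of potential fields: the closed span of the spatial gradients of smooth vectors. A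
potential field is in general not the gradient of an element of `H`, since its potential is in
general not stationary. -/
def potential : Submodule ℝ (VecField d H) :=
  (Submodule.span ℝ {g | ∃ κ u, g = U.gradSmooth κ u}).topologicalClosure

instance : U.potential.HasOrthogonalProjection :=
  haveI : CompleteSpace U.potential := by
    exact (Submodule.isClosed_topologicalClosure _).completeSpace_coe
  inferInstance

theorem gradSmooth_mem_potential (u : H) : U.gradSmooth κ u ∈ U.potential :=
  Submodule.le_topologicalClosure _ (Submodule.subset_span ⟨κ, u, rfl⟩)

/-- A linear identity between continuous linear maps holds on potential fields if it holds on
gradients of smooth vectors. -/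
theorem potential_induction {W : Type*} [NormedAddCommGroup W] [NormedSpace ℝ W]
    {T T' : VecField d H →L[ℝ] W}
    (h : ∀ κ u, T (U.gradSmooth κ u) = T' (U.gradSmooth κ u)) {g : VecField d H}
    (hg : g ∈ U.potential) : T g = T' g := by
  have : U.potential ≤ LinearMap.eqLocus T.toLinearMap T'.toLinearMap := by
    refine Submodule.topologicalClosure_minimal _ (Submodule.span_le.2 ?_)
      (isClosed_eq T.continuous T'.continuous)
    rintro _ ⟨κ, u, rfl⟩
    exact h κ u
  exact this hg

/-- The component of a vector field, as a continuous linear map. -/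
abbrev comp (j : Fin d) : VecField d H →L[ℝ] H := PiLp.proj 2 (fun _ : Fin d => H) j

theorem inner_vecField (f g : VecField d H) : ⟪f, g⟫ = ∑ j, ⟪f j, g j⟫ :=
  PiLp.inner_apply f g

/-- The projection onto potential fields. -/
def proj (f : VecField d H) : VecField d H := U.potential.starProjection f

theorem proj_mem (f : VecField d H) : U.proj f ∈ U.potential :=
  U.potential.starProjection_apply_mem f

theorem norm_proj_le (f : VecField d H) : ‖U.proj f‖ ≤ ‖f‖ :=
  U.potential.norm_starProjection_apply_le f

theorem inner_proj (f : VecField d H) {g : VecField d H} (hg : g ∈ U.potential) :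
    ⟪U.proj f, g⟫ = ⟪f, g⟫ := by
  have := U.potential.starProjection_inner_eq_zero f g hg
  rw [inner_sub_left] at this
  exact (sub_eq_zero.1 this).symm

theorem inner_proj_gradSmooth (f : VecField d H) (u : H) :
    ∑ j, ⟪U.proj f j, U.smooth (∂_{spaceDir j} κ) u⟫ =
      ∑ j, ⟪f j, U.smooth (∂_{spaceDir j} κ) u⟫ := by
  simpa only [inner_vecField, gradSmooth_apply] using
    U.inner_proj f (U.gradSmooth_mem_potential κ u)

/-- Potential fields are curl free, in the weak sense. -/
theorem inner_potential_curl {g : VecField d H} (hg : g ∈ U.potential) (j k : Fin d) (u : H) :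
    ⟪g j, U.smooth (∂_{spaceDir k} κ) u⟫ = ⟪g k, U.smooth (∂_{spaceDir j} κ) u⟫ := by
  have := U.potential_induction
    (T := (innerSL ℝ (U.smooth (∂_{spaceDir k} κ) u)).comp (comp j))
    (T' := (innerSL ℝ (U.smooth (∂_{spaceDir j} κ) u)).comp (comp k))
    (fun κ' u' => by
      simp only [ContinuousLinearMap.comp_apply, PiLp.proj_apply, gradSmooth_apply,
        innerSL_apply_apply]
      have h1 := (U.hasDeriv_smooth κ (spaceDir k) u).inner_eq_neg
        (U.hasDeriv_smooth (∂_{spaceDir j} κ') (spaceDir k) u')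
      have h2 := (U.hasDeriv_smooth κ (spaceDir j) u).inner_eq_neg
        (U.hasDeriv_smooth (∂_{spaceDir k} κ') (spaceDir j) u')
      rw [h1, h2, lineDeriv_comm]) hg
  simpa only [ContinuousLinearMap.comp_apply, PiLp.proj_apply, innerSL_apply_apply,
    real_inner_comm] using this

/-! ### Spatially invariant vectors -/

/-- Spatially invariant vectors; they may depend on time. -/
def Invariant (u : H) : Prop := ∀ x : EuclideanSpace ℝ (Fin d), U.act (x, 0) u = u

variable {U} in
theorem Invariant.hasDeriv {u : H} (h : U.Invariant u) (j : Fin d) :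
    U.HasDeriv (spaceDir j) u 0 := by
  have : (fun s : ℝ => U.act (0 + s • spaceDir j) u) = fun _ => u := by
    funext s
    have := h (s • unitVec j)
    simpa using this
  change HasDerivAt (fun s : ℝ => U.act (0 + s • spaceDir j) u) 0 0
  rw [this]
  exact hasDerivAt_const _ _

/-- Potential fields are orthogonal to the spatially invariant vectors, in particular to the
constants. -/
theorem inner_potential_invariant {g : VecField d H} (hg : g ∈ U.potential) {w : H}
    (hw : U.Invariant w) (j : Fin d) : ⟪g j, w⟫ = 0 := by
  have := U.potential_induction (T := (innerSL ℝ w).comp (comp j)) (T' := 0)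
    (fun κ u => by
      have h1 := (U.hasDeriv_smooth κ (spaceDir j) u).inner_eq_neg (hw.hasDeriv j)
      simpa [real_inner_comm w] using h1) hg
  simpa [real_inner_comm w] using this

/-- A vector all of whose spatial derivatives vanish is spatially invariant. -/
theorem invariant_of_hasDeriv_zero {u : H} (h : ∀ j, U.HasDeriv (spaceDir j) u 0) :
    U.Invariant u := by
  have h1 : ∀ (j : Fin d) (s : ℝ), U.act (s • spaceDir j) u = u := fun j s => by
    have := is_const_of_deriv_eq_zero (f := fun s : ℝ => U.act (0 + s • spaceDir j) u)
      (fun s => ((h j).hasDerivAt 0 s).differentiableAt)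
      (fun s => by simpa using ((h j).hasDerivAt 0 s).deriv) s 0
    simpa [U.act_zero] using this
  intro x
  have h2 : ∀ s : Finset (Fin d), U.act (∑ j ∈ s, x j • spaceDir j) u = u := fun s => by
    induction s using Finset.induction_on with
    | empty => simp [U.act_zero]
    | insert j s hj ih => rw [Finset.sum_insert hj, U.act_add, ih, h1]
  have h3 : ∑ j, x j • (spaceDir j : SpaceTime d) = (x, 0) := by
    ext i
    · simp [Prod.fst_sum, Finset.sum_apply, Pi.single_apply]
    · simp [Prod.snd_sum]
  rw [← h3]
  exact h2 _

/-- Liouville's theorem: a weakly harmonic vector is spatially invariant. There is no growth to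
control: testing the equation of a mollification with itself shows that its gradient vanishes. -/
theorem invariant_of_harmonic {s : H}
    (h : ∀ (κ : 𝓓((⊤ : Opens (SpaceTime d)), ℝ)) (u : H),
      ∑ l : Fin d, ⟪s, U.smooth (∂_{spaceDir l} (∂_{spaceDir l} κ)) u⟫ = 0) :
    U.Invariant s := by
  have h1 : ∀ n, U.Invariant (U.smooth (mollifier d n) s) := fun n => by
    refine U.invariant_of_hasDeriv_zero fun j => ?_
    have h2 : ∑ l : Fin d, ‖U.smooth (∂_{spaceDir l} (mollifier d n)) s‖ ^ 2 = 0 := by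
      -- `pair` is the adjoint of `smooth`, so this test vector yields the energy of `smooth _ s`
      have h3 := h (mollifier d n) (U.pair (mollifier d n) s)
      have h4 : ∀ l : Fin d, ⟪s, U.smooth (∂_{spaceDir l} (∂_{spaceDir l} (mollifier d n)))
          (U.pair (mollifier d n) s)⟫ = -‖U.smooth (∂_{spaceDir l} (mollifier d n)) s‖ ^ 2 :=
        fun l => by
          rw [smooth_pair_comm, real_inner_comm, inner_pair_left, real_inner_comm,
            ← real_inner_self_eq_norm_sq,
            (U.hasDeriv_smooth (mollifier d n) (spaceDir l) s).inner_eq_neg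
              (U.hasDeriv_smooth (∂_{spaceDir l} (mollifier d n)) (spaceDir l) s), neg_neg]
      simp only [h4, Finset.sum_neg_distrib] at h3
      linarith
    have h5 := (Finset.sum_eq_zero_iff_of_nonneg fun l _ => by positivity).1 h2 j
      (Finset.mem_univ j)
    have h6 := U.hasDeriv_smooth (mollifier d n) (spaceDir j) s
    rwa [norm_eq_zero.1 (pow_eq_zero_iff two_ne_zero |>.1 h5)] at h6
  intro x
  have h2 := (U.act (x, 0)).continuous.tendsto s |>.comp (U.tendsto_smooth_mollifier s)
  refine tendsto_nhds_unique h2 ((U.tendsto_smooth_mollifier s).congr fun n => ?_)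
  exact (h1 n x).symm

end UnitaryRep

namespace UnitaryRep

variable {d : ℕ} {H : Type*} [NormedAddCommGroup H] [InnerProductSpace ℝ H] [CompleteSpace H]
  (U : UnitaryRep d H) (κ κ' : 𝓓((⊤ : Opens (SpaceTime d)), ℝ))
  (η : 𝓓((⊤ : Opens (EuclideanSpace ℝ (Fin d))), ℝ))

/-! ### The homotopy formula -/

theorem integrable_anchor_kernel :
    Integrable (fun p : SpaceTime d × EuclideanSpace ℝ (Fin d) => κ p.1 * η p.2) :=
  (integrable_testFunction κ).mul_prod (integrable_testFunction η)

theorem measurable_anchor_point :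
    Measurable fun p : SpaceTime d × EuclideanSpace ℝ (Fin d) => ((p.2, p.1.2) : SpaceTime d) := by
  fun_prop

theorem measurable_anchor_point_neg :
    Measurable fun p : SpaceTime d × EuclideanSpace ℝ (Fin d) => -((p.2, p.1.2) : SpaceTime d) :=
  measurable_anchor_point.neg

/-- The operator `u ↦ ∫∫ κ(x, t) η(y) U_{(y, t)} u dy dx dt`, which pairs with `κ` the spatial
average with weight `η`, a function of time only. -/
abbrev anchor : H →L[ℝ] H :=
  U.avg volume (fun p : SpaceTime d × EuclideanSpace ℝ (Fin d) => κ p.1 * η p.2)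
    fun p => (p.2, p.1.2)

/-- The adjoint of `anchor`. -/
abbrev anchorAdj : H →L[ℝ] H :=
  U.avg volume (fun p : SpaceTime d × EuclideanSpace ℝ (Fin d) => κ p.1 * η p.2)
    fun p => -(p.2, p.1.2)

theorem anchor_apply_symm (u : H) :
    U.anchor κ η u = ∫ y, η y • ∫ z, κ z • U.act (y, z.2) u := by
  rw [anchor, U.avg_apply (integrable_anchor_kernel κ η) measurable_anchor_point,
    Measure.volume_eq_prod, integral_prod_symm _
      (U.integrable_smul_act (integrable_anchor_kernel κ η) measurable_anchor_point u)]
  simp only [mul_comm (κ _), mul_smul, integral_smul]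

/-- The anchored average depends on time only: of the derivative in the direction `m` only the time
component remains. -/
theorem anchor_lineDeriv {m : SpaceTime d} {v w : H} (h : U.HasDeriv (0, m.2) v w) :
    U.anchor (∂_{m} κ) η v = -U.anchor κ η w := by
  rw [anchor_apply_symm, anchor_apply_symm, ← integral_neg]
  refine integral_congr_ae (ae_of_all _ fun y => ?_)
  simp only [← smul_neg]
  congr 1
  have hc : Continuous fun z : SpaceTime d => ((y, z.2) : SpaceTime d) := by fun_prop
  refine integral_smul_eq_neg_of_hasLineDerivAt κ ((U.continuous_act v).comp hc)
    ((U.continuous_act w).comp hc) fun z => ?_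
  have h1 := h.hasLineDerivAt (y, z.2)
  refine HasDerivAt.congr_of_eventuallyEq (h1 : HasDerivAt _ _ _)
    (Eventually.of_forall fun s => ?_)
  simp

theorem anchorAdj_apply (u : H) :
    U.anchorAdj κ η u = ∫ z, κ z • ∫ y, η y • U.act (-(y, z.2)) u := by
  rw [anchorAdj, U.avg_apply (integrable_anchor_kernel κ η) measurable_anchor_point_neg,
    Measure.volume_eq_prod, integral_prod _
      (U.integrable_smul_act (integrable_anchor_kernel κ η) measurable_anchor_point_neg u)]
  simp only [mul_smul, integral_smul]

theorem inner_anchor_left (u v : H) : ⟪U.anchor κ η u, v⟫ = ⟪u, U.anchorAdj κ η v⟫ :=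
  U.inner_avg_left (integrable_anchor_kernel κ η) measurable_anchor_point u v

theorem anchorAdj_lineDeriv {j : Fin d} {v w : H} (h : U.HasDeriv (spaceDir j) v w) :
    U.anchorAdj κ (∂_{unitVec j} η) v = U.anchorAdj κ η w := by
  rw [anchorAdj_apply, anchorAdj_apply]
  refine integral_congr_ae (ae_of_all _ fun z => ?_)
  simp only
  congr 1
  have hc : Continuous fun y : EuclideanSpace ℝ (Fin d) => -((y, z.2) : SpaceTime d) := by fun_prop
  have := integral_smul_eq_neg_of_hasLineDerivAt (μ := volume) η (m := unitVec j)
    (f := fun y => U.act (-(y, z.2)) v) (f' := fun y => -U.act (-(y, z.2)) w)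
    ((U.continuous_act v).comp hc) ((U.continuous_act w).comp hc).neg fun y => by
      have h1 : HasDerivAt (fun s : ℝ => U.act (-(y, z.2) + s • spaceDir j) v)
          (U.act (-(y, z.2)) w) (-0) := by
        rw [neg_zero]; exact h.hasLineDerivAt (-(y, z.2))
      have h2 := HasDerivAt.scomp (0 : ℝ) h1 (h := fun r => -r) (hasDerivAt_neg 0)
      simp only [neg_smul, one_smul] at h2
      refine HasDerivAt.congr_of_eventuallyEq h2 (Eventually.of_forall fun r => ?_)
      simp [add_comm]
  rw [this]
  simp [integral_neg]

theorem smooth_anchorAdj_comm (u : H) :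
    U.smooth κ' (U.anchorAdj κ η u) = U.anchorAdj κ η (U.smooth κ' u) :=
  U.avg_comm (integrable_testFunction κ') measurable_neg (integrable_anchor_kernel κ η)
    measurable_anchor_point_neg u

/-- The measure over which the homotopy formula integrates: over `(x, t)`, over the anchor point
`y`, and over the parameter `s ∈ [0, 1]` of the segment from `y` to `x`. -/
abbrev homotopyMeasure (d : ℕ) :
    Measure (SpaceTime d × (EuclideanSpace ℝ (Fin d) × ℝ)) :=
  volume.prod (volume.prod (volume.restrict (Icc 0 1)))

/-- The point `(y + s (x - y), t)`. -/
abbrev homotopyPoint (p : SpaceTime d × (EuclideanSpace ℝ (Fin d) × ℝ)) : SpaceTime d :=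
  (p.2.1 + p.2.2 • (p.1.1 - p.2.1), p.1.2)

/-- The weight `κ(x, t) η(y) (x - y)_j`. -/
abbrev homotopyKernel (j : Fin d) (p : SpaceTime d × (EuclideanSpace ℝ (Fin d) × ℝ)) : ℝ :=
  κ p.1 * (η p.2.1 * (p.1.1 j - p.2.1 j))

theorem measurable_homotopyPoint : Measurable (homotopyPoint (d := d)) := by
  have : Continuous (homotopyPoint (d := d)) := by unfold homotopyPoint; fun_prop
  exact this.measurable

theorem integrable_homotopyKernel_of_integrable {κ : SpaceTime d → ℝ} (j : Fin d)
    (hκ : Integrable κ) (hκj : Integrable fun z : SpaceTime d => κ z * z.1 j) :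
    Integrable (fun p : SpaceTime d × (EuclideanSpace ℝ (Fin d) × ℝ) =>
      κ p.1 * (η p.2.1 * (p.1.1 j - p.2.1 j))) (homotopyMeasure d) := by
  have h1 : Integrable (fun _ : ℝ => (1 : ℝ)) (volume.restrict (Icc (0 : ℝ) 1)) :=
    integrable_const _
  have hη : Integrable (fun y : EuclideanSpace ℝ (Fin d) => η y * y j) :=
    (η.continuous.mul (by fun_prop)).integrable_of_hasCompactSupport η.hasCompactSupport.mul_right
  have h2 := hκj.mul_prod ((integrable_testFunction (μ := volume) η).mul_prod h1)
  have h3 := hκ.mul_prod (hη.mul_prod h1)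
  refine (h2.sub h3).congr (ae_of_all _ fun p => ?_)
  simp only [Pi.sub_apply]
  ring

theorem integrable_homotopyKernel (j : Fin d) :
    Integrable (homotopyKernel κ η j) (homotopyMeasure d) :=
  integrable_homotopyKernel_of_integrable η j (integrable_testFunction κ)
    ((κ.continuous.mul (by fun_prop)).integrable_of_hasCompactSupport
      κ.hasCompactSupport.mul_right)

/-- The homotopy operator: it pairs with the test function `κ` the function
`φ(x, t) = ∫ η(y) ∫₀¹ (x - y) · g(y + s (x - y), t) ds dy`, which for `∫ η = 1` is the potential of
a potential field `g`, normalized by `∫ η(y) φ(y, t) dy = 0`. -/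
def lift : VecField d H →L[ℝ] H :=
  ∑ j, (U.avg (homotopyMeasure d) (homotopyKernel κ η j) homotopyPoint).comp (comp j)

theorem lift_apply (g : VecField d H) :
    U.lift κ η g = ∑ j, U.avg (homotopyMeasure d) (homotopyKernel κ η j) homotopyPoint (g j) := by
  simp [lift]

/-- The fundamental theorem of calculus along the segment from `y` to `x`, for the orbit of a smooth
vector. -/
theorem act_sub_act_eq_integral (κ' : 𝓓((⊤ : Opens (SpaceTime d)), ℝ)) (u : H)
    (x y : EuclideanSpace ℝ (Fin d)) (t : ℝ) :
    ∫ s in Icc (0 : ℝ) 1, ∑ j, (x j - y j) •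
      U.act (y + s • (x - y), t) (U.smooth (∂_{spaceDir j} κ') u) =
        U.act (x, t) (U.smooth κ' u) - U.act (y, t) (U.smooth κ' u) := by
  have hm : (∑ j, (x j - y j) • (spaceDir j : SpaceTime d)) = (x - y, 0) := by
    ext i
    · simp [Prod.fst_sum, Finset.sum_apply, Pi.single_apply]
    · simp [Prod.snd_sum]
  have hD : U.smooth (∂_{((x - y, 0) : SpaceTime d)} κ') u =
      ∑ j, (x j - y j) • U.smooth (∂_{spaceDir j} κ') u := by
    have : ∀ s : Finset (Fin d),
        U.smooth (∂_{∑ j ∈ s, (x j - y j) • (spaceDir j : SpaceTime d)} κ') u =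
          ∑ j ∈ s, (x j - y j) • U.smooth (∂_{spaceDir j} κ') u := fun s => by
      induction s using Finset.induction_on with
      | empty =>
        simp only [Finset.sum_empty]
        have h0 : (∂_{(0 : SpaceTime d)} κ' : 𝓓((⊤ : Opens (SpaceTime d)), ℝ)) = (0 : ℝ) • κ' := by
          ext z
          simp
        rw [h0, smooth_smul, zero_smul]
      | insert j s hj ih =>
        rw [Finset.sum_insert hj, Finset.sum_insert hj, LineDeriv.lineDerivOp_left_add, smooth_add,
          ih, LineDeriv.lineDerivOp_left_smul, smooth_smul]
    rw [← hm]
    exact this _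
  have hder : ∀ s : ℝ, HasDerivAt (fun s : ℝ => U.act ((y, t) + s • (x - y, 0)) (U.smooth κ' u))
      (U.act ((y, t) + s • (x - y, 0)) (U.smooth (∂_{((x - y, 0) : SpaceTime d)} κ') u)) s :=
    fun s => (U.hasDeriv_smooth κ' (x - y, 0) u).hasDerivAt (y, t) s
  have hFTC := intervalIntegral.integral_eq_sub_of_hasDerivAt (a := 0) (b := 1)
    (fun s _ => hder s) (((U.continuous_act _).comp (by fun_prop)).intervalIntegrable _ _)
  rw [intervalIntegral.integral_of_le zero_le_one, ← integral_Icc_eq_integral_Ioc] at hFTC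
  simp only [zero_smul, add_zero, one_smul, Prod.mk_add_mk, add_sub_cancel, Prod.smul_mk,
    smul_zero] at hFTC
  rw [← hFTC]
  refine integral_congr_ae (ae_of_all _ fun s => ?_)
  simp only [hD, map_sum, map_smul]

/-- On the gradient of a smooth vector `v`, the homotopy formula returns `v` up to a function of
time. -/
theorem lift_gradSmooth (hη : ∫ y, η y = 1) (u : H) :
    U.lift κ η (U.gradSmooth κ' u) = U.pair κ (U.smooth κ' u) - U.anchor κ η (U.smooth κ' u) := by
  have hint : ∀ j, Integrable (fun p => homotopyKernel κ η j p •
      U.act (homotopyPoint p) (U.smooth (∂_{spaceDir j} κ') u)) (homotopyMeasure d) := fun j =>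
    U.integrable_smul_act (integrable_homotopyKernel κ η j) measurable_homotopyPoint _
  have hsum := integrable_finsetSum Finset.univ fun j _ => hint j
  set v := U.smooth κ' u with hv
  have h1 : U.lift κ η (U.gradSmooth κ' u) =
      ∫ z, ∫ y, (κ z * η y) • (U.act z v - U.act (y, z.2) v) := by
    rw [lift_apply]
    simp only [gradSmooth_apply, U.avg_apply (integrable_homotopyKernel κ η _)
      measurable_homotopyPoint]
    rw [← integral_finsetSum _ fun j _ => hint j, integral_prod _ hsum]
    refine integral_congr_ae ?_
    filter_upwards [hsum.prod_right_ae] with z hz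
    rw [integral_prod _ hz]
    refine integral_congr_ae (ae_of_all _ fun y => ?_)
    simp only
    rw [hv, ← U.act_sub_act_eq_integral κ' u z.1 y z.2, ← integral_smul]
    refine integral_congr_ae (ae_of_all _ fun s => ?_)
    simp only [homotopyKernel, Finset.smul_sum, smul_smul, homotopyPoint, mul_assoc]
  have h2 : Integrable fun p : SpaceTime d × EuclideanSpace ℝ (Fin d) =>
      (κ p.1 * η p.2) • U.act p.1 v :=
    U.integrable_smul_act (integrable_anchor_kernel κ η) measurable_fst v
  have h3 : Integrable fun p : SpaceTime d × EuclideanSpace ℝ (Fin d) =>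
      (κ p.1 * η p.2) • U.act (p.2, p.1.2) v :=
    U.integrable_smul_act (integrable_anchor_kernel κ η) measurable_anchor_point v
  rw [h1]
  simp only [smul_sub]
  rw [← integral_prod (fun p : SpaceTime d × EuclideanSpace ℝ (Fin d) =>
    (κ p.1 * η p.2) • U.act p.1 v - (κ p.1 * η p.2) • U.act (p.2, p.1.2) v) (h2.sub h3),
    ← Measure.volume_eq_prod, integral_sub h2 h3, anchor,
    U.avg_apply (integrable_anchor_kernel κ η) measurable_anchor_point, pair_apply]
  congr 1
  rw [Measure.volume_eq_prod, integral_prod _ h2]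
  refine integral_congr_ae (ae_of_all _ fun z => ?_)
  simp only
  rw [integral_smul_const, integral_const_mul, hη, mul_one]

/-- The homotopy formula recovers a potential field as a gradient. -/
theorem lift_spaceDeriv (hη : ∫ y, η y = 1) {g : VecField d H} (hg : g ∈ U.potential)
    (k : Fin d) : U.lift (∂_{spaceDir k} κ) η g = -U.pair κ (g k) := by
  have := U.potential_induction (T := U.lift (∂_{spaceDir k} κ) η)
    (T' := -(U.pair κ).comp (comp k)) (fun κ' u => by
      have h0 : U.HasDeriv (0, (spaceDir k : SpaceTime d).2) (U.smooth κ' u) 0 := by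
        change HasDerivAt (fun s : ℝ => U.act (0 + s • ((0 : EuclideanSpace ℝ (Fin d)), (0 : ℝ)))
          (U.smooth κ' u)) 0 0
        simp only [Prod.smul_mk, smul_zero]
        exact hasDerivAt_const _ _
      rw [lift_gradSmooth _ _ _ _ hη, anchor_lineDeriv _ _ _ h0, map_zero,
        U.pair_lineDeriv κ (U.hasDeriv_smooth κ' (spaceDir k) u)]
      simp) hg
  simpa using this

theorem lift_timeDeriv_gradSmooth (hη : ∫ y, η y = 1) (u : H) :
    U.lift (∂_{timeDir d} κ) η (U.gradSmooth κ' u) =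
      -(U.pair κ (U.smooth (∂_{timeDir d} κ') u) -
        U.anchor κ η (U.smooth (∂_{timeDir d} κ') u)) := by
  have h := U.hasDeriv_smooth κ' (timeDir d) u
  rw [lift_gradSmooth _ _ _ _ hη, pair_lineDeriv _ _ h, anchor_lineDeriv _ _ _ h]
  abel

end UnitaryRep

/-! ### Weak limits -/

/-- Weak sequential compactness of balls of a Hilbert space, along an ultrafilter. -/
theorem exists_weak_limit {V : Type*} [NormedAddCommGroup V] [InnerProductSpace ℝ V]
    [CompleteSpace V] {x : ℕ → V} {C : ℝ} (hx : ∀ n, ‖x n‖ ≤ C) :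
    ∃ y : V, ∀ z, Tendsto (fun n => ⟪x n, z⟫) (hyperfilter ℕ) (𝓝 ⟪y, z⟫) := by
  let X : ℕ → WeakDual ℝ V := fun n => StrongDual.toWeakDual (InnerProductSpace.toDual ℝ V (x n))
  have hK := WeakDual.isCompact_closedBall (0 : StrongDual ℝ V) C
  obtain ⟨Y, -, hY⟩ := hK.ultrafilter_le_nhds ((hyperfilter ℕ).map X) (by
    rw [le_principal_iff]
    refine mem_map.2 (Eventually.of_forall fun n => ?_)
    simpa [X] using hx n)
  refine ⟨(InnerProductSpace.toDual ℝ V).symm (WeakDual.toStrongDual Y), fun z => ?_⟩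
  have h1 : Tendsto X (hyperfilter ℕ) (𝓝 Y) := hY
  have h2 := ((WeakDual.eval_continuous z).tendsto Y).comp h1
  rw [InnerProductSpace.toDual_symm_apply]
  exact h2

theorem norm_le_of_weak_limit {V : Type*} [NormedAddCommGroup V] [InnerProductSpace ℝ V]
    {x : ℕ → V} {y : V} {C : ℝ} (hC : 0 ≤ C) (hx : ∀ n, ‖x n‖ ≤ C)
    (h : Tendsto (fun n => ⟪x n, y⟫) (hyperfilter ℕ) (𝓝 ⟪y, y⟫)) : ‖y‖ ≤ C := by
  have h1 : ⟪y, y⟫ ≤ C * ‖y‖ := le_of_tendsto h (Eventually.of_forall fun n =>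
    (real_inner_le_norm _ _).trans (mul_le_mul_of_nonneg_right (hx n) (norm_nonneg y)))
  rw [real_inner_self_eq_norm_sq, sq] at h1
  rcases (norm_nonneg y).eq_or_lt with h0 | h0
  · rwa [← h0]
  · exact le_of_mul_le_mul_right h1 h0

namespace UnitaryRep

variable {d : ℕ} {H : Type*} [NormedAddCommGroup H] [InnerProductSpace ℝ H] [CompleteSpace H]
  (U : UnitaryRep d H)

/-! ### The regularized parabolic problem -/

section Parabolic

variable (A : VecField d H →L[ℝ] VecField d H)

/-- `φ` solves the corrector equation `∂_t φ = ∇ · A (∇φ + e)` in the weak form of `H`, regularized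
by a massive term and by composing the derivatives with a mollifier, so that they become bounded
operators. -/
def IsApproxCorrector (n : ℕ) (e : VecField d H) (φ : H) : Prop :=
  ∀ v : H, 1 / ((n : ℝ) + 1) * ⟪φ, v⟫ +
    ⟪U.smooth (∂_{timeDir d} (mollifier d n)) φ, U.smooth (mollifier d n) v⟫ +
    ⟪A (U.gradSmooth (mollifier d n) φ + e), U.gradSmooth (mollifier d n) v⟫ = 0

/-- `gradSmooth` as a continuous linear map. -/
def gradSmoothL (κ : 𝓓((⊤ : Opens (SpaceTime d)), ℝ)) : H →L[ℝ] VecField d H :=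
  (PiLp.continuousLinearEquiv 2 ℝ fun _ : Fin d => H).symm.toContinuousLinearMap.comp
    (ContinuousLinearMap.pi fun j => U.smooth (∂_{spaceDir j} κ))

theorem gradSmoothL_apply (κ : 𝓓((⊤ : Opens (SpaceTime d)), ℝ)) (u : H) :
    U.gradSmoothL κ u = U.gradSmooth κ u := rfl

/-- The (mollified) time derivative is antisymmetric, hence does not contribute to the energy. -/
theorem inner_smooth_lineDeriv_self (κ : 𝓓((⊤ : Opens (SpaceTime d)), ℝ)) (m : SpaceTime d)
    (u : H) : ⟪U.smooth (∂_{m} κ) u, U.smooth κ u⟫ = 0 := by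
  have h := U.hasDeriv_smooth κ m u
  have h1 := h.inner_eq_neg h
  rw [real_inner_comm (U.smooth (∂_{m} κ) u) (U.smooth κ u)] at h1
  linarith

variable {A} {lam : ℝ}

/-- The Lax–Milgram theorem; the massive term makes the form coercive. -/
theorem exists_isApproxCorrector (hlam : 0 < lam) (hA : ∀ f, lam * ‖f‖ ^ 2 ≤ ⟪A f, f⟫) (n : ℕ)
    (e : VecField d H) : ∃ φ, U.IsApproxCorrector A n e φ := by
  let ε : ℝ := 1 / ((n : ℝ) + 1)
  have hε : 0 < ε := by positivity
  let Dt := U.smooth (∂_{timeDir d} (mollifier d n))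
  let R := U.smooth (mollifier d n)
  let D := U.gradSmoothL (mollifier d n)
  let T : H →L[ℝ] H := ε • ContinuousLinearMap.id ℝ H + R.adjoint.comp Dt +
    D.adjoint.comp (A.comp D)
  let B : H →L[ℝ] H →L[ℝ] ℝ := (innerSL ℝ).comp T
  have hB : ∀ φ v, B φ v = ε * ⟪φ, v⟫ + ⟪Dt φ, R v⟫ + ⟪A (D φ), D v⟫ := fun φ v => by
    simp only [B, T, ContinuousLinearMap.comp_apply, innerSL_apply_apply,
      add_apply, inner_add_left, ContinuousLinearMap.adjoint_inner_left,
      smul_apply, ContinuousLinearMap.id_apply, real_inner_smul_left]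
  have hco : IsCoercive B := by
    refine ⟨ε, hε, fun φ => ?_⟩
    rw [hB, show ⟪Dt φ, R φ⟫ = 0 from U.inner_smooth_lineDeriv_self _ _ φ,
      real_inner_self_eq_norm_sq]
    have := hA (D φ)
    have h2 : 0 ≤ lam * ‖D φ‖ ^ 2 := by positivity
    nlinarith
  refine ⟨hco.continuousLinearEquivOfBilin.symm (-(D.adjoint (A e))), fun v => ?_⟩
  set φ := hco.continuousLinearEquivOfBilin.symm (-(D.adjoint (A e)))
  have h1 := hco.continuousLinearEquivOfBilin_apply φ v
  rw [ContinuousLinearEquiv.apply_symm_apply, hB, inner_neg_left,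
    ContinuousLinearMap.adjoint_inner_left] at h1
  have h2 : ⟪A (D φ + e), D v⟫ = ⟪A (D φ), D v⟫ + ⟪A e, D v⟫ := by rw [map_add, inner_add_left]
  change ε * ⟪φ, v⟫ + ⟪Dt φ, R v⟫ + ⟪A (D φ + e), D v⟫ = 0
  rw [h2]
  linarith

variable {U} {n : ℕ} {e : VecField d H} {φ : H}

theorem IsApproxCorrector.sum_smul {ι : Type*} (s : Finset ι) {e : ι → VecField d H} {φ : ι → H}
    (h : ∀ i, U.IsApproxCorrector A n (e i) (φ i)) (ξ : ι → ℝ) :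
    U.IsApproxCorrector A n (∑ i ∈ s, ξ i • e i) (∑ i ∈ s, ξ i • φ i) := by
  intro v
  have h1 : U.gradSmooth (mollifier d n) (∑ i ∈ s, ξ i • φ i) + ∑ i ∈ s, ξ i • e i =
      ∑ i ∈ s, ξ i • (U.gradSmooth (mollifier d n) (φ i) + e i) := by
    simp only [← gradSmoothL_apply, map_sum, map_smul, smul_add, Finset.sum_add_distrib]
  rw [h1]
  simp only [map_sum, map_smul, sum_inner, real_inner_smul_left, Finset.mul_sum,
    ← Finset.sum_add_distrib]
  refine Finset.sum_eq_zero fun i _ => ?_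
  have := h i v
  linear_combination ξ i * this

section Estimates

variable (hA : ∀ f, lam * ‖f‖ ^ 2 ≤ ⟪A f, f⟫) (hA1 : ∀ f, ‖A f‖ ≤ ‖f‖)
  (h : U.IsApproxCorrector A n e φ)

include hA h

theorem IsApproxCorrector.energy :
    lam * ‖U.gradSmooth (mollifier d n) φ + e‖ ^ 2 + 1 / ((n : ℝ) + 1) * ‖φ‖ ^ 2 ≤
      ⟪A (U.gradSmooth (mollifier d n) φ + e), e⟫ := by
  have h1 := h φ
  rw [U.inner_smooth_lineDeriv_self, real_inner_self_eq_norm_sq] at h1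
  have h2 := hA (U.gradSmooth (mollifier d n) φ + e)
  rw [inner_add_right] at h2
  linarith

include hA1

/-- A bound for the gradient that does not depend on the regularization. -/
theorem IsApproxCorrector.norm_le (hlam : 0 < lam) :
    ‖U.gradSmooth (mollifier d n) φ + e‖ ≤ ‖e‖ / lam := by
  have h1 := h.energy hA
  have h2 : 0 ≤ 1 / ((n : ℝ) + 1) * ‖φ‖ ^ 2 := by positivity
  have h3 := (real_inner_le_norm (A (U.gradSmooth (mollifier d n) φ + e)) e).trans
    (mul_le_mul_of_nonneg_right (hA1 _) (norm_nonneg e))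
  rw [le_div_iff₀ hlam]
  rcases (norm_nonneg (U.gradSmooth (mollifier d n) φ + e)).eq_or_lt with h0 | h0
  · rw [← h0, zero_mul]
    exact norm_nonneg e
  · refine le_of_mul_le_mul_left ?_ h0
    nlinarith

/-- The corrector itself is bounded only up to the factor `√(n + 1)`, which suffices for the massive
term to vanish in the limit. -/
theorem IsApproxCorrector.norm_sq_le (hlam : 0 < lam) :
    1 / ((n : ℝ) + 1) * ‖φ‖ ^ 2 ≤ ‖e‖ ^ 2 / lam := by
  have h1 := h.energy hA
  have h2 : 0 ≤ lam * ‖U.gradSmooth (mollifier d n) φ + e‖ ^ 2 := by positivity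
  have h3 := (real_inner_le_norm (A (U.gradSmooth (mollifier d n) φ + e)) e).trans
    (mul_le_mul_of_nonneg_right ((hA1 _).trans (h.norm_le hA hA1 hlam)) (norm_nonneg e))
  have h4 : ‖e‖ / lam * ‖e‖ = ‖e‖ ^ 2 / lam := by ring
  linarith

end Estimates

variable (n φ)

/-- The regularized equation, tested with smooth vectors from which the anchored average has been
removed. For such test vectors the time derivative depends on the gradient of `φ` only, through the
homotopy operator, so that the left hand side passes to weak limits of the gradients. -/
theorem IsApproxCorrector.weak_eq (h : U.IsApproxCorrector A n e φ)
    (κ : 𝓓((⊤ : Opens (SpaceTime d)), ℝ)) (η : 𝓓((⊤ : Opens (EuclideanSpace ℝ (Fin d))), ℝ))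
    (hη : ∫ y, η y = 1) (u : H) :
    ⟪U.lift (∂_{timeDir d} κ) η (U.gradSmooth (mollifier d n) φ) -
      ∑ j, (U.pair (∂_{spaceDir j} κ) - U.anchor κ (∂_{unitVec j} η))
        (A (U.gradSmooth (mollifier d n) φ + e) j), U.smooth (mollifier d n) u⟫ =
      1 / ((n : ℝ) + 1) * ⟪φ, (U.smooth κ - U.anchorAdj κ η) u⟫ := by
  have h1 := h ((U.smooth κ - U.anchorAdj κ η) u)
  set ρ := mollifier d n
  set q := A (U.gradSmooth ρ φ + e)
  have h2 : U.smooth ρ ((U.smooth κ - U.anchorAdj κ η) u) =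
      U.smooth κ (U.smooth ρ u) - U.anchorAdj κ η (U.smooth ρ u) := by
    rw [sub_apply, map_sub, smooth_comm, smooth_anchorAdj_comm]
  have h3 : ∀ j, U.smooth (∂_{spaceDir j} ρ) ((U.smooth κ - U.anchorAdj κ η) u) =
      U.smooth (∂_{spaceDir j} κ) (U.smooth ρ u) -
        U.anchorAdj κ (∂_{unitVec j} η) (U.smooth ρ u) := fun j => by
    have hd := U.hasDeriv_smooth ρ (spaceDir j) u
    rw [sub_apply, map_sub, smooth_comm, smooth_anchorAdj_comm,
      smooth_lineDeriv _ _ hd, anchorAdj_lineDeriv _ _ _ hd]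
  rw [h2, inner_vecField] at h1
  simp only [gradSmooth_apply, h3] at h1
  rw [inner_sub_left, U.lift_timeDeriv_gradSmooth κ ρ η hη, inner_neg_left, inner_sub_left,
    sum_inner]
  have h4 : ∀ j, ⟪(U.pair (∂_{spaceDir j} κ) - U.anchor κ (∂_{unitVec j} η)) (q j),
      U.smooth ρ u⟫ = ⟪q j, U.smooth (∂_{spaceDir j} κ) (U.smooth ρ u) -
        U.anchorAdj κ (∂_{unitVec j} η) (U.smooth ρ u)⟫ := fun j => by
    rw [sub_apply, inner_sub_left, inner_sub_right, inner_pair_left,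
      inner_anchor_left]
  simp only [h4]
  rw [inner_sub_right] at h1
  rw [inner_pair_left, inner_anchor_left]
  linarith

end Parabolic

end UnitaryRep

/-- Weak convergence along the hyperfilter is preserved by continuous linear maps. -/
theorem tendsto_inner_clm {V W : Type*} [NormedAddCommGroup V] [InnerProductSpace ℝ V]
    [CompleteSpace V] [NormedAddCommGroup W] [InnerProductSpace ℝ W] [CompleteSpace W]
    {x : ℕ → V} {y : V} (h : ∀ z, Tendsto (fun n => ⟪x n, z⟫) (hyperfilter ℕ) (𝓝 ⟪y, z⟫))
    (T : V →L[ℝ] W) (z : W) :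
    Tendsto (fun n => ⟪T (x n), z⟫) (hyperfilter ℕ) (𝓝 ⟪T y, z⟫) := by
  simpa only [ContinuousLinearMap.adjoint_inner_right] using h (T.adjoint z)

/-! ### Stationary gradients of the parabolic correctors -/

namespace UnitaryRep

variable {d : ℕ} {H : Type*} [NormedAddCommGroup H] [InnerProductSpace ℝ H] [CompleteSpace H]
  (U : UnitaryRep d H)

/-- The constant vector field `ξ`, where `one` plays the role of the constant function `1`. -/
def constField (one : H) (ξ : Fin d → ℝ) : VecField d H := WithLp.toLp 2 fun j => ξ j • one

@[simp] theorem constField_apply (one : H) (ξ : Fin d → ℝ) (j : Fin d) :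
    constField one ξ j = ξ j • one := rfl

theorem norm_sq_constField {one : H} (hone : ‖one‖ = 1) (ξ : Fin d → ℝ) :
    ‖constField one ξ‖ ^ 2 = ∑ j, ξ j ^ 2 := by
  rw [PiLp.norm_sq_eq_of_L2]
  simp [norm_smul, hone]

theorem sum_smul_constField_single (one : H) (ξ : Fin d → ℝ) :
    ∑ i, ξ i • constField one (Pi.single i 1) = constField one ξ := by
  ext j
  simp [Pi.single_apply]

theorem inner_constField (f : VecField d H) (one : H) (ξ : Fin d → ℝ) :
    ⟪f, constField one ξ⟫ = ∑ j, ξ j * ⟪f j, one⟫ := by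
  simp [inner_vecField, real_inner_smul_right]

/-- Adding a potential field does not decrease the norm of a constant field, as the two are
orthogonal. -/
theorem norm_constField_le {one : H} (hinv : U.Invariant one) (ξ : Fin d → ℝ) {g : VecField d H}
    (hg : g ∈ U.potential) : ‖constField one ξ‖ ^ 2 ≤ ‖g + constField one ξ‖ ^ 2 := by
  rw [norm_add_sq_real, inner_constField]
  simp only [U.inner_potential_invariant hg hinv, mul_zero, Finset.sum_const_zero]
  nlinarith [sq_nonneg ‖g‖]

theorem sum_sq_inner_le {one : H} (hone : ‖one‖ = 1) (f : VecField d H) :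
    ∑ j, ⟪f j, one⟫ ^ 2 ≤ ‖f‖ ^ 2 := by
  rw [PiLp.norm_sq_eq_of_L2]
  refine Finset.sum_le_sum fun j _ => ?_
  have := abs_real_inner_le_norm (f j) one
  rw [hone, mul_one] at this
  exact sq_le_sq.2 (this.trans_eq (abs_of_nonneg (norm_nonneg _)).symm)

theorem norm_constField_single {one : H} (hone : ‖one‖ = 1) (i : Fin d) :
    ‖constField one (Pi.single i 1 : Fin d → ℝ)‖ = 1 := by
  have := norm_sq_constField hone (Pi.single i 1 : Fin d → ℝ)
  have h2 : ∑ j, (Pi.single i 1 : Fin d → ℝ) j ^ 2 = 1 := by simp [Pi.single_apply]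
  rw [h2] at this
  exact (pow_eq_one_iff_of_nonneg (norm_nonneg _) two_ne_zero).1 this

/-- Existence of the stationary gradients of the parabolic correctors, as weak limits of the
regularized gradients. The third property consists of the bounds `λ|ξ|² ≤ ξ · ā ξ` and
`|ā ξ|² ≤ λ⁻¹ ξ · ā ξ`. The fourth is `∂_t φ = ∇ · q`, tested with `κ`, up to a function of time
which is fixed by the anchored averages. -/
theorem exists_corrector {A : VecField d H →L[ℝ] VecField d H} {lam : ℝ} (hlam : 0 < lam)
    (hA : ∀ f, lam * ‖f‖ ^ 2 ≤ ⟪A f, f⟫) (hA1 : ∀ f, ‖A f‖ ≤ ‖f‖) {one : H} (hone : ‖one‖ = 1)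
    (hinv : U.Invariant one) :
    ∃ G : Fin d → VecField d H,
      (∀ i, G i ∈ U.potential) ∧
      (∀ i, ‖G i + constField one (Pi.single i 1)‖ ≤ 1 / lam) ∧
      (∀ ξ : Fin d → ℝ,
        lam * ∑ j, ξ j ^ 2 ≤
          ∑ j, ξ j * ⟪A (∑ i, ξ i • (G i + constField one (Pi.single i 1))) j, one⟫ ∧
        ∑ j, ⟪A (∑ i, ξ i • (G i + constField one (Pi.single i 1))) j, one⟫ ^ 2 ≤
          1 / lam * ∑ j, ξ j * ⟪A (∑ i, ξ i • (G i + constField one (Pi.single i 1))) j, one⟫) ∧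
      ∀ i (κ : 𝓓((⊤ : Opens (SpaceTime d)), ℝ))
        (η : 𝓓((⊤ : Opens (EuclideanSpace ℝ (Fin d))), ℝ)), ∫ y, η y = 1 →
        U.lift (∂_{timeDir d} κ) η (G i) =
          ∑ j, (U.pair (∂_{spaceDir j} κ) - U.anchor κ (∂_{unitVec j} η))
            (A (G i + constField one (Pi.single i 1)) j) := by
  set e : Fin d → VecField d H := fun i => constField one (Pi.single i 1) with he
  have hnorm : ∀ i, ‖e i‖ = 1 := norm_constField_single hone
  choose φ hφ using fun n i => U.exists_isApproxCorrector hlam hA n (e i)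
  let g : ℕ → Fin d → VecField d H := fun n i => U.gradSmooth (mollifier d n) (φ n i)
  have hbound : ∀ i n, ‖g n i + e i‖ ≤ 1 / lam := fun i n => by
    simpa only [hnorm] using (hφ n i).norm_le hA hA1 hlam
  choose y hy using fun i => exists_weak_limit (hbound i)
  have hG : ∀ i z, Tendsto (fun n => ⟪g n i, z⟫) (hyperfilter ℕ) (𝓝 ⟪y i - e i, z⟫) :=
    fun i z => by
      have := (hy i z).sub_const ⟪e i, z⟫
      simpa only [inner_add_left, inner_sub_left, add_sub_cancel_right] using this
  have hye : ∀ i, y i - e i + constField one (Pi.single i 1) = y i := fun i =>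
    sub_add_cancel _ _
  refine ⟨fun i => y i - e i, fun i => ?_, fun i => ?_, fun ξ => ?_, fun i κ η hη => ?_⟩
  · -- a closed subspace is weakly closed, since it is its double orthogonal complement
    rw [← Submodule.orthogonal_orthogonal U.potential, Submodule.mem_orthogonal']
    intro z hz
    refine tendsto_nhds_unique (hG i z) (tendsto_const_nhds.congr fun n => ?_)
    exact (Submodule.inner_right_of_mem_orthogonal (U.gradSmooth_mem_potential _ _) hz).symm
  · simp only [hye]
    exact norm_le_of_weak_limit (by positivity) (hbound i) (hy i (y i))
  · simp only [hye]
    have hsol := fun n => IsApproxCorrector.sum_smul Finset.univ (hφ n) ξ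
    have hsum : ∑ i, ξ i • e i = constField one ξ := sum_smul_constField_single one ξ
    rw [hsum] at hsol
    have hx : ∀ n, U.gradSmooth (mollifier d n) (∑ i, ξ i • φ n i) + constField one ξ =
        ∑ i, ξ i • (g n i + e i) := fun n => by
      simp only [← hsum, g, ← gradSmoothL_apply, map_sum, map_smul, smul_add,
        Finset.sum_add_distrib]
    have hlim : ∀ j, Tendsto (fun n => ⟪A (∑ i, ξ i • (g n i + e i)) j, one⟫) (hyperfilter ℕ)
        (𝓝 ⟪A (∑ i, ξ i • y i) j, one⟫) := fun j => by
      have h1 : ∀ z, Tendsto (fun n => ⟪∑ i, ξ i • (g n i + e i), z⟫) (hyperfilter ℕ)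
          (𝓝 ⟪∑ i, ξ i • y i, z⟫) := fun z => by
        simp only [sum_inner, real_inner_smul_left]
        exact tendsto_finsetSum _ fun i _ => (hy i z).const_mul _
      exact tendsto_inner_clm h1 ((comp j).comp A) one
    have hlimS : Tendsto (fun n => ∑ j, ξ j * ⟪A (∑ i, ξ i • (g n i + e i)) j, one⟫)
        (hyperfilter ℕ) (𝓝 (∑ j, ξ j * ⟪A (∑ i, ξ i • y i) j, one⟫)) :=
      tendsto_finsetSum _ fun j _ => (hlim j).const_mul _
    -- the energy inequality, from which both bounds follow before the passage to the limit
    have hen : ∀ n, lam * ‖∑ i, ξ i • (g n i + e i)‖ ^ 2 ≤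
        ∑ j, ξ j * ⟪A (∑ i, ξ i • (g n i + e i)) j, one⟫ := fun n => by
      have h1 := (hsol n).energy hA
      rw [hx, inner_constField] at h1
      have h2 : 0 ≤ 1 / ((n : ℝ) + 1) * ‖∑ i, ξ i • φ n i‖ ^ 2 := by positivity
      linarith
    constructor
    · refine ge_of_tendsto hlimS (Eventually.of_forall fun n => le_trans ?_ (hen n))
      refine mul_le_mul_of_nonneg_left ?_ hlam.le
      rw [← norm_sq_constField hone ξ, ← hx]
      exact U.norm_constField_le hinv ξ (U.gradSmooth_mem_potential _ _)
    · refine le_of_tendsto_of_tendsto (tendsto_finsetSum _ fun j _ => (hlim j).pow 2)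
        (hlimS.const_mul (1 / lam)) (Eventually.of_forall fun n => ?_)
      refine (sum_sq_inner_le hone _).trans ?_
      have h1 : ‖A (∑ i, ξ i • (g n i + e i))‖ ^ 2 ≤ ‖∑ i, ξ i • (g n i + e i)‖ ^ 2 :=
        pow_le_pow_left₀ (norm_nonneg _) (hA1 _) 2
      refine h1.trans ?_
      simp only
      rw [one_div, ← div_eq_inv_mul, le_div_iff₀ hlam, mul_comm]
      exact hen n
  · simp only [hye]
    let T1 : VecField d H →L[ℝ] H := U.lift (∂_{timeDir d} κ) η
    let T2 : VecField d H →L[ℝ] H :=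
      ∑ j, (U.pair (∂_{spaceDir j} κ) - U.anchor κ (∂_{unitVec j} η)).comp (comp j)
    have hT2 : ∀ q, T2 q =
        ∑ j, (U.pair (∂_{spaceDir j} κ) - U.anchor κ (∂_{unitVec j} η)) (q j) :=
      fun q => by simp [T2]
    change T1 (y i - e i) = _
    rw [← hT2, ← sub_eq_zero]
    refine ext_inner_right ℝ fun u => ?_
    rw [inner_zero_left]
    -- The residual of the equation is bounded, and it vanishes weakly against mollified vectors,
    -- hence against all vectors.
    let X : ℕ → H := fun n => T1 (g n i) - T2 (A (g n i + e i))
    have hX1 : Tendsto (fun n => ⟪X n, u⟫) (hyperfilter ℕ)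
        (𝓝 ⟪T1 (y i - e i) - T2 (A (y i)), u⟫) := by
      simp only [X, inner_sub_left]
      exact (tendsto_inner_clm (hG i) T1 u).sub (tendsto_inner_clm (hy i) (T2.comp A) u)
    have hXeq : ∀ n, ⟪X n, U.smooth (mollifier d n) u⟫ =
        1 / ((n : ℝ) + 1) * ⟪φ n i, (U.smooth κ - U.anchorAdj κ η) u⟫ := fun n => by
      rw [← (hφ n i).weak_eq n (φ n i) κ η hη u]
      simp only [X, T1, hT2, g]
    have hXb : ∀ n, ‖X n‖ ≤ ‖T1‖ * (1 / lam + 1) + ‖T2‖ * (1 / lam) := fun n => by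
      refine (norm_sub_le _ _).trans (add_le_add ?_ ?_)
      · refine T1.le_opNorm_of_le ?_
        have : g n i = (g n i + e i) - e i := by abel
        rw [this]
        exact (norm_sub_le _ _).trans (add_le_add (hbound i n) (hnorm i).le)
      · exact T2.le_opNorm_of_le ((hA1 _).trans (hbound i n))
    have hX2 : Tendsto (fun n => ⟪X n, U.smooth (mollifier d n) u - u⟫) (hyperfilter ℕ)
        (𝓝 0) := by
      have h1 : Tendsto (fun n => U.smooth (mollifier d n) u - u) (hyperfilter ℕ) (𝓝 0) := by
        have := ((U.tendsto_smooth_mollifier u).mono_left Nat.hyperfilter_le_atTop).sub_const u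
        rwa [sub_self] at this
      refine squeeze_zero_norm (fun n => ?_)
        (a := fun n => (‖T1‖ * (1 / lam + 1) + ‖T2‖ * (1 / lam)) *
          ‖U.smooth (mollifier d n) u - u‖) ?_
      · exact (norm_inner_le_norm _ _).trans
          (mul_le_mul_of_nonneg_right (hXb n) (norm_nonneg _))
      · simpa using h1.norm.const_mul (‖T1‖ * (1 / lam + 1) + ‖T2‖ * (1 / lam))
    have hX3 : Tendsto (fun n => ⟪X n, U.smooth (mollifier d n) u⟫) (hyperfilter ℕ) (𝓝 0) := by
      simp only [hXeq]
      set w := (U.smooth κ - U.anchorAdj κ η) u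
      refine squeeze_zero_norm (fun n => ?_)
        (a := fun n : ℕ => √(1 / ((n : ℝ) + 1)) * (√(1 / lam) * ‖w‖)) ?_
      · have h1 := (hφ n i).norm_sq_le hA hA1 hlam
        rw [hnorm, one_pow] at h1
        have h2 : √(1 / ((n : ℝ) + 1)) * ‖φ n i‖ ≤ √(1 / lam) := by
          refine Real.le_sqrt_of_sq_le ?_
          rwa [mul_pow, Real.sq_sqrt (by positivity)]
        have h3 : 1 / ((n : ℝ) + 1) = √(1 / ((n : ℝ) + 1)) * √(1 / ((n : ℝ) + 1)) :=
          (Real.mul_self_sqrt (by positivity)).symm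
        have h4 : (0 : ℝ) ≤ √(1 / ((n : ℝ) + 1)) := Real.sqrt_nonneg _
        rw [norm_mul, Real.norm_of_nonneg (by positivity : (0 : ℝ) ≤ 1 / ((n : ℝ) + 1))]
        calc 1 / ((n : ℝ) + 1) * ‖⟪φ n i, w⟫‖ ≤ 1 / ((n : ℝ) + 1) * (‖φ n i‖ * ‖w‖) :=
              mul_le_mul_of_nonneg_left (norm_inner_le_norm _ _) (by positivity)
          _ = √(1 / ((n : ℝ) + 1)) * ((√(1 / ((n : ℝ) + 1)) * ‖φ n i‖) * ‖w‖) := by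
              conv_lhs => rw [h3]
              ring
          _ ≤ _ := mul_le_mul_of_nonneg_left
              (mul_le_mul_of_nonneg_right h2 (norm_nonneg _)) h4
      · have h1 : Tendsto (fun n : ℕ => √(1 / ((n : ℝ) + 1))) (hyperfilter ℕ) (𝓝 0) := by
          have := (Real.continuous_sqrt.tendsto 0).comp
            ((tendsto_one_div_add_atTop_nhds_zero_nat (𝕜 := ℝ)).mono_left
              Nat.hyperfilter_le_atTop)
          rwa [Real.sqrt_zero] at this
        simpa using h1.mul_const (√(1 / lam) * ‖w‖)
    refine tendsto_nhds_unique hX1 ?_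
    have := hX3.sub hX2
    simpa only [inner_sub_right, sub_sub_cancel, sub_zero] using this

end UnitaryRep

/-! ### The vector potential of the flux -/

namespace UnitaryRep

variable {d : ℕ} {H : Type*} [NormedAddCommGroup H] [InnerProductSpace ℝ H] [CompleteSpace H]
  (U : UnitaryRep d H)

/-- The projection onto potential fields does not change the divergence. -/
theorem sum_pair_proj (κ : 𝓓((⊤ : Opens (SpaceTime d)), ℝ)) (f : VecField d H) :
    ∑ j, U.pair (∂_{spaceDir j} κ) (U.proj f j) = ∑ j, U.pair (∂_{spaceDir j} κ) (f j) := by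
  refine ext_inner_right ℝ fun u => ?_
  simp only [sum_inner, inner_pair_left]
  exact U.inner_proj_gradSmooth κ f u

/-- The vector field `w_j e_k - w_k e_j`. -/
def skewField (w : VecField d H) (j k : Fin d) : VecField d H :=
  PiLp.single 2 k (w j) - PiLp.single 2 j (w k)

theorem skewField_apply (w : VecField d H) (j k l : Fin d) :
    skewField w j k l = (if l = k then w j else 0) - if l = j then w k else 0 := by
  simp [skewField]

theorem skewField_swap (w : VecField d H) (j k : Fin d) :
    skewField w k j = -skewField w j k := by
  simp [skewField]

theorem norm_skewField_le (w : VecField d H) (j k : Fin d) : ‖skewField w j k‖ ≤ 2 * ‖w‖ := by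
  refine (norm_sub_le _ _).trans ?_
  rw [PiLp.norm_single, PiLp.norm_single, two_mul]
  exact add_le_add (PiLp.norm_apply_le w j) (PiLp.norm_apply_le w k)

theorem proj_neg (f : VecField d H) : U.proj (-f) = -U.proj f := map_neg _ _

/-- The gradient of the vector potential: the potential part of `w_j e_k - w_k e_j`, where
`w = q - ∇ψ` is the solenoidal part of the flux `q`. -/
def vecPotential (q : VecField d H) (j k : Fin d) : VecField d H :=
  U.proj (skewField (q - U.proj q) j k)

theorem vecPotential_mem (q : VecField d H) (j k : Fin d) : U.vecPotential q j k ∈ U.potential :=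
  U.proj_mem _

theorem vecPotential_swap (q : VecField d H) (j k : Fin d) :
    U.vecPotential q k j = -U.vecPotential q j k := by
  rw [vecPotential, skewField_swap, proj_neg, vecPotential]

theorem norm_vecPotential_le (q : VecField d H) (j k : Fin d) :
    ‖U.vecPotential q j k‖ ≤ 4 * ‖q‖ := by
  have h1 := (U.norm_proj_le _).trans (norm_skewField_le (q - U.proj q) j k)
  have h2 := (norm_sub_le q (U.proj q)).trans (add_le_add le_rfl (U.norm_proj_le q))
  exact h1.trans (by linarith)

theorem sum_inner_skewField (w : VecField d H) (j k : Fin d) (f : Fin d → H) :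
    ∑ l, ⟪skewField w j k l, f l⟫ = ⟪w j, f k⟫ - ⟪w k, f j⟫ := by
  simp only [skewField_apply, inner_sub_left, Finset.sum_sub_distrib]
  congr 1
  · rw [Finset.sum_eq_single k (fun l _ hl => by simp [hl]) (by simp)]
    simp
  · rw [Finset.sum_eq_single j (fun l _ hl => by simp [hl]) (by simp)]
    simp

/-- The divergence of the vector potential is the solenoidal part of the flux, up to its
spatially invariant part `c`: the difference is harmonic, hence invariant by Liouville's theorem,
and it is orthogonal to the invariant vectors. -/
theorem sum_vecPotential (q c : VecField d H) (hc : ∀ j, U.Invariant (c j))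
    (hqc : ∀ j u, U.Invariant u → ⟪q j - c j, u⟫ = 0) (j : Fin d) :
    ∑ k, U.vecPotential q j k k = q j - U.proj q j - c j := by
  set w := q - U.proj q with hw
  -- `w` is divergence free, since `q` and its projection have the same divergence
  have hdiv : ∀ (κ : 𝓓((⊤ : Opens (SpaceTime d)), ℝ)) (u : H),
      ∑ k, ⟪w k, U.smooth (∂_{spaceDir k} κ) u⟫ = 0 := fun κ u => by
    simp only [hw, PiLp.sub_apply, inner_sub_left, Finset.sum_sub_distrib]
    rw [U.inner_proj_gradSmooth κ q u, sub_self]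
  rw [← sub_eq_zero]
  set s := ∑ k, U.vecPotential q j k k - (q j - U.proj q j - c j) with hs
  have hs' : s = ∑ k, U.vecPotential q j k k - w j + c j := by
    simp only [hs, hw, PiLp.sub_apply]
    abel
  have hinv : U.Invariant s := by
    refine U.invariant_of_harmonic fun κ u => ?_
    have h1 : ∀ l, ⟪c j, U.smooth (∂_{spaceDir l} (∂_{spaceDir l} κ)) u⟫ = 0 := fun l => by
      have := ((hc j).hasDeriv l).inner_eq_neg (U.hasDeriv_smooth (∂_{spaceDir l} κ) (spaceDir l) u)
      rw [inner_zero_left] at this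
      linarith
    have h2 : ∀ k, ∑ l, ⟪U.vecPotential q j k k,
        U.smooth (∂_{spaceDir l} (∂_{spaceDir l} κ)) u⟫ =
          ⟪w j, U.smooth (∂_{spaceDir k} (∂_{spaceDir k} κ)) u⟫ -
            ⟪w k, U.smooth (∂_{spaceDir k} (∂_{spaceDir j} κ)) u⟫ := fun k => by
      -- as `vecPotential q j k` is curl free, `∂_l ∂_l` of its component `k` is `∂_k ∂_l` of its
      -- component `l`, which brings in the equation of `vecPotential`
      have h3 : ∀ l, ⟪U.vecPotential q j k k, U.smooth (∂_{spaceDir l} (∂_{spaceDir l} κ)) u⟫ =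
          ⟪U.vecPotential q j k l, U.smooth (∂_{spaceDir l} (∂_{spaceDir k} κ)) u⟫ := fun l => by
        rw [U.inner_potential_curl (∂_{spaceDir l} κ) (U.vecPotential_mem q j k) k l u,
          lineDeriv_comm]
      rw [Finset.sum_congr rfl fun l _ => h3 l]
      rw [vecPotential, U.inner_proj_gradSmooth (∂_{spaceDir k} κ), sum_inner_skewField,
        lineDeriv_comm κ (spaceDir j) (spaceDir k)]
    have h4 : ∀ l, ⟪s, U.smooth (∂_{spaceDir l} (∂_{spaceDir l} κ)) u⟫ =
        ∑ k, ⟪U.vecPotential q j k k, U.smooth (∂_{spaceDir l} (∂_{spaceDir l} κ)) u⟫ -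
          ⟪w j, U.smooth (∂_{spaceDir l} (∂_{spaceDir l} κ)) u⟫ := fun l => by
      rw [hs', inner_add_left, inner_sub_left, sum_inner, h1, add_zero]
    simp only [h4, Finset.sum_sub_distrib]
    rw [Finset.sum_comm]
    rw [Finset.sum_congr rfl fun k _ => h2 k, Finset.sum_sub_distrib]
    rw [hdiv]
    ring
  have h0 : ⟪s, s⟫ = 0 := by
    have h1 : ∀ k, ⟪U.vecPotential q j k k, s⟫ = 0 := fun k =>
      U.inner_potential_invariant (U.vecPotential_mem q j k) hinv k
    have h2 := U.inner_potential_invariant (U.proj_mem q) hinv j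
    have h3 := hqc j s hinv
    have h4 : s = ∑ k, U.vecPotential q j k k + U.proj q j - (q j - c j) := by
      rw [hs]; abel
    calc ⟪s, s⟫ = ⟪∑ k, U.vecPotential q j k k + U.proj q j - (q j - c j), s⟫ := by rw [← h4]
      _ = 0 := by
        rw [inner_sub_left, inner_add_left, sum_inner, h2, h3]
        simp only [h1, Finset.sum_const_zero]
        ring
  exact inner_self_eq_zero.1 h0

/-- The equation `Δσ_{jk} = ∂_k w_j - ∂_j w_k`, tested with `κ`. -/
theorem sum_pair_vecPotential (κ : 𝓓((⊤ : Opens (SpaceTime d)), ℝ)) (q : VecField d H)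
    (j k : Fin d) :
    ∑ l, U.pair (∂_{spaceDir l} κ) (U.vecPotential q j k l) =
      U.pair (∂_{spaceDir k} κ) (q j - U.proj q j) -
        U.pair (∂_{spaceDir j} κ) (q k - U.proj q k) := by
  rw [vecPotential, sum_pair_proj]
  refine ext_inner_right ℝ fun u => ?_
  rw [sum_inner, inner_sub_left]
  simp only [inner_pair_left, sum_inner_skewField (f := fun l => U.smooth (∂_{spaceDir l} κ) u)]
  rfl

end UnitaryRep

/-! ### Translations in `L²` of a stationary ensemble -/

theorem eLpNorm_two_pow_two {α F : Type*} [MeasurableSpace α] {μ : Measure α}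
    [NormedAddCommGroup F] (f : α → F) : eLpNorm f 2 μ ^ 2 = ∫⁻ x, ‖f x‖ₑ ^ 2 ∂μ := by
  have := eLpNorm_nnreal_pow_eq_lintegral (f := f) (μ := μ) (p := 2) two_ne_zero
  simpa [ENNReal.rpow_ofNat] using this

/-- Translations are continuous in `L²`. -/
theorem tendsto_lintegral_translate_sub {V : Type*} [NormedAddCommGroup V] [NormedSpace ℝ V]
    [FiniteDimensional ℝ V] [MeasurableSpace V] [BorelSpace V] {μ : Measure V}
    [μ.IsAddHaarMeasure] {g : V → ℝ} (hg : MemLp g 2 μ) :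
    Tendsto (fun h => ∫⁻ z, ‖g (z + h) - g z‖ₑ ^ 2 ∂μ) (𝓝 0) (𝓝 0) := by
  have hmp : ∀ h : V, MeasurePreserving (· + h) μ μ := fun h => measurePreserving_add_right μ h
  let c : V → C(V, V) := fun h => ⟨(· + h), by fun_prop⟩
  have hc : Continuous c :=
    (ContinuousMap.curry ⟨fun p : V × V => p.2 + p.1, by fun_prop⟩).continuous
  have h1 := Continuous.compMeasurePreservingLp (f := fun _ : V => hg.toLp g) continuous_const hc
    hmp (by simp)
  have h2 := (h1.tendsto 0).sub_const (hg.toLp g)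
  have h3 : ∀ h, Lp.compMeasurePreserving (c h) (hmp h) (hg.toLp g) - hg.toLp g =
      ((hg.comp_measurePreserving (hmp h)).sub hg).toLp _ := fun h => by
    rw [MemLp.toLp_sub (hg.comp_measurePreserving (hmp h)) hg]
    rfl
  have h4 : Lp.compMeasurePreserving (c 0) (hmp 0) (hg.toLp g) - hg.toLp g = 0 := by
    have : ((c 0 : C(V, V)) : V → V) = id := by funext z; simp [c]
    simp only [this, Lp.compMeasurePreserving_id_apply, sub_self]
  rw [h4] at h2
  have h5 := (continuous_enorm.tendsto _).comp h2
  have h6 := (ENNReal.continuous_pow 2).tendsto _ |>.comp h5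
  simp only [enorm_zero, ne_eq, OfNat.ofNat_ne_zero, not_false_eq_true, zero_pow] at h6
  refine h6.congr fun h => ?_
  simp only [Function.comp_apply]
  rw [h3, Lp.enorm_toLp, eLpNorm_two_pow_two]
  rfl

theorem enorm_sub_pow_two_le (x y : ℝ) : ‖x - y‖ₑ ^ 2 ≤ 2 * ‖x‖ₑ ^ 2 + 2 * ‖y‖ₑ ^ 2 := by
  have h2 : ‖x - y‖ ^ 2 ≤ 2 * ‖x‖ ^ 2 + 2 * ‖y‖ ^ 2 := by
    simp only [Real.norm_eq_abs, sq_abs]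
    nlinarith [sq_nonneg (x + y)]
  simp only [← ofReal_norm]
  rw [← ENNReal.ofReal_pow (norm_nonneg _), ← ENNReal.ofReal_pow (norm_nonneg _),
    ← ENNReal.ofReal_pow (norm_nonneg _), ← ENNReal.ofReal_ofNat 2,
    ← ENNReal.ofReal_mul (by norm_num), ← ENNReal.ofReal_mul (by norm_num),
    ← ENNReal.ofReal_add (by positivity) (by positivity)]
  exact ENNReal.ofReal_le_ofReal h2

theorem lintegral_translate_sub_le {V : Type*} [NormedAddCommGroup V] [NormedSpace ℝ V]
    [FiniteDimensional ℝ V] [MeasurableSpace V] [BorelSpace V] {μ : Measure V}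
    [μ.IsAddHaarMeasure] {g : V → ℝ} (hg : Measurable g) (h : V) :
    ∫⁻ z, ‖g (z + h) - g z‖ₑ ^ 2 ∂μ ≤ 4 * ∫⁻ z, ‖g z‖ₑ ^ 2 ∂μ := by
  have h1 : Measurable fun z => ‖g z‖ₑ ^ 2 := hg.enorm.pow_const 2
  have h2 : Measurable fun z => ‖g (z + h)‖ₑ ^ 2 := h1.comp (measurable_add_const h)
  refine (lintegral_mono fun z => enorm_sub_pow_two_le (g (z + h)) (g z)).trans ?_
  rw [lintegral_add_right _ (h1.const_mul 2), lintegral_const_mul _ h1, lintegral_const_mul _ h2,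
    lintegral_add_right_eq_self (fun z => ‖g z‖ₑ ^ 2) h, ← add_mul]
  norm_num

namespace Ensemble

variable {d : ℕ} {E : Ensemble d}

theorem shift_add (z w : SpaceTime d) (a : E.Ω) :
    E.shift (z + w) a = E.shift z (E.shift w a) :=
  E.coeff_injective <| funext fun v => by simp only [E.coeff_shift]; rw [add_assoc]

theorem shift_zero (a : E.Ω) : E.shift 0 a = a :=
  E.coeff_injective <| funext fun v => by simp only [E.coeff_shift, add_zero]

theorem measurable_shift_left (z : SpaceTime d) : Measurable (E.shift z) :=
  E.measurable_shift.comp (measurable_id.prodMk measurable_const)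

theorem Stationary.measurePreserving (hE : E.Stationary) (z : SpaceTime d) :
    MeasurePreserving (E.shift z) E.law E.law :=
  ⟨measurable_shift_left z, hE z⟩

/-- Translations are strongly continuous in `L²` of a stationary ensemble. By stationarity
`⟨|f(a(· + h)) - f(a)|²⟩` is, up to a factor, the ensemble average of the squared `L²` distance on a
unit ball between the realization of `f` and its translate. -/
theorem Stationary.tendsto_lintegral_shift_sub (hE : E.Stationary) {f : E.Ω → ℝ}
    (hf : Measurable f) (hf2 : MemLp f 2 E.law) :
    Tendsto (fun h => ∫⁻ a, ‖f (E.shift h a) - f a‖ₑ ^ 2 ∂E.law) (𝓝 0) (𝓝 0) := by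
  let F : E.Ω × SpaceTime d → ℝ := fun p => f (E.shift p.2 p.1)
  have hF : Measurable F := hf.comp E.measurable_shift
  let B : Set (SpaceTime d) := Metric.ball 0 1
  let B2 : Set (SpaceTime d) := Metric.ball 0 2
  have hB : MeasurableSet B := measurableSet_ball
  have hB2 : MeasurableSet B2 := measurableSet_ball
  have hBpos : volume B ≠ 0 := (Metric.measure_ball_pos volume 0 one_pos).ne'
  have hBfin : volume B ≠ ⊤ := measure_ball_lt_top.ne
  -- the realizations, cut off outside a ball that contains all small translates of the unit ball
  let g : E.Ω → SpaceTime d → ℝ := fun a => B2.indicator fun z => F (a, z)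
  have hgm : Measurable fun p : E.Ω × SpaceTime d => g p.1 p.2 := by
    have : (fun p : E.Ω × SpaceTime d => g p.1 p.2) = (Prod.snd ⁻¹' B2).indicator F := by
      funext p
      simp only [g, indicator, mem_preimage]
      rfl
    rw [this]
    exact hF.indicator (measurable_snd hB2)
  have hg_int : ∫⁻ a, (∫⁻ z, ‖g a z‖ₑ ^ 2) ∂E.law = volume B2 * ∫⁻ a, ‖f a‖ₑ ^ 2 ∂E.law := by
    rw [lintegral_lintegral_swap (hgm.enorm.pow_const 2).aemeasurable]
    have : ∀ z, ∫⁻ a, ‖g a z‖ₑ ^ 2 ∂E.law = B2.indicator (fun _ => ∫⁻ a, ‖f a‖ₑ ^ 2 ∂E.law) z := by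
      intro z
      by_cases hz : z ∈ B2
      · simp only [g, indicator_of_mem hz, F]
        exact (hE.measurePreserving z).lintegral_comp (hf.enorm.pow_const 2)
      · simp [g, indicator_of_notMem hz]
    simp only [this]
    rw [lintegral_indicator hB2, setLIntegral_const, mul_comm]
  have hfin : ∫⁻ a, ‖f a‖ₑ ^ 2 ∂E.law ≠ ⊤ := by
    rw [← eLpNorm_two_pow_two]
    exact ENNReal.pow_ne_top hf2.eLpNorm_lt_top.ne
  have hg_fin : ∫⁻ a, (∫⁻ z, ‖g a z‖ₑ ^ 2) ∂E.law ≠ ⊤ := by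
    rw [hg_int]
    exact ENNReal.mul_ne_top measure_ball_lt_top.ne hfin
  let Φ : SpaceTime d → E.Ω → ℝ≥0∞ := fun h a => ∫⁻ z, ‖g a (z + h) - g a z‖ₑ ^ 2
  have hΦm : ∀ h, Measurable (Φ h) := fun h => by
    refine Measurable.lintegral_prod_right' (f := fun p : E.Ω × SpaceTime d =>
      ‖g p.1 (p.2 + h) - g p.1 p.2‖ₑ ^ 2) ?_
    exact ((hgm.comp (measurable_fst.prodMk (measurable_snd.add_const h))).sub
      hgm).enorm.pow_const 2
  have hΦ : Tendsto (fun h => ∫⁻ a, Φ h a ∂E.law) (𝓝 0) (𝓝 0) := by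
    have := tendsto_lintegral_filter_of_dominated_convergence (μ := E.law)
      (l := 𝓝 (0 : SpaceTime d)) (F := Φ) (f := fun _ => 0) (fun a => 4 * ∫⁻ z, ‖g a z‖ₑ ^ 2)
      (Eventually.of_forall hΦm) (Eventually.of_forall fun h => ae_of_all _ fun a => ?_) ?_ ?_
    · simpa using this
    · exact lintegral_translate_sub_le (hgm.comp (measurable_const.prodMk measurable_id)) h
    · rw [lintegral_const_mul]
      · exact ENNReal.mul_ne_top (by norm_num) hg_fin
      · exact Measurable.lintegral_prod_right' (f := fun p : E.Ω × SpaceTime d => ‖g p.1 p.2‖ₑ ^ 2)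
          (hgm.enorm.pow_const 2)
    · have hae := ae_lt_top (Measurable.lintegral_prod_right'
        (f := fun p : E.Ω × SpaceTime d => ‖g p.1 p.2‖ₑ ^ 2) (hgm.enorm.pow_const 2)) hg_fin
      filter_upwards [hae] with a ha
      refine tendsto_lintegral_translate_sub ⟨?_, ?_⟩
      · exact (hgm.comp (measurable_const.prodMk measurable_id)).aestronglyMeasurable
      · by_contra hcon
        rw [not_lt, top_le_iff] at hcon
        have := eLpNorm_two_pow_two (μ := volume) (g a)
        rw [hcon, ENNReal.top_pow two_ne_zero] at this
        exact ha.ne this.symm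
  have hle : ∀ᶠ h in 𝓝 (0 : SpaceTime d),
      volume B * ∫⁻ a, ‖f (E.shift h a) - f a‖ₑ ^ 2 ∂E.law ≤ ∫⁻ a, Φ h a ∂E.law := by
    filter_upwards [Metric.ball_mem_nhds (0 : SpaceTime d) one_pos] with h hh
    have hdm : Measurable fun a => ‖f (E.shift h a) - f a‖ₑ ^ 2 :=
      ((hf.comp (measurable_shift_left h)).sub hf).enorm.pow_const 2
    have hjm : Measurable fun p : E.Ω × SpaceTime d =>
        ‖f (E.shift h (E.shift p.2 p.1)) - f (E.shift p.2 p.1)‖ₑ ^ 2 := hdm.comp E.measurable_shift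
    calc volume B * ∫⁻ a, ‖f (E.shift h a) - f a‖ₑ ^ 2 ∂E.law
        = ∫⁻ z in B, ∫⁻ a, ‖f (E.shift h (E.shift z a)) - f (E.shift z a)‖ₑ ^ 2 ∂E.law := by
          rw [mul_comm, ← setLIntegral_const]
          refine lintegral_congr fun z => ?_
          exact ((hE.measurePreserving z).lintegral_comp hdm).symm
      _ = ∫⁻ a, (∫⁻ z in B, ‖f (E.shift h (E.shift z a)) - f (E.shift z a)‖ₑ ^ 2) ∂E.law :=
          lintegral_lintegral_swap (hjm.comp measurable_swap).aemeasurable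
      _ ≤ ∫⁻ a, Φ h a ∂E.law := by
          refine lintegral_mono fun a => ?_
          rw [← lintegral_indicator hB]
          refine lintegral_mono fun z => ?_
          by_cases hz : z ∈ B
          · rw [indicator_of_mem hz]
            have hz' : ‖z‖ < 1 := by simpa [B] using hz
            have hh' : ‖h‖ < 1 := by simpa using hh
            have hz2 : z ∈ B2 := by
              simp only [B2, mem_ball_zero_iff]
              linarith
            have hzh : z + h ∈ B2 := by
              simp only [B2, mem_ball_zero_iff]
              linarith [norm_add_le z h]
            simp only [g, indicator_of_mem hz2, indicator_of_mem hzh, F]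
            rw [add_comm z h, shift_add]
          · rw [indicator_of_notMem hz]
            exact zero_le
  have h1 : Tendsto (fun h => volume B * ∫⁻ a, ‖f (E.shift h a) - f a‖ₑ ^ 2 ∂E.law) (𝓝 0) (𝓝 0) :=
    tendsto_of_tendsto_of_tendsto_of_le_of_le' tendsto_const_nhds hΦ
      (Eventually.of_forall fun _ => zero_le) hle
  have h2 := ENNReal.Tendsto.const_mul (a := (volume B)⁻¹) h1 (Or.inr (ENNReal.inv_ne_top.2 hBpos))
  simpa only [← mul_assoc, ENNReal.inv_mul_cancel hBpos hBfin, one_mul, mul_zero] using h2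

theorem Stationary.compMeasurePreserving_shift_add (hE : E.Stationary) (z w : SpaceTime d)
    (u : Lp ℝ 2 E.law) :
    Lp.compMeasurePreserving (E.shift (z + w)) (hE.measurePreserving (z + w)) u =
      Lp.compMeasurePreserving (E.shift z) (hE.measurePreserving z)
        (Lp.compMeasurePreserving (E.shift w) (hE.measurePreserving w) u) := by
  refine Lp.ext ?_
  have h1 := Lp.coeFn_compMeasurePreserving u (hE.measurePreserving (z + w))
  have h2 := Lp.coeFn_compMeasurePreserving
    (Lp.compMeasurePreserving (E.shift w) (hE.measurePreserving w) u) (hE.measurePreserving z)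
  have h3 := (hE.measurePreserving z).quasiMeasurePreserving.ae
    (Lp.coeFn_compMeasurePreserving u (hE.measurePreserving w))
  filter_upwards [h1, h2, h3] with a h1 h2 h3
  refine h1.trans (Eq.trans ?_ h2.symm)
  simp only [Function.comp_apply] at h3 ⊢
  rw [h3, add_comm, shift_add]

/-- The action `X ↦ X(a(· + x, · + t))` of the translations on `L²` of a stationary ensemble. -/
def Stationary.koopman (hE : E.Stationary) : UnitaryRep d (Lp ℝ 2 E.law) where
  act z := Lp.compMeasurePreservingₗᵢ ℝ (E.shift z) (hE.measurePreserving z)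
  act_zero u := by
    refine Lp.ext ((Lp.coeFn_compMeasurePreserving u (hE.measurePreserving 0)).trans
      (ae_of_all _ fun a => ?_))
    simp [shift_zero]
  act_add z w u := hE.compMeasurePreserving_shift_add z w u
  continuous_act u := by
    have h0 : Tendsto (fun h => Lp.compMeasurePreserving (E.shift h) (hE.measurePreserving h) u - u)
        (𝓝 0) (𝓝 0) := by
      have hum := (Lp.stronglyMeasurable u).measurable
      rw [tendsto_zero_iff_enorm_tendsto_zero]
      have h1 := hE.tendsto_lintegral_shift_sub hum (Lp.memLp u)
      have h2 := (ENNReal.continuous_rpow_const (y := 1 / 2)).tendsto 0 |>.comp h1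
      rw [ENNReal.zero_rpow_of_pos (by norm_num)] at h2
      refine h2.congr fun h => ?_
      have h3 : ∫⁻ a, ‖u (E.shift h a) - u a‖ₑ ^ 2 ∂E.law =
          ‖Lp.compMeasurePreserving (E.shift h) (hE.measurePreserving h) u - u‖ₑ ^ 2 := by
        rw [Lp.enorm_def, eLpNorm_two_pow_two]
        refine lintegral_congr_ae ?_
        filter_upwards [Lp.coeFn_sub (Lp.compMeasurePreserving (E.shift h)
          (hE.measurePreserving h) u) u,
          Lp.coeFn_compMeasurePreserving u (hE.measurePreserving h)] with a h1 h2
        rw [h1, Pi.sub_apply, h2]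
        rfl
      simp only [Function.comp_apply]
      rw [h3, ← ENNReal.rpow_natCast, ← ENNReal.rpow_mul]
      norm_num
    refine continuous_iff_continuousAt.2 fun z₀ => ?_
    have h1 : Tendsto (fun z => Lp.compMeasurePreserving (E.shift (z - z₀))
        (hE.measurePreserving (z - z₀)) u) (𝓝 z₀) (𝓝 u) := by
      have h2 : Tendsto (fun z : SpaceTime d => z - z₀) (𝓝 z₀) (𝓝 0) := by
        simpa using (continuous_sub_right z₀).tendsto z₀
      have h3 := (h0.comp h2).add_const u
      simpa only [Function.comp_def, sub_add_cancel, zero_add] using h3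
    have h2 := ((Lp.compMeasurePreservingₗᵢ ℝ (E.shift z₀)
      (hE.measurePreserving z₀)).continuous.tendsto u).comp h1
    have h3 : Lp.compMeasurePreserving (E.shift z₀) (hE.measurePreserving z₀) u =
        Lp.compMeasurePreservingₗᵢ ℝ (E.shift z₀) (hE.measurePreserving z₀) u := rfl
    rw [← h3] at h2
    refine h2.congr fun z => ?_
    have h4 := hE.compMeasurePreserving_shift_add z₀ (z - z₀) u
    simp only [add_sub_cancel] at h4
    exact h4.symm

end Ensemble

/-! ### Regular distributions -/

theorem locallyIntegrable_of_ball {V : Type*} [NormedAddCommGroup V] [MeasurableSpace V]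
    {μ : Measure V} {F : Type*} [NormedAddCommGroup F] {f : V → F}
    (h : ∀ n : ℕ, IntegrableOn f (Metric.ball 0 n) μ) : LocallyIntegrable f μ := by
  intro x
  obtain ⟨n, hn⟩ := exists_nat_gt ‖x‖
  exact ⟨Metric.ball 0 n, Metric.isOpen_ball.mem_nhds (by simpa using hn), h n⟩

theorem distOf_sub {d : ℕ} {f g : SpaceTime d → ℝ} (hf : LocallyIntegrable f volume)
    (hg : LocallyIntegrable g volume) :
    distOf (fun z => f z - g z) = distOf f - distOf g := by
  ext κ
  have hi : ∀ {f : SpaceTime d → ℝ}, LocallyIntegrable f volume →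
      Integrable fun z => κ z * f z := fun hf => by
    simpa using hf.integrable_smul_left_of_hasCompactSupport κ.continuous κ.hasCompactSupport
  rw [distOf_apply (f := fun z => f z - g z) (hf.sub hg), FunLike.coe_sub, Pi.sub_apply,
    distOf_apply hf, distOf_apply hg, ← integral_sub (hi hf) (hi hg)]
  simp only [mul_sub]

theorem distOf_sum {d : ℕ} {ι : Type*} {s : Finset ι} {f : ι → SpaceTime d → ℝ}
    (hf : ∀ i, LocallyIntegrable (f i) volume) :
    distOf (fun z => ∑ i ∈ s, f i z) = ∑ i ∈ s, distOf (f i) := by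
  induction s using Finset.cons_induction with
  | empty =>
    ext κ
    have h0 : LocallyIntegrable (fun _ : SpaceTime d => (0 : ℝ)) volume :=
      continuous_const.locallyIntegrable
    simp only [Finset.sum_empty]
    rw [distOf_apply h0]
    simp
  | cons i s hi ih =>
    simp only [Finset.sum_cons]
    rw [← ih]
    have h1 : LocallyIntegrable (fun z => ∑ i ∈ s, f i z) volume :=
      locallyIntegrable_finsetSum _ fun i _ => hf i
    have h2 := distOf_sub (f := fun z => f i z + ∑ i ∈ s, f i z) ((hf i).add h1) h1
    simp only [add_sub_cancel_right] at h2
    rw [h2, sub_add_cancel]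

namespace Ensemble

variable {d : ℕ} {E : Ensemble d}

/-! ### Realizations of elements of `L²` along space-time -/

/-- The map `(a, y) ↦ a(· + p(y))` pulls null sets back to null sets. -/
theorem Stationary.quasiMeasurePreserving_shift (hE : E.Stationary) {τ : Type*}
    [MeasurableSpace τ] (ν : Measure τ) [SFinite ν] {p : τ → SpaceTime d} (hp : Measurable p) :
    Measure.QuasiMeasurePreserving (fun q : E.Ω × τ => E.shift (p q.2) q.1)
      (E.law.prod ν) E.law := by
  have hm : Measurable fun q : E.Ω × τ => E.shift (p q.2) q.1 :=
    E.measurable_shift.comp (measurable_fst.prodMk (hp.comp measurable_snd))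
  refine ⟨hm, Measure.AbsolutelyContinuous.mk fun s hs h0 => ?_⟩
  rw [Measure.map_apply hm hs, Measure.prod_apply_symm (hm hs)]
  have : ∀ y, E.law ((fun x => (x, y)) ⁻¹' ((fun q : E.Ω × τ => E.shift (p q.2) q.1) ⁻¹' s)) = 0 :=
    fun y => by
      have := (hE.measurePreserving (p y)).measure_preimage hs.nullMeasurableSet
      rw [h0] at this
      exact this
  simp [this]

section

variable {τ : Type*} [MeasurableSpace τ] {ν : Measure τ} [SFinite ν] {k : τ → ℝ}
  {p : τ → SpaceTime d} {X : E.Ω → ℝ}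

theorem Stationary.integrable_prod (hE : E.Stationary) (hk : Integrable k ν) (hp : Measurable p)
    (hX : Measurable X) (hX1 : Integrable X E.law) :
    Integrable (fun q : E.Ω × τ => k q.2 * X (E.shift (p q.2) q.1)) (E.law.prod ν) := by
  have hm : Measurable fun q : E.Ω × τ => X (E.shift (p q.2) q.1) :=
    hX.comp (hE.quasiMeasurePreserving_shift ν hp).measurable
  have hmk : AEStronglyMeasurable (fun q : E.Ω × τ => k q.2 * X (E.shift (p q.2) q.1))
      (E.law.prod ν) := hk.aestronglyMeasurable.comp_snd.mul hm.aestronglyMeasurable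
  refine (integrable_prod_iff' hmk).2 ⟨ae_of_all _ fun y => ?_, ?_⟩
  · exact ((hE.measurePreserving (p y)).integrable_comp_of_integrable hX1).const_mul (k y)
  · refine (hk.norm.mul_const (∫ a, ‖X a‖ ∂E.law)).congr (ae_of_all _ fun y => ?_)
    simp only [norm_mul]
    rw [integral_const_mul]
    congr 1
    have := integral_map (μ := E.law) (f := fun a => ‖X a‖)
      (measurable_shift_left (p y)).aemeasurable hX.norm.aestronglyMeasurable
    rw [hE (p y)] at this
    exact this

theorem Stationary.ae_integrable_shift (hE : E.Stationary) (hk : Integrable k ν)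
    (hp : Measurable p) (hX : Measurable X) (hX1 : Integrable X E.law) :
    ∀ᵐ a ∂E.law, Integrable (fun y => k y * X (E.shift (p y) a)) ν :=
  (hE.integrable_prod hk hp hX hX1).prod_right_ae

/-- The average of an element of `L²` over translations is, almost surely, the average of the
realizations. -/
theorem Stationary.avg_ae_eq (hE : E.Stationary) (hk : Integrable k ν) (hp : Measurable p)
    (hX : Measurable X) (hX2 : MemLp X 2 E.law) :
    hE.koopman.avg ν k p (hX2.toLp X) =ᵐ[E.law] fun a => ∫ y, k y * X (E.shift (p y) a) ∂ν := by
  have hX1 : Integrable X E.law := hX2.integrable one_le_two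
  have hI := hE.integrable_prod hk hp hX hX1
  -- both sides have the same integral over every event, by Fubini's theorem
  refine Integrable.ae_eq_of_forall_setIntegral_eq _ _ ((Lp.memLp _).integrable one_le_two)
    hI.integral_prod_left fun s hs _ => ?_
  have hfin : E.law s ≠ ⊤ := measure_ne_top _ _
  have key : ∀ u : Lp ℝ 2 E.law, ⟪u, indicatorConstLp 2 hs hfin (1 : ℝ)⟫ = ∫ a in s, u a ∂E.law :=
    fun u => by
      rw [real_inner_comm]
      exact L2.inner_indicatorConstLp_one hs hfin u
  rw [← key, hE.koopman.inner_avg_eq_integral hk hp]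
  have hI' : Integrable (fun q : E.Ω × τ => k q.2 * X (E.shift (p q.2) q.1))
      ((E.law.restrict s).prod ν) := by
    have := hI.restrict (s := s ×ˢ univ)
    rwa [← Measure.prod_restrict, Measure.restrict_univ] at this
  rw [integral_integral_swap hI']
  refine integral_congr_ae (ae_of_all _ fun y => ?_)
  simp only
  rw [key, integral_const_mul]
  congr 1
  refine setIntegral_congr_ae hs ?_
  have h1 := Lp.coeFn_compMeasurePreserving (hX2.toLp X) (hE.measurePreserving (p y))
  have h2 := (hE.measurePreserving (p y)).quasiMeasurePreserving.ae hX2.coeFn_toLp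
  filter_upwards [h1, h2] with a h1 h2 _
  exact h1.trans h2

end

theorem Stationary.ae_locallyIntegrable_extend (hE : E.Stationary) {X : E.Ω → ℝ}
    (hX : Measurable X) (hX1 : Integrable X E.law) :
    ∀ᵐ a ∂E.law, LocallyIntegrable (extend X a) volume := by
  have h : ∀ n : ℕ, ∀ᵐ a ∂E.law, IntegrableOn (extend X a) (Metric.ball 0 n) volume := fun n => by
    have hk : Integrable (fun _ : SpaceTime d => (1 : ℝ))
        (volume.restrict (Metric.ball (0 : SpaceTime d) n)) := by
      have : IsFiniteMeasure (volume.restrict (Metric.ball (0 : SpaceTime d) n)) :=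
        ⟨by simpa using measure_ball_lt_top⟩
      exact integrable_const _
    filter_upwards [hE.ae_integrable_shift hk measurable_id hX hX1] with a ha
    simp only [one_mul, id] at ha
    exact ha
  filter_upwards [ae_all_iff.2 h] with a ha
  exact locallyIntegrable_of_ball ha

/-! ### Random distributions with square integrable pairings -/

/-- The pairing of the random distribution `T` with each test function `κ` is, almost surely, the
element `L κ` of `L²`. -/
def Represents (T : E.Ω → SpaceTimeDistribution d)
    (L : 𝓓((⊤ : Opens (SpaceTime d)), ℝ) → Lp ℝ 2 E.law) : Prop :=
  ∀ κ, ∀ᵐ a ∂E.law, T a κ = L κ a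

namespace Represents

variable {T T' : E.Ω → SpaceTimeDistribution d}
  {L L' : 𝓓((⊤ : Opens (SpaceTime d)), ℝ) → Lp ℝ 2 E.law}

/-- Random distributions agree almost surely if their pairings agree in `L²`. This turns identities
between operators on `L²` into almost sure equations. -/
theorem ae_eq (h : Represents T L) (h' : Represents T' L') (hL : ∀ κ, L κ = L' κ) :
    ∀ᵐ a ∂E.law, T a = T' a :=
  ae_distribution_eq fun κ => by
    filter_upwards [h κ, h' κ] with a ha ha'
    rw [ha, ha', hL]

theorem congr (h : Represents T L) (hT : ∀ᵐ a ∂E.law, T a = T' a) : Represents T' L := fun κ => by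
  filter_upwards [h κ, hT] with a ha ha'
  rw [← ha', ha]

theorem zero :
    Represents (E := E) (fun _ => (0 : SpaceTimeDistribution d)) fun _ => 0 := fun κ => by
  filter_upwards [Lp.coeFn_zero ℝ 2 E.law] with a ha
  rw [ha]
  rfl

theorem add (h : Represents T L) (h' : Represents T' L') :
    Represents (fun a => T a + T' a) fun κ => L κ + L' κ := fun κ => by
  filter_upwards [h κ, h' κ, Lp.coeFn_add (L κ) (L' κ)] with a ha ha' hL
  rw [hL, Pi.add_apply, ← ha, ← ha']
  rfl

theorem sub (h : Represents T L) (h' : Represents T' L') :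
    Represents (fun a => T a - T' a) fun κ => L κ - L' κ := fun κ => by
  filter_upwards [h κ, h' κ, Lp.coeFn_sub (L κ) (L' κ)] with a ha ha' hL
  rw [hL, Pi.sub_apply, ← ha, ← ha']
  rfl

theorem sum {ι : Type*} (s : Finset ι) {T : ι → E.Ω → SpaceTimeDistribution d}
    {L : ι → 𝓓((⊤ : Opens (SpaceTime d)), ℝ) → Lp ℝ 2 E.law} (h : ∀ i, Represents (T i) (L i)) :
    Represents (fun a => ∑ i ∈ s, T i a) fun κ => ∑ i ∈ s, L i κ := by
  induction s using Finset.cons_induction with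
  | empty => simpa using zero
  | cons i s hi ih => simpa only [Finset.sum_cons] using (h i).add ih

theorem lineDeriv (h : Represents T L) (m : SpaceTime d) :
    Represents (fun a => ∂_{m} (T a)) fun κ => -L (∂_{m} κ) := fun κ => by
  filter_upwards [h (∂_{m} κ), Lp.coeFn_neg (L (∂_{m} κ))] with a ha hL
  rw [hL, Pi.neg_apply, ← ha, Distribution.lineDerivOp_apply_apply, map_neg]

end Represents

/-- The regular distribution of a stationary field is represented by the averages of its value at
the origin over translations. -/
theorem Stationary.represents_extend (hE : E.Stationary) {X : E.Ω → ℝ} (hX : Measurable X)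
    (hX2 : MemLp X 2 E.law) :
    Represents (fun a => distOf (extend X a)) fun κ => hE.koopman.pair κ (hX2.toLp X) := fun κ => by
  filter_upwards [hE.ae_locallyIntegrable_extend hX (hX2.integrable one_le_two),
    hE.avg_ae_eq (UnitaryRep.integrable_testFunction (μ := volume) κ) measurable_id hX
      hX2] with a h1 h2
  rw [distOf_apply h1, UnitaryRep.pair, h2]
  rfl

end Ensemble

/-! ### Primitives in time -/

theorem intervalIntegrable_of_locallyIntegrable {h : ℝ → ℝ} (hh : LocallyIntegrable h volume)
    (a b : ℝ) : IntervalIntegrable h volume a b :=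
  intervalIntegrable_iff.mpr <|
    (hh.integrableOn_isCompact isCompact_uIcc).mono_set uIoc_subset_uIcc

/-- Integration by parts against the primitive of a merely locally integrable function. -/
theorem integral_deriv_mul_primitive {h ρ : ℝ → ℝ} (hh : LocallyIntegrable h volume)
    (hρ : ContDiff ℝ 1 ρ) (hρc : HasCompactSupport ρ) :
    ∫ t, deriv ρ t * (∫ τ in (0 : ℝ)..t, h τ) = -∫ t, ρ t * h t := by
  obtain ⟨R, hR, hsub⟩ : ∃ R : ℝ, 0 < R ∧ tsupport ρ ⊆ Ioo (-R) R := by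
    obtain ⟨R, hR, h⟩ := (Metric.isBounded_iff_subset_ball 0 |>.1 hρc.isBounded)
      |>.imp fun R h => (⟨le_max_right R 1, h⟩ : (1 : ℝ) ≤ max R 1 ∧ _)
    refine ⟨max R 1, by linarith, fun t ht => ?_⟩
    have := h ht
    rw [mem_ball_zero_iff, Real.norm_eq_abs, abs_lt] at this
    exact ⟨by linarith [le_max_left R 1], this.2.trans_le (le_max_left R 1)⟩
  have hvan : ∀ t, t ∉ Ioo (-R) R → ρ t = 0 := fun t ht =>
    image_eq_zero_of_notMem_tsupport fun h => ht (hsub h)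
  have hvan' : ∀ t, t ∉ Ioo (-R) R → deriv ρ t = 0 := fun t ht =>
    image_eq_zero_of_notMem_tsupport fun h => ht (hsub (tsupport_deriv_subset h))
  have hred : ∀ f : ℝ → ℝ, (∀ t, t ∉ Ioo (-R) R → f t = 0) →
      ∫ t, f t = ∫ t in (-R)..R, f t := fun f hf => by
    rw [intervalIntegral.integral_of_le (by linarith)]
    refine (setIntegral_eq_integral_of_forall_compl_eq_zero fun t ht => hf t fun h => ht ?_).symm
    exact Ioo_subset_Ioc_self h
  rw [hred _ fun t ht => by simp [hvan' t ht], hred _ fun t ht => by simp [hvan t ht]]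
  have hF : AbsolutelyContinuousOnInterval (fun t => ∫ τ in (0 : ℝ)..t, h τ) (-R) R :=
    (intervalIntegrable_of_locallyIntegrable hh _ _).absolutelyContinuousOnInterval_intervalIntegral
      (by rw [uIcc_of_le (by linarith)]; constructor <;> linarith)
  have hρa : AbsolutelyContinuousOnInterval ρ (-R) R :=
    hρ.contDiffOn.absolutelyContinuousOnInterval
  have h1 := hρa.integral_mul_deriv_eq_deriv_mul hF
  rw [hvan R (by simp), hvan (-R) (by simp)] at h1
  simp only [zero_mul, sub_zero, zero_sub] at h1
  rw [eq_neg_iff_add_eq_zero, add_comm, ← eq_neg_iff_add_eq_zero, ← h1]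
  refine intervalIntegral.integral_congr_ae ?_
  filter_upwards [LocallyIntegrable.ae_hasDerivAt_integral hh] with t ht _
  rw [(ht 0).deriv]

/-- The time primitive, vanishing at time `0`, of a function of time, as a function on
space-time. -/
def timePrimitive {d : ℕ} (h : ℝ → ℝ) (z : SpaceTime d) : ℝ := ∫ τ in (0 : ℝ)..z.2, h τ

section

variable {d : ℕ} {h : ℝ → ℝ}

theorem continuous_timePrimitive (hh : LocallyIntegrable h volume) :
    Continuous (timePrimitive (d := d) h) :=
  (intervalIntegral.continuous_primitive
    (fun a b => intervalIntegrable_of_locallyIntegrable hh a b) 0).comp continuous_snd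

theorem locallyIntegrable_comp_snd (hh : LocallyIntegrable h volume) :
    LocallyIntegrable (fun z : SpaceTime d => h z.2) volume := by
  refine locallyIntegrable_of_ball fun n => ?_
  have : IsFiniteMeasure (volume.restrict (Metric.ball (0 : EuclideanSpace ℝ (Fin d)) n)) :=
    ⟨by simpa using measure_ball_lt_top⟩
  have h1 : Integrable h (volume.restrict (Metric.ball (0 : ℝ) n)) :=
    (hh.integrableOn_isCompact (isCompact_closedBall (0 : ℝ) n)).mono_set
      Metric.ball_subset_closedBall
  have h2 := h1.comp_snd (volume.restrict (Metric.ball (0 : EuclideanSpace ℝ (Fin d)) n))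
  rw [Measure.prod_restrict, ball_prod_same] at h2
  exact h2

theorem dt_timePrimitive (hh : LocallyIntegrable h volume) :
    dt (distOf (timePrimitive (d := d) h)) = distOf fun z => h z.2 := by
  ext κ
  have hl := (continuous_timePrimitive (d := d) hh).locallyIntegrable (μ := volume)
  have hl' := locallyIntegrable_comp_snd (d := d) hh
  have hi : ∀ (κ : 𝓓((⊤ : Opens (SpaceTime d)), ℝ)) {f : SpaceTime d → ℝ},
      LocallyIntegrable f volume → Integrable fun z => κ z * f z := fun κ _ hf => by
    simpa using hf.integrable_smul_left_of_hasCompactSupport κ.continuous κ.hasCompactSupport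
  rw [dt, Distribution.lineDerivOp_apply_apply, map_neg, distOf_apply hl, distOf_apply hl',
    Measure.volume_eq_prod, integral_prod _ (hi _ hl), integral_prod _ (hi _ hl'), ← integral_neg]
  refine integral_congr_ae (ae_of_all _ fun x => ?_)
  simp only [timePrimitive]
  have hρ : ContDiff ℝ 1 fun t : ℝ => κ (x, t) :=
    (κ.contDiff.of_le (by simp)).comp (contDiff_const.prodMk contDiff_id)
  have hρc : HasCompactSupport fun t : ℝ => κ (x, t) :=
    κ.hasCompactSupport.comp_isClosedEmbedding ⟨isEmbedding_prodMkRight x, by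
      rw [show range (Prod.mk x) = Prod.fst ⁻¹' {x} by
        ext ⟨y, t⟩
        simp [eq_comm]]
      exact isClosed_singleton.preimage continuous_fst⟩
  have hd : ∀ t, (∂_{timeDir d} κ : 𝓓((⊤ : Opens (SpaceTime d)), ℝ)) (x, t) =
      deriv (fun t : ℝ => κ (x, t)) t := fun t => by
    rw [testFunction_lineDeriv_apply]
    have h1 : HasFDerivAt κ (fderiv ℝ κ (x, t)) (x, t) :=
      (κ.contDiff.differentiable (by simp)).differentiableAt.hasFDerivAt
    have h2 : HasDerivAt (fun t : ℝ => ((x, t) : SpaceTime d)) (timeDir d) t :=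
      (hasDerivAt_const t x).prodMk (hasDerivAt_id t)
    exact (h1.comp_hasDerivAt t h2).deriv.symm
  simp only [hd]
  rw [integral_deriv_mul_primitive hh hρ hρc, neg_neg]

theorem dx_timePrimitive (hh : LocallyIntegrable h volume) (k : Fin d) :
    dx k (distOf (timePrimitive (d := d) h)) = 0 := by
  ext κ
  have hc := continuous_timePrimitive (d := d) hh
  rw [dx, Distribution.lineDerivOp_apply_apply, map_neg, distOf_apply hc.locallyIntegrable]
  have := UnitaryRep.integral_smul_eq_neg_of_hasLineDerivAt (μ := volume) κ (m := spaceDir k)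
    (f := timePrimitive (d := d) h) (f' := fun _ => 0) hc continuous_const fun z => by
      change HasDerivAt (fun s : ℝ => timePrimitive (d := d) h (z + s • spaceDir k)) 0 0
      simp only [timePrimitive, Prod.snd_add, Prod.smul_snd, smul_zero, add_zero]
      exact hasDerivAt_const _ _
  simp only [smul_eq_mul, mul_zero, integral_zero, neg_zero] at this
  rw [this, neg_zero]
  rfl

end

namespace Ensemble

variable {d : ℕ} {E : Ensemble d}

/-! ### The potential of a stationary potential field -/

/-- The vector field in `L²` with the components `g j`. -/
def fieldClass {g : Fin d → E.Ω → ℝ} (hg : ∀ j, MemLp (g j) 2 E.law) :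
    UnitaryRep.VecField d (Lp ℝ 2 E.law) := WithLp.toLp 2 fun j => (hg j).toLp (g j)

@[simp] theorem fieldClass_apply {g : Fin d → E.Ω → ℝ} (hg : ∀ j, MemLp (g j) 2 E.law)
    (j : Fin d) : fieldClass hg j = (hg j).toLp (g j) := rfl

/-- The integrand of the homotopy formula at the point `z`. -/
def potentialIntegrand (η : EuclideanSpace ℝ (Fin d) → ℝ) (g : Fin d → E.Ω → ℝ) (a : E.Ω)
    (z : SpaceTime d) (p : EuclideanSpace ℝ (Fin d) × ℝ) : ℝ :=
  ∑ j, η p.1 * (z.1 j - p.1 j) * g j (E.shift (p.1 + p.2 • (z.1 - p.1), z.2) a)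

/-- The potential of the stationary field generated by `g`, obtained by integrating the field along
the segment from an anchor point `y` to `x` and averaging over `y` with the weight `η`. Time is a
parameter of this construction, which makes the potential stationary in time. -/
def potentialField (η : EuclideanSpace ℝ (Fin d) → ℝ) (g : Fin d → E.Ω → ℝ) (a : E.Ω)
    (z : SpaceTime d) : ℝ :=
  ∫ p, potentialIntegrand η g a z p ∂(volume.prod (volume.restrict (Icc (0 : ℝ) 1)))

theorem stationaryInTime_potentialField (η : EuclideanSpace ℝ (Fin d) → ℝ)
    (g : Fin d → E.Ω → ℝ) : StationaryInTime (potentialField η g) := fun a x t => by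
  simp only [potentialField, potentialIntegrand]
  refine integral_congr_ae (ae_of_all _ fun p => Finset.sum_congr rfl fun j _ => ?_)
  rw [← shift_add]
  simp

theorem potentialField_neg (η : EuclideanSpace ℝ (Fin d) → ℝ) (g : Fin d → E.Ω → ℝ) (a : E.Ω)
    (z : SpaceTime d) : potentialField η (fun j a => -g j a) a z = -potentialField η g a z := by
  simp only [potentialField, potentialIntegrand, mul_neg, Finset.sum_neg_distrib, integral_neg]

theorem measurable_potentialField {η : EuclideanSpace ℝ (Fin d) → ℝ} (hη : Measurable η)
    {g : Fin d → E.Ω → ℝ} (hg : ∀ j, Measurable (g j)) :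
    Measurable fun q : E.Ω × SpaceTime d => potentialField η g q.1 q.2 := by
  have h : Measurable fun r : (E.Ω × SpaceTime d) × (EuclideanSpace ℝ (Fin d) × ℝ) =>
      potentialIntegrand η g r.1.1 r.1.2 r.2 := by
    refine Finset.measurable_fun_sum _ fun j _ => ?_
    refine ((hη.comp (measurable_fst.comp measurable_snd)).mul ?_).mul
      ((hg j).comp (E.measurable_shift.comp ((measurable_fst.comp measurable_fst).prodMk ?_)))
    · have : Continuous fun q : SpaceTime d × (EuclideanSpace ℝ (Fin d) × ℝ) =>
          q.1.1 j - q.2.1 j := by fun_prop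
      exact this.measurable.comp ((measurable_snd.comp measurable_fst).prodMk measurable_snd)
    · exact UnitaryRep.measurable_homotopyPoint.comp
        ((measurable_snd.comp measurable_fst).prodMk measurable_snd)
  exact h.stronglyMeasurable.integral_prod_right.measurable

section

variable (η : 𝓓((⊤ : Opens (EuclideanSpace ℝ (Fin d))), ℝ)) {g : Fin d → E.Ω → ℝ}

theorem Stationary.ae_integrable_potentialIntegrand (hE : E.Stationary)
    (hg : ∀ j, Measurable (g j)) (hg2 : ∀ j, MemLp (g j) 2 E.law) {k : SpaceTime d → ℝ}
    (hk : Integrable k) (hkj : ∀ j, Integrable fun z : SpaceTime d => k z * z.1 j) :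
    ∀ᵐ a ∂E.law, Integrable (fun q => k q.1 * potentialIntegrand η g a q.1 q.2)
      (UnitaryRep.homotopyMeasure d) := by
  have h : ∀ j, ∀ᵐ a ∂E.law, Integrable (fun q : SpaceTime d × (EuclideanSpace ℝ (Fin d) × ℝ) =>
      k q.1 * (η q.2.1 * (q.1.1 j - q.2.1 j)) * g j (E.shift (UnitaryRep.homotopyPoint q) a))
      (UnitaryRep.homotopyMeasure d) := fun j =>
    hE.ae_integrable_shift (UnitaryRep.integrable_homotopyKernel_of_integrable η j hk (hkj j))
      UnitaryRep.measurable_homotopyPoint (hg j) ((hg2 j).integrable one_le_two)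
  filter_upwards [ae_all_iff.2 h] with a ha
  refine (integrable_finsetSum Finset.univ fun j _ => ha j).congr (ae_of_all _ fun q => ?_)
  simp only [potentialIntegrand, Finset.mul_sum, mul_assoc]

theorem Stationary.ae_locallyIntegrable_potentialField (hE : E.Stationary)
    (hg : ∀ j, Measurable (g j)) (hg2 : ∀ j, MemLp (g j) 2 E.law) :
    ∀ᵐ a ∂E.law, LocallyIntegrable (potentialField η g a) volume := by
  have h : ∀ n : ℕ, ∀ᵐ a ∂E.law,
      IntegrableOn (potentialField η g a) (Metric.ball 0 n) volume := fun n => by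
    have hb : MeasurableSet (Metric.ball (0 : SpaceTime d) n) := measurableSet_ball
    have hc : ∀ f : SpaceTime d → ℝ, Continuous f →
        Integrable ((Metric.ball (0 : SpaceTime d) n).indicator f) := fun f hf =>
      (integrable_indicator_iff hb).2 ((hf.locallyIntegrable.integrableOn_isCompact
        (isCompact_closedBall (0 : SpaceTime d) n)).mono_set Metric.ball_subset_closedBall)
    filter_upwards [hE.ae_integrable_potentialIntegrand η hg hg2
      (hc (fun _ => 1) continuous_const) fun j => by
        refine (hc (fun z => z.1 j) (by fun_prop)).congr (ae_of_all _ fun z => ?_)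
        by_cases hz : z ∈ Metric.ball (0 : SpaceTime d) n <;> simp [indicator, hz]] with a ha
    refine (integrable_indicator_iff hb).1 (ha.integral_prod_left.congr (ae_of_all _ fun z => ?_))
    simp only [integral_const_mul]
    by_cases hz : z ∈ Metric.ball (0 : SpaceTime d) n
    · rw [indicator_of_mem hz, indicator_of_mem hz, one_mul]
      rfl
    · rw [indicator_of_notMem hz, indicator_of_notMem hz, zero_mul]
  filter_upwards [ae_all_iff.2 h] with a ha
  exact locallyIntegrable_of_ball ha

theorem Stationary.isRandomField_potentialField (hE : E.Stationary)
    (hg : ∀ j, Measurable (g j)) (hg2 : ∀ j, MemLp (g j) 2 E.law) :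
    IsRandomField (potentialField (E := E) η g) :=
  ⟨measurable_potentialField η.continuous.measurable hg,
    hE.ae_locallyIntegrable_potentialField η hg hg2⟩

/-- `potentialField` is the realization of the homotopy operator `lift`. -/
theorem Stationary.represents_potentialField (hE : E.Stationary)
    (hg : ∀ j, Measurable (g j)) (hg2 : ∀ j, MemLp (g j) 2 E.law) :
    Represents (fun a => distOf (potentialField η g a))
      fun κ => hE.koopman.lift κ η (fieldClass hg2) := fun κ => by
  have h1 : ∀ j, ∀ᵐ a ∂E.law, _ := fun j =>
    hE.ae_integrable_shift (UnitaryRep.integrable_homotopyKernel κ η j)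
      UnitaryRep.measurable_homotopyPoint (hg j) ((hg2 j).integrable one_le_two)
  have h2 : ∀ j, ∀ᵐ a ∂E.law, _ := fun j =>
    hE.avg_ae_eq (UnitaryRep.integrable_homotopyKernel κ η j)
      UnitaryRep.measurable_homotopyPoint (hg j) (hg2 j)
  beta_reduce
  rw [UnitaryRep.lift_apply]
  filter_upwards [hE.ae_locallyIntegrable_potentialField η hg hg2, ae_all_iff.2 h1,
    ae_all_iff.2 h2, Lp.coeFn_finsetSum Finset.univ fun j =>
      hE.koopman.avg (UnitaryRep.homotopyMeasure d) (UnitaryRep.homotopyKernel κ η j)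
        UnitaryRep.homotopyPoint (fieldClass hg2 j)] with a hl h1 h2 h3
  rw [h3, Finset.sum_apply, distOf_apply hl]
  simp only [fieldClass_apply, h2]
  rw [← integral_finsetSum _ fun j _ => h1 j,
    integral_prod _ (integrable_finsetSum Finset.univ fun j _ => h1 j)]
  refine integral_congr_ae (ae_of_all _ fun z => ?_)
  simp only [potentialField]
  rw [← integral_const_mul]
  refine integral_congr_ae (ae_of_all _ fun p => ?_)
  simp only [potentialIntegrand, Finset.mul_sum, mul_assoc]

end

/-! ### Random variables in `L²` -/

theorem norm_toLp_sq {X : E.Ω → ℝ} (hX : MemLp X 2 E.law) :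
    ‖hX.toLp X‖ ^ 2 = ∫ a, X a ^ 2 ∂E.law := by
  rw [← real_inner_self_eq_norm_sq, L2.inner_def]
  refine integral_congr_ae ?_
  filter_upwards [hX.coeFn_toLp] with a ha
  rw [ha]
  simp [sq]

variable (E) in
/-- The constant function `1` in `L²`. -/
def one : Lp ℝ 2 E.law := (memLp_const (1 : ℝ)).toLp fun _ => 1

theorem norm_one : ‖E.one‖ = 1 := by
  have := norm_toLp_sq (E := E) (memLp_const (1 : ℝ))
  simp only [one_pow, integral_const, probReal_univ, smul_eq_mul, mul_one] at this
  exact (pow_eq_one_iff_of_nonneg (norm_nonneg _) two_ne_zero).1 this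

theorem Stationary.invariant_one (hE : E.Stationary) : hE.koopman.Invariant E.one := fun x => by
  refine Lp.ext ?_
  have h1 := Lp.coeFn_compMeasurePreserving E.one (hE.measurePreserving (x, 0))
  have h2 : E.one =ᵐ[E.law] fun _ => 1 := (memLp_const (1 : ℝ)).coeFn_toLp
  filter_upwards [h1, h2, (hE.measurePreserving (x, 0)).quasiMeasurePreserving.ae
    h2] with a h1 h2 h3
  rw [h2, ← h3]
  exact h1

theorem inner_one (u : Lp ℝ 2 E.law) : ⟪u, E.one⟫ = ∫ a, u a ∂E.law := by
  rw [L2.inner_def]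
  refine integral_congr_ae ?_
  filter_upwards [(memLp_const (μ := E.law) (p := 2) (1 : ℝ)).coeFn_toLp] with a ha
  simp only [one, ha]
  simp

theorem inner_toLp_one {X : E.Ω → ℝ} (hX : MemLp X 2 E.law) :
    ⟪hX.toLp X, E.one⟫ = ∫ a, X a ∂E.law := by
  rw [inner_one]
  exact integral_congr_ae hX.coeFn_toLp

/-- The random vector with the components `g j`. -/
def vec (g : Fin d → E.Ω → ℝ) (a : E.Ω) : EuclideanSpace ℝ (Fin d) := WithLp.toLp 2 fun j => g j a

theorem measurable_vec {g : Fin d → E.Ω → ℝ} (hg : ∀ j, Measurable (g j)) : Measurable (vec g) :=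
  (WithLp.measurable_toLp 2 _).comp (measurable_pi_lambda _ hg)

theorem memLp_vec {g : Fin d → E.Ω → ℝ} (hg : ∀ j, MemLp (g j) 2 E.law) :
    MemLp (vec g) 2 E.law :=
  MemLp.of_eval_piLp hg

theorem integral_vec_apply {g : Fin d → E.Ω → ℝ} (hg : ∀ j, MemLp (g j) 2 E.law) (j : Fin d) :
    (∫ a, vec g a ∂E.law) j = ∫ a, g j a ∂E.law :=
  eval_integral_piLp (fun j => (hg j).integrable one_le_two) j

theorem integral_norm_vec_sq {g : Fin d → E.Ω → ℝ} (hg : ∀ j, MemLp (g j) 2 E.law) :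
    ∫ a, ‖vec g a‖ ^ 2 ∂E.law = ‖fieldClass hg‖ ^ 2 := by
  simp only [EuclideanSpace.real_norm_sq_eq, PiLp.norm_sq_eq_of_L2, vec]
  rw [integral_finsetSum _ fun j _ => (hg j).integrable_sq]
  exact Finset.sum_congr rfl fun j _ => (norm_toLp_sq (hg j)).symm

theorem Stationary.ae_locallyIntegrable_extend_vec (hE : E.Stationary) {g : Fin d → E.Ω → ℝ}
    (hg : ∀ j, Measurable (g j)) (hg2 : ∀ j, MemLp (g j) 2 E.law) :
    ∀ᵐ a ∂E.law, LocallyIntegrable (extend (vec g) a) volume := by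
  filter_upwards [ae_all_iff.2 fun j =>
    hE.ae_locallyIntegrable_extend (hg j) ((hg2 j).integrable one_le_two)] with a ha x
  choose s hs hs' using fun j => ha j x
  refine ⟨⋂ j, s j, (iInter_mem).2 hs, ?_⟩
  exact Integrable.of_eval_piLp fun j => (hs' j).mono_set (iInter_subset _ j)

/-- The mean of the gradient vanishes because potential fields are orthogonal to constants. -/
theorem Stationary.hasStationaryGradient (hE : E.Stationary) {g : Fin d → E.Ω → ℝ}
    (hg : ∀ j, Measurable (g j)) (hg2 : ∀ j, MemLp (g j) 2 E.law)
    (hpot : fieldClass hg2 ∈ hE.koopman.potential) {f : E.Ω → SpaceTime d → ℝ}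
    (hf : ∀ k, Represents (fun a => dx k (distOf (f a)))
      fun κ => hE.koopman.pair κ (fieldClass hg2 k)) :
    HasStationaryGradient f (vec g) := by
  refine ⟨measurable_vec hg, memLp_vec hg2, ?_, ?_⟩
  · ext j
    rw [integral_vec_apply hg2, ← inner_toLp_one (hg2 j)]
    exact hE.koopman.inner_potential_invariant hpot hE.invariant_one j
  · filter_upwards [hE.ae_locallyIntegrable_extend_vec hg hg2, ae_all_iff.2 fun k =>
      (hf k).ae_eq (hE.represents_extend (hg k) (hg2 k)) fun κ => rfl] with a h1 h2
    exact ⟨h1, fun k => h2 k⟩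

theorem Stationary.represents_dx_potentialField (hE : E.Stationary)
    (η : 𝓓((⊤ : Opens (EuclideanSpace ℝ (Fin d))), ℝ)) (hη : ∫ y, η y = 1)
    {g : Fin d → E.Ω → ℝ} (hg : ∀ j, Measurable (g j)) (hg2 : ∀ j, MemLp (g j) 2 E.law)
    (hpot : fieldClass hg2 ∈ hE.koopman.potential) (k : Fin d) :
    Represents (fun a => dx k (distOf (potentialField η g a)))
      fun κ => hE.koopman.pair κ (fieldClass hg2 k) := by
  have := (hE.represents_potentialField η hg hg2).lineDeriv (spaceDir k)
  simpa only [hE.koopman.lift_spaceDeriv _ η hη hpot, neg_neg] using this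

end Ensemble

namespace Ensemble

variable {d : ℕ} {E : Ensemble d}

/-! ### The spatially invariant σ-algebra -/

/-- The realization of `X` along the spatial translates of `a` is almost everywhere equal to
`c`. -/
def IsSpatialConst (X : E.Ω → ℝ) (a : E.Ω) (c : ℝ) : Prop :=
  ∀ᵐ x : EuclideanSpace ℝ (Fin d), X (E.shift (x, 0) a) = c

theorem IsSpatialConst.shift {X : E.Ω → ℝ} {a : E.Ω} {c : ℝ} (h : IsSpatialConst X a c)
    (y : EuclideanSpace ℝ (Fin d)) : IsSpatialConst X (E.shift (y, 0) a) c := by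
  filter_upwards [(measurePreserving_add_right volume y).quasiMeasurePreserving.ae h] with x hx
  rw [← shift_add]
  simpa using hx

theorem isSpatialConst_shift {X : E.Ω → ℝ} {a : E.Ω} {c : ℝ} (y : EuclideanSpace ℝ (Fin d)) :
    IsSpatialConst X (E.shift (y, 0) a) c ↔ IsSpatialConst X a c := by
  refine ⟨fun h => ?_, fun h => h.shift y⟩
  have := h.shift (-y)
  rwa [← shift_add, Prod.mk_add_mk, neg_add_cancel, add_zero, ← Prod.zero_eq_mk, shift_zero] at this

/-- A function is almost everywhere equal to a constant if and only if the double integral of its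
differences vanishes, which is a measurable condition. -/
theorem measurableSet_exists_isSpatialConst {X : E.Ω → ℝ} (hX : Measurable X) :
    MeasurableSet {a | ∃ c, IsSpatialConst X a c} := by
  let D : E.Ω × (EuclideanSpace ℝ (Fin d) × EuclideanSpace ℝ (Fin d)) → ℝ := fun q =>
    X (E.shift (q.2.1, 0) q.1) - X (E.shift (q.2.2, 0) q.1)
  have hD : Measurable D := by
    refine (hX.comp (E.measurable_shift.comp (measurable_fst.prodMk ?_))).sub
      (hX.comp (E.measurable_shift.comp (measurable_fst.prodMk ?_)))
    · exact (measurable_fst.comp measurable_snd).prodMk measurable_const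
    · exact (measurable_snd.comp measurable_snd).prodMk measurable_const
  have hset : {a | ∃ c, IsSpatialConst X a c} =
      (fun a => ∫⁻ p, ‖D (a, p)‖ₑ ∂(volume.prod volume)) ⁻¹' {0} := by
    ext a
    have hDa : Measurable fun p => ‖D (a, p)‖ₑ := (hD.comp measurable_prodMk_left).enorm
    simp only [mem_ofPred_eq, mem_preimage, mem_singleton_iff]
    rw [lintegral_eq_zero_iff hDa]
    refine ⟨fun ⟨c, hc⟩ => ?_, fun h => ?_⟩
    · filter_upwards [Measure.quasiMeasurePreserving_fst.ae hc,
        Measure.quasiMeasurePreserving_snd.ae hc] with p h1 h2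
      simp [D, h1, h2]
    · obtain ⟨x, hx⟩ := (Measure.ae_ae_of_ae_prod h).exists
      refine ⟨X (E.shift (x, 0) a), ?_⟩
      filter_upwards [hx] with y hy
      simp only [D, Pi.zero_apply, enorm_eq_zero, sub_eq_zero] at hy
      exact hy.symm
  rw [hset]
  exact (hD.enorm.lintegral_prod_right') (measurableSet_singleton 0)

open Classical in
/-- The version of a spatially invariant random variable which is exactly invariant: the almost
everywhere constant value of its realization in space, which is its integral with respect to a
probability measure with the null sets of Lebesgue measure, and `0` where there is no such
value. -/
def invariantVersion (X : E.Ω → ℝ) (a : E.Ω) : ℝ :=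
  if ∃ c, IsSpatialConst X a c then
    ∫ x, X (E.shift (x, 0) a) ∂(volume : Measure (EuclideanSpace ℝ (Fin d))).toFinite
  else 0

theorem IsSpatialConst.invariantVersion_eq {X : E.Ω → ℝ} {a : E.Ω} {c : ℝ}
    (h : IsSpatialConst X a c) : invariantVersion X a = c := by
  have h' : ∀ᵐ x ∂(volume : Measure (EuclideanSpace ℝ (Fin d))).toFinite,
      X (E.shift (x, 0) a) = c := by
    rw [ae_toFinite]
    exact h
  rw [invariantVersion, if_pos ⟨c, h⟩, integral_congr_ae h']
  simp

theorem invariantVersion_shift (X : E.Ω → ℝ) (a : E.Ω) (y : EuclideanSpace ℝ (Fin d)) :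
    invariantVersion X (E.shift (y, 0) a) = invariantVersion X a := by
  by_cases h : ∃ c, IsSpatialConst X a c
  · obtain ⟨c, hc⟩ := h
    rw [hc.invariantVersion_eq, (hc.shift y).invariantVersion_eq]
  · have h' : ¬∃ c, IsSpatialConst X (E.shift (y, 0) a) c := by
      simpa only [isSpatialConst_shift] using h
    rw [invariantVersion, invariantVersion, if_neg h, if_neg h']

theorem measurable_invariantVersion {X : E.Ω → ℝ} (hX : Measurable X) :
    Measurable[E.spatialInvariants] (invariantVersion X) := by
  have hm : Measurable (invariantVersion X) := by
    classical
    refine Measurable.ite (measurableSet_exists_isSpatialConst hX) ?_ measurable_const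
    have : Measurable fun q : E.Ω × EuclideanSpace ℝ (Fin d) => X (E.shift (q.2, 0) q.1) :=
      hX.comp (E.measurable_shift.comp
        (measurable_fst.prodMk (measurable_snd.prodMk measurable_const)))
    exact this.stronglyMeasurable.integral_prod_right.measurable
  intro s hs
  refine MeasurableSpace.measurableSet_iInf.2 fun y =>
    (MeasurableSpace.measurable_invariants_dom.2 ⟨hm, fun s _ => ?_⟩) hs
  rw [show invariantVersion X ∘ E.shift (y, 0) = invariantVersion X from
    funext fun a => invariantVersion_shift X a y]

/-- An element of `L²` that is invariant under each spatial translation, up to null sets which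
depend on the translation, is measurable with respect to the σ-algebra of the events which are
exactly invariant. -/
theorem Stationary.aestronglyMeasurable_of_invariant (hE : E.Stationary) {u : Lp ℝ 2 E.law}
    (hu : hE.koopman.Invariant u) : AEStronglyMeasurable[E.spatialInvariants] u E.law := by
  have hm : Measurable u := (Lp.stronglyMeasurable u).measurable
  refine ⟨invariantVersion u, (measurable_invariantVersion hm).stronglyMeasurable, ?_⟩
  have h1 : ∀ x : EuclideanSpace ℝ (Fin d), ∀ᵐ a ∂E.law, u (E.shift (x, 0) a) = u a := fun x => by
    have := Lp.coeFn_compMeasurePreserving u (hE.measurePreserving (x, 0))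
    have h2 : Lp.compMeasurePreserving _ (hE.measurePreserving (x, 0)) u = u := hu x
    rw [h2] at this
    filter_upwards [this] with a ha using ha.symm
  have hjm : MeasurableSet {q : EuclideanSpace ℝ (Fin d) × E.Ω |
      u (E.shift (q.1, 0) q.2) = u q.2} :=
    measurableSet_eq_fun (hm.comp (E.measurable_shift.comp
      (measurable_snd.prodMk (measurable_fst.prodMk measurable_const)))) (hm.comp measurable_snd)
  filter_upwards [(Measure.ae_ae_comm hjm).1 (ae_of_all volume h1)] with a ha
  exact (IsSpatialConst.invariantVersion_eq ha).symm

/-! ### The conditional expectation with respect to the spatially invariant σ-algebra -/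

section CondExp

variable {X : E.Ω → EuclideanSpace ℝ (Fin d)}

theorem measurable_condExp_invariants (X : E.Ω → EuclideanSpace ℝ (Fin d)) :
    Measurable (E.law[X | E.spatialInvariants]) :=
  (stronglyMeasurable_condExp.mono E.spatialInvariants_le).measurable

theorem condExp_invariants_shift (X : E.Ω → EuclideanSpace ℝ (Fin d)) (a : E.Ω)
    (x : EuclideanSpace ℝ (Fin d)) :
    E.law[X | E.spatialInvariants] (E.shift (x, 0) a) = E.law[X | E.spatialInvariants] a := by
  have h : Measurable[E.spatialInvariants] (E.law[X | E.spatialInvariants]) :=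
    stronglyMeasurable_condExp.measurable
  have h' : Measurable[MeasurableSpace.invariants (E.shift (x, 0))]
      (E.law[X | E.spatialInvariants]) := fun s hs => iInf_le (fun x : EuclideanSpace ℝ (Fin d) =>
        MeasurableSpace.invariants (E.shift (x, 0))) x _ (h hs)
  exact congrFun (MeasurableSpace.comp_eq_of_measurable_invariants h') a

theorem memLp_condExp_invariants (hX : MemLp X 2 E.law) :
    MemLp (E.law[X | E.spatialInvariants]) 2 E.law := hX.condExp one_le_two

theorem memLp_apply {Y : E.Ω → EuclideanSpace ℝ (Fin d)} (hY : MemLp Y 2 E.law) (j : Fin d) :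
    MemLp (fun a => Y a j) 2 E.law := hY.eval_piLp j

theorem Stationary.invariant_condExp (hE : E.Stationary) (hX : MemLp X 2 E.law) (j : Fin d) :
    hE.koopman.Invariant ((memLp_apply (memLp_condExp_invariants hX) j).toLp _) := fun x => by
  set hY := memLp_apply (memLp_condExp_invariants hX) j
  refine Lp.ext ?_
  have h1 := Lp.coeFn_compMeasurePreserving (hY.toLp _) (hE.measurePreserving (x, 0))
  filter_upwards [h1, hY.coeFn_toLp,
    (hE.measurePreserving (x, 0)).quasiMeasurePreserving.ae hY.coeFn_toLp] with a h1 h2 h3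
  refine (h1.trans (h3.trans ?_)).trans h2.symm
  rw [condExp_invariants_shift]

/-- The conditional expectation is the orthogonal projection on the spatially invariant elements of
`L²`. -/
theorem Stationary.inner_sub_condExp (hE : E.Stationary) (hX : MemLp X 2 E.law) (j : Fin d)
    {u : Lp ℝ 2 E.law} (hu : hE.koopman.Invariant u) :
    ⟪(memLp_apply hX j).toLp _ - (memLp_apply (memLp_condExp_invariants hX) j).toLp _, u⟫ = 0 := by
  have hu' := hE.aestronglyMeasurable_of_invariant hu
  have hXj := memLp_apply hX j
  have hYj := memLp_apply (memLp_condExp_invariants hX) j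
  have hXu : Integrable ((fun a => X a j) * (u : E.Ω → ℝ)) E.law := hXj.integrable_mul (Lp.memLp u)
  have h1 := condExp_mul_of_aestronglyMeasurable_right hu' hXu (hXj.integrable one_le_two)
  have h2 := (EuclideanSpace.proj (𝕜 := ℝ) j).comp_condExp_comm (m := E.spatialInvariants)
    (hX.integrable one_le_two)
  have hin : ∀ {Z : E.Ω → ℝ} (hZ : MemLp Z 2 E.law), ⟪hZ.toLp Z, u⟫ = ∫ a, Z a * u a ∂E.law :=
    fun hZ => by
      rw [L2.inner_def]
      refine integral_congr_ae ?_
      filter_upwards [hZ.coeFn_toLp] with a ha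
      rw [ha]
      simp [mul_comm]
  rw [inner_sub_left, hin, hin, sub_eq_zero]
  calc ∫ a, X a j * u a ∂E.law =
        ∫ a, (E.law[(fun a => X a j) * (u : E.Ω → ℝ) | E.spatialInvariants]) a ∂E.law :=
        (integral_condExp E.spatialInvariants_le).symm
    _ = ∫ a, (E.law[X | E.spatialInvariants]) a j * u a ∂E.law := by
      refine integral_congr_ae ?_
      filter_upwards [h1, h2] with a h1 h2
      rw [h1, Pi.mul_apply]
      congr 1
      exact h2.symm

theorem integral_norm_condExp_sq_le (hX : MemLp X 2 E.law) :
    ∫ a, ‖E.law[X | E.spatialInvariants] a‖ ^ 2 ∂E.law ≤ ∫ a, ‖X a‖ ^ 2 ∂E.law := by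
  have h := eLpNorm_condExp_le_eLpNorm (m := E.spatialInvariants) (μ := E.law) X one_le_two
  have h1 : ∀ {Z : E.Ω → EuclideanSpace ℝ (Fin d)}, MemLp Z 2 E.law →
      ∫ a, ‖Z a‖ ^ 2 ∂E.law = (eLpNorm Z 2 E.law ^ 2).toReal := fun {Z} hZ => by
    rw [eLpNorm_two_pow_two, integral_eq_lintegral_of_nonneg_ae (ae_of_all _ fun _ => by positivity)
      (f := fun a => ‖Z a‖ ^ 2) (hZ.1.norm.pow 2)]
    congr 1
    refine lintegral_congr fun a => ?_
    rw [ENNReal.ofReal_pow (norm_nonneg _), ofReal_norm]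
  rw [h1 hX, h1 (memLp_condExp_invariants hX)]
  exact ENNReal.toReal_mono (ENNReal.pow_ne_top hX.eLpNorm_ne_top) (by gcongr)

end CondExp

end Ensemble

/-! ### The coefficient field as an operator on `L²` -/

section

variable {α F : Type*} [MeasurableSpace α] {μ : Measure α} [NormedAddCommGroup F]
  [InnerProductSpace ℝ F] {X Y : α → F}

theorem integrable_norm_sq_of_memLp (hX : MemLp X 2 μ) : Integrable (fun a => ‖X a‖ ^ 2) μ :=
  (memLp_two_iff_integrable_sq_norm hX.1).1 hX

theorem integrable_inner_of_memLp (hX : MemLp X 2 μ) (hY : MemLp Y 2 μ) :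
    Integrable (fun a => ⟪X a, Y a⟫) μ := by
  refine (L2.integrable_inner (𝕜 := ℝ) (hX.toLp X) (hY.toLp Y)).congr ?_
  filter_upwards [hX.coeFn_toLp, hY.coeFn_toLp] with a h1 h2
  rw [h1, h2]

end

/-- The matrix `M` is bounded by `1` and bounded below by `lam`. -/
def IsElliptic {d : ℕ} (lam : ℝ) (M : Matrix (Fin d) (Fin d) ℝ) : Prop :=
  ∀ ξ : EuclideanSpace ℝ (Fin d),
    ‖M.toEuclideanLin ξ‖ ≤ ‖ξ‖ ∧ lam * ‖ξ‖ ^ 2 ≤ inner ℝ ξ (M.toEuclideanLin ξ)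

namespace Ensemble

variable {d : ℕ} {E : Ensemble d} {lam : ℝ}

theorem measurableSet_isElliptic (lam : ℝ) :
    MeasurableSet {a : E.Ω | IsElliptic lam (E.coeff a 0)} := by
  have h : IsClosed {M : Fin d → Fin d → ℝ | IsElliptic lam (Matrix.of M)} := by
    have hc : ∀ ξ : EuclideanSpace ℝ (Fin d), Continuous fun M : Fin d → Fin d → ℝ =>
        (Matrix.of M).toEuclideanLin ξ := fun ξ => by
      have : (fun M : Fin d → Fin d → ℝ => (Matrix.of M).toEuclideanLin ξ) =
          fun M => WithLp.toLp 2 (Matrix.mulVec (Matrix.of M) (WithLp.ofLp ξ)) := rfl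
      rw [this]
      exact (PiLp.continuous_toLp 2 _).comp
        (Continuous.matrix_mulVec continuous_id continuous_const)
    have : {M : Fin d → Fin d → ℝ | IsElliptic lam (Matrix.of M)} =
        ⋂ ξ : EuclideanSpace ℝ (Fin d), {M | ‖(Matrix.of M).toEuclideanLin ξ‖ ≤ ‖ξ‖} ∩
          {M | lam * ‖ξ‖ ^ 2 ≤ inner ℝ ξ ((Matrix.of M).toEuclideanLin ξ)} := by
      ext M
      simp [IsElliptic]
    rw [this]
    exact isClosed_iInter fun ξ => (isClosed_le (hc ξ).norm continuous_const).inter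
      (isClosed_le continuous_const (continuous_const.inner (hc ξ)))
  have hm : Measurable fun a : E.Ω => fun i j => E.coeff a 0 i j :=
    measurable_pi_lambda _ fun i => measurable_pi_lambda _ fun j =>
      (E.measurable_coeff i j).comp measurable_prodMk_right
  exact hm h.measurableSet

/-- By stationarity, ellipticity almost everywhere in space-time gives ellipticity at the origin. -/
theorem Stationary.ae_isElliptic (hE : E.Stationary) (h : E.UniformlyElliptic lam) :
    ∀ᵐ a ∂E.law, IsElliptic lam (E.coeff a 0) := by
  have hS := measurableSet_isElliptic (E := E) lam
  have h1 : ∀ᵐ a ∂E.law, ∀ᵐ z : SpaceTime d, IsElliptic lam (E.coeff (E.shift z a) 0) := by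
    filter_upwards [h] with a ha
    filter_upwards [ha] with z hz
    rw [E.coeff_shift, zero_add]
    exact hz
  obtain ⟨z, hz⟩ := ((Measure.ae_ae_comm
    (p := fun a (z : SpaceTime d) => IsElliptic lam (E.coeff (E.shift z a) 0))
    (E.measurable_shift hS)).1 h1).exists
  have := (hE.measurePreserving z).measure_preimage hS.compl.nullMeasurableSet
  rw [ae_iff] at hz ⊢
  exact this.symm.trans hz

/-- The product of the coefficient field at the origin with the random vector `v`. -/
def coeffMul (v : Fin d → E.Ω → ℝ) (j : Fin d) (a : E.Ω) : ℝ := ∑ k, E.coeff a 0 j k * v k a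

theorem toEuclideanLin_vec (v : Fin d → E.Ω → ℝ) (a : E.Ω) :
    (E.coeff a 0).toEuclideanLin (vec v a) = vec (coeffMul v) a := rfl

theorem measurable_coeff_zero (j k : Fin d) : Measurable fun a : E.Ω => E.coeff a 0 j k :=
  (E.measurable_coeff j k).comp measurable_prodMk_right

theorem measurable_coeffMul {v : Fin d → E.Ω → ℝ} (hv : ∀ j, Measurable (v j)) (j : Fin d) :
    Measurable (coeffMul v j) :=
  Finset.measurable_fun_sum _ fun k _ => (measurable_coeff_zero j k).mul (hv k)

theorem memLp_coeffMul (hell : ∀ᵐ a ∂E.law, IsElliptic lam (E.coeff a 0)) {v : Fin d → E.Ω → ℝ}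
    (hv : ∀ j, MemLp (v j) 2 E.law) (j : Fin d) : MemLp (coeffMul v j) 2 E.law := by
  refine (memLp_vec hv).of_le ?_ ?_
  · exact Finset.aestronglyMeasurable_fun_sum _ fun k _ =>
      (measurable_coeff_zero j k).aestronglyMeasurable.mul (hv k).1
  · filter_upwards [hell] with a ha
    exact (PiLp.norm_apply_le (vec (coeffMul v) a) j).trans (ha (vec v a)).1

theorem inner_fieldClass {v w : Fin d → E.Ω → ℝ} (hv : ∀ j, MemLp (v j) 2 E.law)
    (hw : ∀ j, MemLp (w j) 2 E.law) :
    ⟪fieldClass hv, fieldClass hw⟫ = ∫ a, ⟪vec v a, vec w a⟫ ∂E.law := by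
  rw [UnitaryRep.inner_vecField]
  simp only [PiLp.inner_apply, vec]
  rw [integral_finsetSum _ fun j _ => integrable_inner_of_memLp (hv j) (hw j)]
  refine Finset.sum_congr rfl fun j _ => ?_
  rw [L2.inner_def]
  refine integral_congr_ae ?_
  filter_upwards [(hv j).coeFn_toLp, (hw j).coeFn_toLp] with a h1 h2
  simp only [fieldClass_apply, h1, h2]

theorem fieldClass_coeFn (f : UnitaryRep.VecField d (Lp ℝ 2 E.law)) :
    fieldClass (fun j => Lp.memLp (f j)) = f := by
  ext1 j
  exact Lp.toLp_coeFn (f j) (Lp.memLp (f j))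

theorem norm_fieldClass_coeffMul_le (hell : ∀ᵐ a ∂E.law, IsElliptic lam (E.coeff a 0))
    {v : Fin d → E.Ω → ℝ} (hv : ∀ j, MemLp (v j) 2 E.law) :
    ‖fieldClass (memLp_coeffMul hell hv)‖ ≤ ‖fieldClass hv‖ := by
  refine le_of_sq_le_sq ?_ (norm_nonneg _)
  rw [← integral_norm_vec_sq, ← integral_norm_vec_sq]
  refine integral_mono_ae (integrable_norm_sq_of_memLp (memLp_vec (memLp_coeffMul hell hv)))
    (integrable_norm_sq_of_memLp (memLp_vec hv)) ?_
  filter_upwards [hell] with a ha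
  exact pow_le_pow_left₀ (norm_nonneg _) (ha (vec v a)).1 2

/-- Multiplication with the coefficient field, as an operator on `L²` vector fields. -/
def coeffOp (hell : ∀ᵐ a ∂E.law, IsElliptic lam (E.coeff a 0)) :
    UnitaryRep.VecField d (Lp ℝ 2 E.law) →L[ℝ] UnitaryRep.VecField d (Lp ℝ 2 E.law) :=
  LinearMap.mkContinuous
    { toFun := fun f => fieldClass (memLp_coeffMul hell fun j => Lp.memLp (f j))
      map_add' := fun f g => by
        ext1 j
        rw [PiLp.add_apply, fieldClass_apply, fieldClass_apply, fieldClass_apply, ← MemLp.toLp_add,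
          MemLp.toLp_eq_toLp_iff]
        filter_upwards [ae_all_iff.2 fun k => Lp.coeFn_add (f k) (g k)] with a ha
        simp only [coeffMul, PiLp.add_apply, ha, Pi.add_apply, mul_add, Finset.sum_add_distrib]
      map_smul' := fun c f => by
        ext1 j
        rw [PiLp.smul_apply, fieldClass_apply, fieldClass_apply, RingHom.id_apply,
          ← MemLp.toLp_const_smul, MemLp.toLp_eq_toLp_iff]
        filter_upwards [ae_all_iff.2 fun k => Lp.coeFn_smul c (f k)] with a ha
        simp only [coeffMul, PiLp.smul_apply, ha, Pi.smul_apply, smul_eq_mul, Finset.mul_sum]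
        exact Finset.sum_congr rfl fun k _ => by ring }
    1 fun f => by
      rw [one_mul]
      refine (norm_fieldClass_coeffMul_le hell fun j => Lp.memLp (f j)).trans_eq ?_
      rw [fieldClass_coeFn]

theorem coeffOp_fieldClass (hell : ∀ᵐ a ∂E.law, IsElliptic lam (E.coeff a 0))
    {v : Fin d → E.Ω → ℝ} (hv : ∀ j, MemLp (v j) 2 E.law) :
    coeffOp hell (fieldClass hv) = fieldClass (memLp_coeffMul hell hv) := by
  ext1 j
  refine (MemLp.toLp_eq_toLp_iff
    (memLp_coeffMul hell (fun k => Lp.memLp (fieldClass hv k)) j) (memLp_coeffMul hell hv j)).2 ?_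
  filter_upwards [ae_all_iff.2 fun k => (hv k).coeFn_toLp] with a ha
  simp only [coeffMul, fieldClass_apply, ha]

theorem norm_coeffOp_le (hell : ∀ᵐ a ∂E.law, IsElliptic lam (E.coeff a 0))
    (f : UnitaryRep.VecField d (Lp ℝ 2 E.law)) : ‖coeffOp hell f‖ ≤ ‖f‖ := by
  rw [← fieldClass_coeFn f, coeffOp_fieldClass]
  exact norm_fieldClass_coeffMul_le hell _

theorem inner_coeffOp_ge (hell : ∀ᵐ a ∂E.law, IsElliptic lam (E.coeff a 0))
    (f : UnitaryRep.VecField d (Lp ℝ 2 E.law)) : lam * ‖f‖ ^ 2 ≤ ⟪coeffOp hell f, f⟫ := by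
  rw [← fieldClass_coeFn f, coeffOp_fieldClass, real_inner_comm, inner_fieldClass,
    ← integral_norm_vec_sq, ← integral_const_mul]
  have hv := fun j => Lp.memLp (f j)
  refine integral_mono_ae ((integrable_norm_sq_of_memLp (memLp_vec hv)).const_mul lam)
    (integrable_inner_of_memLp (memLp_vec hv) (memLp_vec (memLp_coeffMul hell hv))) ?_
  filter_upwards [hell] with a ha
  exact (ha (vec _ a)).2

end Ensemble

/-! ### Random primitives in time -/

theorem lineDeriv_distribution_sub {d : ℕ} (m : SpaceTime d) (T T' : SpaceTimeDistribution d) :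
    ∂_{m} (T - T') = ∂_{m} T - ∂_{m} T' := map_sub (Distribution.lineDerivCLM m) T T'

namespace Ensemble

variable {d : ℕ} {E : Ensemble d}

theorem integrable_one_restrict_ball {V : Type*} [NormedAddCommGroup V] [MeasurableSpace V]
    {μ : Measure V} [ProperSpace V] [IsFiniteMeasureOnCompacts μ] (n : ℕ) :
    Integrable (fun _ : V => (1 : ℝ)) (μ.restrict (Metric.ball 0 n)) := by
  have : IsFiniteMeasure (μ.restrict (Metric.ball (0 : V) n)) :=
    ⟨by simpa using measure_ball_lt_top⟩
  exact integrable_const _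

theorem measurable_timePrimitive {h : E.Ω → ℝ → ℝ}
    (hh : Measurable fun p : E.Ω × ℝ => h p.1 p.2) :
    Measurable fun q : E.Ω × SpaceTime d => timePrimitive (h q.1) q.2 := by
  -- the two indicators are the two signs of the interval integral
  have key : ∀ S : Set ((E.Ω × SpaceTime d) × ℝ), MeasurableSet S →
      Measurable fun q : E.Ω × SpaceTime d => ∫ τ, S.indicator (fun r => h r.1.1 r.2) (q, τ) :=
    fun S hS => by
      have : Measurable fun r : (E.Ω × SpaceTime d) × ℝ => h r.1.1 r.2 :=
        hh.comp ((measurable_fst.comp measurable_fst).prodMk measurable_snd)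
      exact (this.indicator hS).stronglyMeasurable.integral_prod_right'.measurable
  have ht : Measurable fun r : (E.Ω × SpaceTime d) × ℝ => r.1.2.2 :=
    measurable_snd.comp (measurable_snd.comp measurable_fst)
  have h0 : Measurable fun _ : (E.Ω × SpaceTime d) × ℝ => (0 : ℝ) := measurable_const
  have h1 := key {r | 0 < r.2 ∧ r.2 ≤ r.1.2.2}
    ((measurableSet_lt h0 measurable_snd).inter (measurableSet_le measurable_snd ht))
  have h2 := key {r | r.1.2.2 < r.2 ∧ r.2 ≤ 0}
    ((measurableSet_lt ht measurable_snd).inter (measurableSet_le measurable_snd h0))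
  convert h1.sub h2 using 2 with q
  rw [timePrimitive, intervalIntegral, ← integral_indicator measurableSet_Ioc,
    ← integral_indicator measurableSet_Ioc]
  rfl

theorem isRandomField_timePrimitive {h : E.Ω → ℝ → ℝ}
    (hh : Measurable fun p : E.Ω × ℝ => h p.1 p.2)
    (hl : ∀ᵐ a ∂E.law, LocallyIntegrable (h a) volume) :
    IsRandomField (E := E) fun a => timePrimitive (h a) := by
  refine ⟨measurable_timePrimitive hh, ?_⟩
  filter_upwards [hl] with a ha
  exact (continuous_timePrimitive ha).locallyIntegrable

/-- A spatially invariant random variable of mean zero has a primitive in time which is constant in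
space. -/
theorem Stationary.timePrimitive_of_invariant (hE : E.Stationary) {D : E.Ω → ℝ}
    (hD : Measurable D) (hD2 : MemLp D 2 E.law) (hD0 : ∫ a, D a ∂E.law = 0)
    (hinv : ∀ a (x : EuclideanSpace ℝ (Fin d)), D (E.shift (x, 0) a) = D a) :
    IsRandomField (E := E) (fun a => timePrimitive fun τ => D (E.shift (0, τ) a)) ∧
      HasStationaryTimeDeriv (E := E) (fun a => timePrimitive fun τ => D (E.shift (0, τ) a)) D := by
  have hp : Measurable fun τ : ℝ => ((0, τ) : SpaceTime d) := by fun_prop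
  have hl : ∀ᵐ a ∂E.law, LocallyIntegrable (fun τ => D (E.shift (0, τ) a)) volume := by
    have h : ∀ n : ℕ, ∀ᵐ a ∂E.law, IntegrableOn (fun τ : ℝ => D (E.shift (0, τ) a))
        (Metric.ball 0 n) volume := fun n => by
      filter_upwards [hE.ae_integrable_shift
        (integrable_one_restrict_ball (V := ℝ) (μ := volume) n) hp hD
        (hD2.integrable one_le_two)] with a ha
      simp only [one_mul] at ha
      exact ha
    filter_upwards [ae_all_iff.2 h] with a ha
    exact locallyIntegrable_of_ball ha
  refine ⟨isRandomField_timePrimitive (hD.comp (E.measurable_shift.comp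
    (measurable_fst.prodMk (hp.comp measurable_snd)))) hl, hD, hD2, hD0, ?_⟩
  filter_upwards [hl, hE.ae_locallyIntegrable_extend hD (hD2.integrable one_le_two)] with a h1 h2
  refine ⟨h2, (dt_timePrimitive h1).trans (congrArg distOf (funext fun z => ?_))⟩
  rw [extend, ← hinv (E.shift (0, z.2) a) z.1, ← shift_add]
  simp

/-! ### The parabolic corrector -/

/-- The spatial average, with the weight `θ` around the origin, of the realization of `X` at time
`τ`. -/
def anchorField (θ : EuclideanSpace ℝ (Fin d) → ℝ) (X : E.Ω → ℝ) (a : E.Ω) (τ : ℝ) : ℝ :=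
  ∫ y, θ y * X (E.shift (y, τ) a)

theorem measurable_anchorField {θ : EuclideanSpace ℝ (Fin d) → ℝ} (hθ : Measurable θ)
    {X : E.Ω → ℝ} (hX : Measurable X) :
    Measurable fun p : E.Ω × ℝ => anchorField θ X p.1 p.2 := by
  have : Measurable fun r : (E.Ω × ℝ) × EuclideanSpace ℝ (Fin d) =>
      θ r.2 * X (E.shift (r.2, r.1.2) r.1.1) :=
    (hθ.comp measurable_snd).mul (hX.comp (E.measurable_shift.comp
      ((measurable_fst.comp measurable_fst).prodMk
        (measurable_snd.prodMk (measurable_snd.comp measurable_fst)))))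
  exact this.stronglyMeasurable.integral_prod_right'.measurable

section

variable (η : 𝓓((⊤ : Opens (EuclideanSpace ℝ (Fin d))), ℝ)) {X : E.Ω → ℝ}

theorem Stationary.ae_locallyIntegrable_anchorField (hE : E.Stationary) (hX : Measurable X)
    (hX2 : MemLp X 2 E.law) : ∀ᵐ a ∂E.law, LocallyIntegrable (anchorField η X a) volume := by
  have hp : Measurable fun r : ℝ × EuclideanSpace ℝ (Fin d) => ((r.2, r.1) : SpaceTime d) := by
    fun_prop
  have h : ∀ n : ℕ, ∀ᵐ a ∂E.law, IntegrableOn (anchorField η X a) (Metric.ball 0 n) volume :=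
    fun n => by
      have hk := (integrable_one_restrict_ball (V := ℝ) (μ := volume) n).mul_prod
        (UnitaryRep.integrable_testFunction (μ := volume) η)
      filter_upwards [hE.ae_integrable_shift hk hp hX (hX2.integrable one_le_two)] with a ha
      simp only [one_mul] at ha
      exact ha.integral_prod_left
  filter_upwards [ae_all_iff.2 h] with a ha
  exact locallyIntegrable_of_ball ha

theorem Stationary.represents_anchorField (hE : E.Stationary) (hX : Measurable X)
    (hX2 : MemLp X 2 E.law) :
    Represents (fun a => distOf fun z => anchorField η X a z.2)
      fun κ => hE.koopman.anchor κ η (hX2.toLp X) := fun κ => by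
  have hk := UnitaryRep.integrable_anchor_kernel κ η
  have hp := UnitaryRep.measurable_anchor_point (d := d)
  filter_upwards [hE.ae_locallyIntegrable_anchorField η hX hX2, hE.avg_ae_eq hk hp hX hX2,
    hE.ae_integrable_shift hk hp hX (hX2.integrable one_le_two)] with a h1 h2 h3
  rw [distOf_apply (locallyIntegrable_comp_snd h1), UnitaryRep.anchor, h2]
  refine Eq.trans ?_ (integral_prod _ h3).symm
  refine integral_congr_ae (ae_of_all _ fun z => ?_)
  simp only [anchorField, mul_assoc]
  rw [← integral_const_mul]

end

/-- The corrector of the parabolic equation: the potential of the stationary field generated by `g`,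
corrected by a function of time. As the potential has vanishing averages against `η`, its time
derivative is `∇ · q` minus the average of `∇ · q` against `η`; the average is `-∑ ∫ ∂_j η q_j` and
its primitive in time is what has to be added. -/
def correctorField (η : 𝓓((⊤ : Opens (EuclideanSpace ℝ (Fin d))), ℝ)) (g q : Fin d → E.Ω → ℝ)
    (a : E.Ω) (z : SpaceTime d) : ℝ :=
  potentialField η g a z -
    timePrimitive (fun τ => ∑ j, anchorField (∂_{unitVec j} η :
      𝓓((⊤ : Opens (EuclideanSpace ℝ (Fin d))), ℝ)) (q j) a τ) z

section

variable (η : 𝓓((⊤ : Opens (EuclideanSpace ℝ (Fin d))), ℝ)) {g q : Fin d → E.Ω → ℝ}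

theorem Stationary.ae_locallyIntegrable_sum_anchorField (hE : E.Stationary)
    (hq : ∀ j, Measurable (q j)) (hq2 : ∀ j, MemLp (q j) 2 E.law) :
    ∀ᵐ a ∂E.law, LocallyIntegrable (fun τ => ∑ j, anchorField (∂_{unitVec j} η :
      𝓓((⊤ : Opens (EuclideanSpace ℝ (Fin d))), ℝ)) (q j) a τ) volume := by
  filter_upwards [ae_all_iff.2 fun j =>
    hE.ae_locallyIntegrable_anchorField (∂_{unitVec j} η) (hq j) (hq2 j)] with a ha
  exact locallyIntegrable_finsetSum _ fun j _ => ha j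

theorem Stationary.isRandomField_correctorField (hE : E.Stationary)
    (hg : ∀ j, Measurable (g j)) (hg2 : ∀ j, MemLp (g j) 2 E.law)
    (hq : ∀ j, Measurable (q j)) (hq2 : ∀ j, MemLp (q j) 2 E.law) :
    IsRandomField (correctorField (E := E) η g q) := by
  have h1 := hE.isRandomField_potentialField η hg hg2
  have h2 := isRandomField_timePrimitive (Finset.measurable_fun_sum _ fun j _ =>
    measurable_anchorField (∂_{unitVec j} η :
      𝓓((⊤ : Opens (EuclideanSpace ℝ (Fin d))), ℝ)).continuous.measurable (hq j))
    (hE.ae_locallyIntegrable_sum_anchorField η hq hq2)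
  refine ⟨h1.1.sub h2.1, ?_⟩
  filter_upwards [h1.2, h2.2] with a h1 h2
  exact h1.sub h2

theorem Stationary.ae_distOf_correctorField (hE : E.Stationary)
    (hg : ∀ j, Measurable (g j)) (hg2 : ∀ j, MemLp (g j) 2 E.law)
    (hq : ∀ j, Measurable (q j)) (hq2 : ∀ j, MemLp (q j) 2 E.law) :
    ∀ᵐ a ∂E.law,
      (∀ k, dx k (distOf (correctorField η g q a)) = dx k (distOf (potentialField η g a))) ∧
      dt (distOf (correctorField η g q a)) = dt (distOf (potentialField η g a)) -
        ∑ j, distOf fun z => anchorField (∂_{unitVec j} η :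
          𝓓((⊤ : Opens (EuclideanSpace ℝ (Fin d))), ℝ)) (q j) a z.2 := by
  filter_upwards [hE.ae_locallyIntegrable_potentialField η hg hg2,
    hE.ae_locallyIntegrable_sum_anchorField η hq hq2, ae_all_iff.2 fun j =>
    hE.ae_locallyIntegrable_anchorField (∂_{unitVec j} η) (hq j) (hq2 j)] with a h1 h2 h3
  have h4 : distOf (correctorField η g q a) = _ :=
    distOf_sub h1 (continuous_timePrimitive h2).locallyIntegrable
  refine ⟨fun k => ?_, ?_⟩
  · rw [h4, dx, lineDeriv_distribution_sub]
    have := dx_timePrimitive (d := d) h2 k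
    rw [dx] at this
    rw [this, sub_zero]
  · have := dt_timePrimitive (d := d) h2
    rw [dt] at this
    rw [h4, dt, lineDeriv_distribution_sub, this,
      distOf_sum fun j => locallyIntegrable_comp_snd (h3 j)]

/-- The parabolic corrector solves `∂_t φ = ∇ · q` if the weak form of this equation in `L²`
holds. -/
theorem Stationary.ae_dt_correctorField (hE : E.Stationary)
    (hg : ∀ j, Measurable (g j)) (hg2 : ∀ j, MemLp (g j) 2 E.law)
    (hq : ∀ j, Measurable (q j)) (hq2 : ∀ j, MemLp (q j) 2 E.law)
    (hgq : ∀ κ : 𝓓((⊤ : Opens (SpaceTime d)), ℝ),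
      hE.koopman.lift (∂_{timeDir d} κ) η (fieldClass hg2) =
        ∑ j, (hE.koopman.pair (∂_{spaceDir j} κ) - hE.koopman.anchor κ (∂_{unitVec j} η))
          (fieldClass hq2 j)) :
    ∀ᵐ a ∂E.law, dt (distOf (correctorField η g q a)) = ∑ j, dx j (distOf (extend (q j) a)) := by
  have h1 := ((hE.represents_potentialField η hg hg2).lineDeriv (timeDir d)).sub
    (Represents.sum Finset.univ fun j =>
      hE.represents_anchorField (∂_{unitVec j} η) (hq j) (hq2 j))
  have h2 := Represents.sum Finset.univ fun j =>
    (hE.represents_extend (hq j) (hq2 j)).lineDeriv (spaceDir j)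
  filter_upwards [hE.ae_distOf_correctorField η hg hg2 hq hq2, h1.ae_eq h2 fun κ => by
    rw [hgq]
    simp only [FunLike.coe_sub, Pi.sub_apply, fieldClass_apply, Finset.sum_sub_distrib,
      Finset.sum_neg_distrib]
    abel] with a h1 h2
  rw [h1.2]
  exact h2

end

end Ensemble

namespace Ensemble

variable {d : ℕ} {E : Ensemble d}

/-! ### Correctors of the flux -/

/-- Antisymmetrizing representatives of the vector potential makes the antisymmetry hold for every
coefficient field, and not only almost surely. -/
theorem Stationary.exists_skew_representatives (hE : E.Stationary)
    (q : UnitaryRep.VecField d (Lp ℝ 2 E.law)) :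
    ∃ (S : Fin d → Fin d → Fin d → E.Ω → ℝ) (hS : ∀ j k l, MemLp (S j k l) 2 E.law),
      (∀ j k l, Measurable (S j k l)) ∧
      (∀ j k, fieldClass (hS j k) = hE.koopman.vecPotential q j k) ∧
      ∀ j k l a, S j k l a = -S k j l a := by
  let R : Fin d → Fin d → Fin d → E.Ω → ℝ := fun j k l => hE.koopman.vecPotential q j k l
  have hR : ∀ j k l, MemLp (R j k l) 2 E.law := fun j k l => Lp.memLp _
  have hRm : ∀ j k l, Measurable (R j k l) := fun j k l => (Lp.stronglyMeasurable _).measurable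
  have hS : ∀ j k l, MemLp (fun a => (1 / 2 : ℝ) * (R j k l a - R k j l a)) 2 E.law :=
    fun j k l => ((hR j k l).sub (hR k j l)).const_mul _
  refine ⟨fun j k l a => (1 / 2 : ℝ) * (R j k l a - R k j l a), hS,
    fun j k l => ((hRm j k l).sub (hRm k j l)).const_mul _, fun j k => ?_, fun j k l a => by ring⟩
  ext1 l
  rw [fieldClass_apply, ← Lp.toLp_coeFn (hE.koopman.vecPotential q j k l) (Lp.memLp _),
    MemLp.toLp_eq_toLp_iff]
  have h1 : R k j l =ᵐ[E.law] -R j k l := by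
    have : hE.koopman.vecPotential q k j l = -hE.koopman.vecPotential q j k l := by
      rw [hE.koopman.vecPotential_swap, PiLp.neg_apply]
    simp only [R, this]
    exact Lp.coeFn_neg _
  filter_upwards [h1] with a ha
  rw [ha, Pi.neg_apply]
  ring

/-- For a square integrable stationary vector field (the flux) the elliptic corrector `ψ`, whose
gradient is the projection of the field on potential fields, and the vector potential `σ` of the
remaining divergence free part. -/
theorem Stationary.exists_fluxCorrectors (hE : E.Stationary)
    {η : 𝓓((⊤ : Opens (EuclideanSpace ℝ (Fin d))), ℝ)} (hη : ∫ y, η y = 1)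
    {X : E.Ω → EuclideanSpace ℝ (Fin d)} (hXm : Measurable X) (hX : MemLp X 2 E.law) :
    ∃ (ψ : E.Ω → SpaceTime d → ℝ) (σ : Fin d → Fin d → E.Ω → SpaceTime d → ℝ)
      (Dψ : E.Ω → EuclideanSpace ℝ (Fin d)) (Dσ : Fin d → Fin d → E.Ω → EuclideanSpace ℝ (Fin d)),
      (IsRandomField ψ ∧ HasStationaryGradient ψ Dψ) ∧
      (∀ j k, IsRandomField (σ j k) ∧ HasStationaryGradient (σ j k) (Dσ j k)) ∧
      ∫ a, ‖Dψ a‖ ^ 2 ∂E.law ≤ ∫ a, ‖X a‖ ^ 2 ∂E.law ∧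
      (∀ j k, ∫ a, ‖Dσ j k a‖ ^ 2 ∂E.law ≤ 16 * ∫ a, ‖X a‖ ^ 2 ∂E.law) ∧
      (∀ j k a z, σ j k a z = -σ k j a z) ∧
      StationaryInTime ψ ∧ (∀ j k, StationaryInTime (σ j k)) ∧
      ∀ᵐ a ∂E.law,
        ∑ j, dx j (dx j (distOf (ψ a))) = ∑ j, dx j (distOf fun z => extend X a z j) ∧
        (∀ j, ∑ k, dx k (distOf (σ j k a)) =
          (distOf fun z => extend X a z j) - dx j (distOf (ψ a)) -
            distOf fun z => extend (E.law[X | E.spatialInvariants]) a z j) ∧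
        ∀ j k, ∑ l, dx l (dx l (distOf (σ j k a))) =
          dx k ((distOf fun z => extend X a z j) - dx j (distOf (ψ a))) -
            dx j ((distOf fun z => extend X a z k) - dx k (distOf (ψ a))) := by
  have hXj := memLp_apply hX
  have hXjm : ∀ j, Measurable fun a => X a j := fun j => by fun_prop
  have hY := memLp_condExp_invariants hX
  have hYj := memLp_apply hY
  have hYjm : ∀ j, Measurable fun a => E.law[X | E.spatialInvariants] a j := fun j => by
    have := measurable_condExp_invariants X
    fun_prop
  let U := hE.koopman
  set q := fieldClass hXj with hq
  set c := fieldClass hYj with hc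
  have hqX : ∫ a, ‖X a‖ ^ 2 ∂E.law = ‖q‖ ^ 2 := integral_norm_vec_sq hXj
  let p : Fin d → E.Ω → ℝ := fun j => U.proj q j
  have hp : ∀ j, MemLp (p j) 2 E.law := fun j => Lp.memLp _
  have hpm : ∀ j, Measurable (p j) := fun j => (Lp.stronglyMeasurable _).measurable
  have hpc : fieldClass hp = U.proj q := fieldClass_coeFn _
  have hpp : fieldClass hp ∈ U.potential := hpc ▸ U.proj_mem q
  obtain ⟨S, hS, hSm, hSc, hSs⟩ := hE.exists_skew_representatives q
  have hSp : ∀ j k, fieldClass (hS j k) ∈ U.potential := fun j k => by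
    rw [hSc]; exact U.vecPotential_mem q j k
  have hψ := hE.represents_dx_potentialField η hη hpm hp hpp
  have hσ := fun j k => hE.represents_dx_potentialField η hη (hSm j k) (hS j k) (hSp j k)
  have hRq := fun j => hE.represents_extend (hXjm j) (hXj j)
  have hRc := fun j => hE.represents_extend (hYjm j) (hYj j)
  have e1 := (Represents.sum Finset.univ fun j => (hψ j).lineDeriv (spaceDir j)).ae_eq
    (Represents.sum Finset.univ fun j => (hRq j).lineDeriv (spaceDir j)) fun κ => by
      rw [hpc, Finset.sum_neg_distrib, Finset.sum_neg_distrib, U.sum_pair_proj κ q]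
      rfl
  have e2 := fun j => (Represents.sum Finset.univ fun k => hσ j k k).ae_eq
    (((hRq j).sub (hψ j)).sub (hRc j)) fun κ => by
      simp only [hSc, hpc]
      rw [← map_sum, U.sum_vecPotential q c (hE.invariant_condExp hX)
        (fun j u hu => hE.inner_sub_condExp hX j hu) j, map_sub, map_sub]
      rfl
  have e3 := fun j k =>
    (Represents.sum Finset.univ fun l => (hσ j k l).lineDeriv (spaceDir l)).ae_eq
    ((((hRq j).sub (hψ j)).lineDeriv (spaceDir k)).sub
      (((hRq k).sub (hψ k)).lineDeriv (spaceDir j))) fun κ => by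
      simp only [hSc, hpc]
      rw [Finset.sum_neg_distrib, U.sum_pair_vecPotential κ q j k, map_sub, map_sub]
      simp only [hq, fieldClass_apply]
      abel
  refine ⟨potentialField η p, fun j k => potentialField η (S j k), vec p, fun j k => vec (S j k),
    ⟨hE.isRandomField_potentialField η hpm hp, hE.hasStationaryGradient hpm hp hpp hψ⟩,
    fun j k => ⟨hE.isRandomField_potentialField η (hSm j k) (hS j k),
      hE.hasStationaryGradient (hSm j k) (hS j k) (hSp j k) (hσ j k)⟩, ?_, fun j k => ?_,
    fun j k a z => ?_, stationaryInTime_potentialField _ _,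
    fun j k => stationaryInTime_potentialField _ _, ?_⟩
  · rw [integral_norm_vec_sq hp, hpc, hqX]
    exact pow_le_pow_left₀ (norm_nonneg _) (U.norm_proj_le q) 2
  · rw [integral_norm_vec_sq (hS j k), hSc, hqX]
    calc _ ≤ (4 * ‖q‖) ^ 2 := pow_le_pow_left₀ (norm_nonneg _) (U.norm_vecPotential_le q j k) 2
      _ = 16 * ‖q‖ ^ 2 := by ring
  · change potentialField η (S j k) a z = -potentialField η (S k j) a z
    rw [← potentialField_neg, show S j k = fun l a => -S k j l a from
      funext fun l => funext fun a => hSs j k l a]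
  · filter_upwards [e1, ae_all_iff.2 e2, ae_all_iff.2 fun j => ae_all_iff.2 (e3 j)] with a h1 h2 h3
    exact ⟨h1, h2, h3⟩

/-- The primitive in time of the deviation of the spatially invariant part of a square integrable
stationary vector field from its mean. -/
theorem Stationary.exists_timeCorrector (hE : E.Stationary)
    {X : E.Ω → EuclideanSpace ℝ (Fin d)} (hX : MemLp X 2 E.law) (j : Fin d) :
    ∃ ζ : E.Ω → SpaceTime d → ℝ, IsRandomField ζ ∧
      HasStationaryTimeDeriv ζ
        (fun a => E.law[X | E.spatialInvariants] a j - (∫ a, X a ∂E.law) j) ∧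
      ConstantInSpace ζ ∧
      ∫ a, |E.law[X | E.spatialInvariants] a j - (∫ a, X a ∂E.law) j| ^ 2 ∂E.law ≤
        ∫ a, ‖X a‖ ^ 2 ∂E.law := by
  set Y := E.law[X | E.spatialInvariants] with hYdef
  have hY := memLp_condExp_invariants hX
  have hYj := memLp_apply hY j
  have hYjm : Measurable fun a => Y a j := by
    have := measurable_condExp_invariants X
    fun_prop
  set m := (∫ a, X a ∂E.law) j with hm
  have hYm : ∫ a, Y a j ∂E.law = m := by
    rw [hm, ← integral_condExp (f := X) E.spatialInvariants_le, ← hYdef]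
    exact (eval_integral_piLp (fun j => (memLp_apply hY j).integrable one_le_two) j).symm
  have hD2 : MemLp (fun a => Y a j - m) 2 E.law := hYj.sub (memLp_const m)
  have h := hE.timePrimitive_of_invariant (D := fun a => Y a j - m) (hYjm.sub_const m) hD2
    (by rw [integral_sub (hYj.integrable one_le_two) (integrable_const m), hYm]; simp)
    (fun a x => by rw [hYdef, condExp_invariants_shift])
  refine ⟨_, h.1, h.2, fun a x y t => rfl, ?_⟩
  have h1 : ∫ a, (Y a j) ^ 2 ∂E.law ≤ ∫ a, ‖X a‖ ^ 2 ∂E.law := by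
    refine le_trans ?_ (integral_norm_condExp_sq_le hX)
    refine integral_mono hYj.integrable_sq (integrable_norm_sq_of_memLp hY) fun a => ?_
    have := pow_le_pow_left₀ (norm_nonneg _) (PiLp.norm_apply_le (Y a) j) 2
    simpa using this
  -- the variance is at most the second moment
  have h2 : ∫ a, |Y a j - m| ^ 2 ∂E.law = ∫ a, (Y a j) ^ 2 ∂E.law - m ^ 2 := by
    have hi1 : Integrable (fun a => Y a j ^ 2) E.law := hYj.integrable_sq
    have hi2 : Integrable (fun a => 2 * m * Y a j) E.law :=
      (hYj.integrable one_le_two).const_mul (2 * m)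
    have : ∀ a, |Y a j - m| ^ 2 = (Y a j) ^ 2 - 2 * m * Y a j + m ^ 2 := fun a => by
      rw [sq_abs]; ring
    simp only [this]
    rw [integral_add (f := fun a => Y a j ^ 2 - 2 * m * Y a j) (hi1.sub hi2) (integrable_const _),
      integral_sub hi1 hi2, integral_const_mul, hYm]
    simp
    ring
  rw [h2]
  linarith [sq_nonneg m]

end Ensemble

namespace Ensemble

variable {d : ℕ} {E : Ensemble d} {lam : ℝ}

/-! ### The parabolic correctors and the homogenized matrix -/

theorem norm_le_of_norm_sq_le {V : Type*} [NormedAddCommGroup V] [InnerProductSpace ℝ V] {x y : V}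
    {c : ℝ} (hc : 0 ≤ c) (h : ‖y‖ ^ 2 ≤ c * ⟪x, y⟫) : ‖y‖ ≤ c * ‖x‖ := by
  rcases (norm_nonneg y).eq_or_lt with h0 | h0
  · rw [← h0]
    positivity
  · have := mul_le_mul_of_nonneg_left (real_inner_le_norm x y) hc
    refine le_of_mul_le_mul_right ?_ h0
    nlinarith

/-- The parabolic correctors, with the bounds of the energies of their gradients and fluxes and of
the homogenized matrix. -/
theorem Stationary.exists_parabolicCorrectors (hE : E.Stationary) (hlam : 0 < lam)
    (hell : ∀ᵐ a ∂E.law, IsElliptic lam (E.coeff a 0))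
    {η : 𝓓((⊤ : Opens (EuclideanSpace ℝ (Fin d))), ℝ)} (hη : ∫ y, η y = 1) :
    ∃ (φ : Fin d → E.Ω → SpaceTime d → ℝ) (Dφ : Fin d → E.Ω → EuclideanSpace ℝ (Fin d)),
      (∀ i, IsRandomField (φ i) ∧ HasStationaryGradient (φ i) (Dφ i)) ∧
      (∀ i, ∫ a, ‖Dφ i a‖ ^ 2 ∂E.law ≤ (1 / lam + 1) ^ 2) ∧
      (∀ i, Measurable (flux Dφ i)) ∧ (∀ i, MemLp (flux Dφ i) 2 E.law) ∧
      (∀ i, ∫ a, ‖flux Dφ i a‖ ^ 2 ∂E.law ≤ (1 / lam) ^ 2) ∧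
      (∀ᵐ a ∂E.law, ∀ i, dt (distOf (φ i a)) =
        ∑ j, dx j (distOf fun z => extend (flux Dφ i) a z j)) ∧
      ∀ ξ : EuclideanSpace ℝ (Fin d),
        lam * ‖ξ‖ ^ 2 ≤ inner ℝ ξ ((homogenized Dφ).toEuclideanLin ξ) ∧
          ‖(homogenized Dφ).toEuclideanLin ξ‖ ≤ 1 / lam * ‖ξ‖ := by
  obtain ⟨G, hGpot, hGn, hGell, hGeq⟩ := hE.koopman.exists_corrector hlam (inner_coeffOp_ge hell)
    (norm_coeffOp_le hell) norm_one hE.invariant_one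
  let g : Fin d → Fin d → E.Ω → ℝ := fun i j => G i j
  have hg : ∀ i j, Measurable (g i j) := fun i j => (Lp.stronglyMeasurable _).measurable
  have hg2 : ∀ i j, MemLp (g i j) 2 E.law := fun i j => Lp.memLp _
  have hgG : ∀ i, fieldClass (hg2 i) = G i := fun i => fieldClass_coeFn _
  let v : Fin d → Fin d → E.Ω → ℝ := fun i k a => g i k a + (Pi.single i 1 : Fin d → ℝ) k
  have hv : ∀ i j, Measurable (v i j) := fun i j => (hg i j).add_const _
  have hv2 : ∀ i j, MemLp (v i j) 2 E.law := fun i j => (hg2 i j).add (memLp_const _)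
  have hvG : ∀ i, fieldClass (hv2 i) = G i + UnitaryRep.constField E.one (Pi.single i 1) :=
      fun i => by
    ext1 k
    rw [← hgG, PiLp.add_apply, UnitaryRep.constField_apply, fieldClass_apply, fieldClass_apply, one,
      ← MemLp.toLp_const_smul, ← MemLp.toLp_add, MemLp.toLp_eq_toLp_iff]
    refine ae_of_all _ fun a => ?_
    simp [v]
  let q : Fin d → Fin d → E.Ω → ℝ := fun i => coeffMul (v i)
  have hq : ∀ i j, Measurable (q i j) := fun i j => measurable_coeffMul (hv i) j
  have hq2 : ∀ i j, MemLp (q i j) 2 E.law := fun i j => memLp_coeffMul hell (hv2 i) j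
  have hqA : ∀ i, fieldClass (hq2 i) =
      coeffOp hell (G i + UnitaryRep.constField E.one (Pi.single i 1)) := fun i => by
    rw [← hvG, coeffOp_fieldClass]
  let Dφ : Fin d → E.Ω → EuclideanSpace ℝ (Fin d) := fun i => vec (g i)
  have hflux : ∀ i, flux Dφ i = vec (q i) := fun i => by
    funext a
    rw [← toEuclideanLin_vec]
    rfl
  have hqn : ∀ i, ‖fieldClass (hq2 i)‖ ≤ 1 / lam := fun i => by
    rw [hqA]
    exact (norm_coeffOp_le hell _).trans (hGn i)
  have hpot : ∀ i, fieldClass (hg2 i) ∈ hE.koopman.potential := fun i => by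
    rw [hgG]; exact hGpot i
  have hdist := fun i => hE.ae_distOf_correctorField η (hg i) (hg2 i) (hq i) (hq2 i)
  refine ⟨fun i => correctorField η (g i) (q i), Dφ, fun i =>
    ⟨hE.isRandomField_correctorField η (hg i) (hg2 i) (hq i) (hq2 i),
      hE.hasStationaryGradient (hg i) (hg2 i) (hpot i) fun k =>
        (hE.represents_dx_potentialField η hη (hg i) (hg2 i) (hpot i) k).congr ?_⟩,
    fun i => ?_, fun i => ?_, fun i => ?_, fun i => ?_, ?_, ?_⟩
  · filter_upwards [hdist i] with a ha
    exact (ha.1 k).symm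
  · rw [integral_norm_vec_sq (hg2 i), hgG]
    refine pow_le_pow_left₀ (norm_nonneg _) ?_ 2
    have he := UnitaryRep.norm_constField_single (norm_one (E := E)) i
    calc ‖G i‖ = ‖(G i + UnitaryRep.constField E.one (Pi.single i 1)) -
          UnitaryRep.constField E.one (Pi.single i 1)‖ := by rw [add_sub_cancel_right]
      _ ≤ 1 / lam + 1 := (norm_sub_le _ _).trans (add_le_add (hGn i) he.le)
  · rw [hflux]
    exact measurable_vec (hq i)
  · rw [hflux]
    exact memLp_vec (hq2 i)
  · rw [hflux, integral_norm_vec_sq (hq2 i)]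
    exact pow_le_pow_left₀ (norm_nonneg _) (hqn i) 2
  · have h := fun i => hE.ae_dt_correctorField η (hg i) (hg2 i) (hq i) (hq2 i) fun κ => by
      rw [hgG, hqA]
      exact hGeq i κ η hη
    filter_upwards [ae_all_iff.2 h] with a ha i
    rw [hflux]
    exact ha i
  · intro ξ
    have hhom : ∀ j, ((homogenized Dφ).toEuclideanLin ξ) j =
        ⟪coeffOp hell (∑ i, ξ i • (G i + UnitaryRep.constField E.one (Pi.single i 1))) j,
          E.one⟫ := fun j => by
      rw [map_sum, WithLp.ofLp_sum, Finset.sum_apply, sum_inner]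
      change ∑ i, homogenized Dφ j i * ξ i = _
      refine Finset.sum_congr rfl fun i _ => ?_
      rw [map_smul, PiLp.smul_apply, real_inner_smul_left, mul_comm, ← hqA, fieldClass_apply,
        inner_toLp_one, homogenized, Matrix.of_apply, hflux, integral_vec_apply (hq2 i)]
    obtain ⟨h1, h2⟩ := hGell ξ
    simp only [← hhom] at h1 h2
    have hin : ∑ j, ξ j * ((homogenized Dφ).toEuclideanLin ξ) j =
        ⟪ξ, (homogenized Dφ).toEuclideanLin ξ⟫ := by
      rw [PiLp.inner_apply]
      exact Finset.sum_congr rfl fun j _ => by simp [mul_comm]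
    rw [hin, ← EuclideanSpace.real_norm_sq_eq] at h1 h2
    exact ⟨h1, norm_le_of_norm_sq_le (by positivity) h2⟩

end Ensemble

end

theorem lemma1 (d : ℕ) (lam : ℝ) (hlam : 0 < lam) (hlam1 : lam ≤ 1) :
    ∃ C : ℝ, 0 < C ∧
      ∀ E : Ensemble d, E.Stationary → E.Ergodic → E.UniformlyElliptic lam →
        -- the correctors `φ_i`, `ψ_i`, `σ_{ijk}`, `ζ_{ij}`, and the random variables that
        -- generate their stationary gradients and time derivatives
        ∃ (φ ψ : Fin d → E.Ω → SpaceTime d → ℝ)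
          (σ : Fin d → Fin d → Fin d → E.Ω → SpaceTime d → ℝ)
          (ζ : Fin d → Fin d → E.Ω → SpaceTime d → ℝ)
          (Dφ Dψ : Fin d → E.Ω → EuclideanSpace ℝ (Fin d))
          (Dσ : Fin d → Fin d → Fin d → E.Ω → EuclideanSpace ℝ (Fin d))
          (Dζ : Fin d → Fin d → E.Ω → ℝ),
          -- random fields with stationary, finite energy, mean zero derivatives
          (∀ i, Ensemble.IsRandomField (φ i) ∧ Ensemble.HasStationaryGradient (φ i) (Dφ i)) ∧
          (∀ i, Ensemble.IsRandomField (ψ i) ∧ Ensemble.HasStationaryGradient (ψ i) (Dψ i)) ∧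
          (∀ i j k, Ensemble.IsRandomField (σ i j k) ∧
            Ensemble.HasStationaryGradient (σ i j k) (Dσ i j k)) ∧
          (∀ i j, Ensemble.IsRandomField (ζ i j) ∧
            Ensemble.HasStationaryTimeDeriv (ζ i j) (Dζ i j)) ∧
          (∀ i j k, (∫ a, ‖Dφ i a‖ ^ 2 ∂E.law) + (∫ a, ‖Dψ i a‖ ^ 2 ∂E.law) +
            (∫ a, ‖Dσ i j k a‖ ^ 2 ∂E.law) + (∫ a, |Dζ i j a| ^ 2 ∂E.law) ≤ C) ∧
          -- skew-symmetry, stationarity in time, constancy in space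
          (∀ i j k a z, σ i j k a z = -σ i k j a z) ∧
          (∀ i, Ensemble.StationaryInTime (ψ i)) ∧
          (∀ i j k, Ensemble.StationaryInTime (σ i j k)) ∧
          (∀ i j, Ensemble.ConstantInSpace (ζ i j)) ∧
          -- the equations, almost surely, as distributions on space-time
          (∀ᵐ a ∂E.law, ∀ i,
            -- `∂_t φ_i = ∇ · q_i`
            dt (distOf (φ i a)) =
                ∑ j, dx j
                  (distOf fun z => Ensemble.extend (Ensemble.flux Dφ i) a z j) ∧
            -- `Δ ψ_i = ∇ · q_i`
            ∑ j, dx j (dx j (distOf (ψ i a))) =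
                ∑ j, dx j
                  (distOf fun z => Ensemble.extend (Ensemble.flux Dφ i) a z j) ∧
            -- `∇ · σ_i = q_i - ∇ψ_i - ⟨q_i | F_{ℝ^d}⟩`
            (∀ j, ∑ k, dx k (distOf (σ i j k a)) =
                (distOf fun z => Ensemble.extend (Ensemble.flux Dφ i) a z j)
                  - dx j (distOf (ψ i a))
                  - distOf fun z => Ensemble.extend (Ensemble.condFlux Dφ i) a z j) ∧
            -- `Δ σ_{ijk} = ∂_k (q_i - ∇ψ_i)_j - ∂_j (q_i - ∇ψ_i)_k`
            (∀ j k, ∑ l, dx l (dx l (distOf (σ i j k a))) =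
                dx k
                  ((distOf fun z => Ensemble.extend (Ensemble.flux Dφ i) a z j)
                    - dx j (distOf (ψ i a)))
                - dx j
                  ((distOf fun z => Ensemble.extend (Ensemble.flux Dφ i) a z k)
                    - dx k (distOf (ψ i a)))) ∧
            -- `∂_t ζ_i = ⟨q_i | F_{ℝ^d}⟩ - ⟨q_i⟩`, where `⟨q_i⟩ = ā e_i`
            (∀ j, dt (distOf (ζ i j a)) =
                distOf fun z => Ensemble.extend (Ensemble.condFlux Dφ i) a z j
                  - Ensemble.homogenized Dφ j i)) ∧
          -- the homogenized matrix is bounded and uniformly elliptic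
          (∀ ξ : EuclideanSpace ℝ (Fin d),
            lam * ‖ξ‖ ^ 2 ≤ inner ℝ ξ ((Ensemble.homogenized Dφ).toEuclideanLin ξ) ∧
            ‖(Ensemble.homogenized Dφ).toEuclideanLin ξ‖ ≤ 1 / lam * ‖ξ‖) := by
  -- as `1 ≤ λ⁻¹`, the four energies are at most `4`, `1`, `16` and `1` times `λ⁻²`
  refine ⟨22 / lam ^ 2, by positivity, fun E hE _ hell' => ?_⟩
  have hell := hE.ae_isElliptic hell'
  let b : ContDiffBump (0 : EuclideanSpace ℝ (Fin d)) := ⟨1, 2, one_pos, one_lt_two⟩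
  have hη : ∫ y, UnitaryRep.bump volume b y = 1 := b.integral_normed
  obtain ⟨φ, Dφ, hφ, hDφ, hqm, hq2, hqn, heq, hhom⟩ :=
    hE.exists_parabolicCorrectors hlam hell hη
  choose ψ σ Dψ Dσ hψ hσ hDψ hDσ hskew hψt hσt hψσ using
    fun i => hE.exists_fluxCorrectors hη (hqm i) (hq2 i)
  choose ζ hζ hDζ hζc hζn using fun i j => hE.exists_timeCorrector (hq2 i) j
  refine ⟨φ, ψ, σ, ζ, Dφ, Dψ, Dσ, _, hφ, hψ, hσ, fun i j => ⟨hζ i j, hDζ i j⟩,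
    fun i j k => ?_, hskew, hψt, hσt, hζc, ?_, hhom⟩
  · have h1 : 1 / lam + 1 ≤ 2 * (1 / lam) := by
      have : 1 ≤ 1 / lam := (one_le_div hlam).2 hlam1
      linarith
    have h2 : (1 / lam + 1) ^ 2 ≤ (2 * (1 / lam)) ^ 2 := pow_le_pow_left₀ (by positivity) h1 2
    have h3 : 22 / lam ^ 2 = 22 * (1 / lam) ^ 2 := by ring
    have := hDφ i
    have := hDψ i
    have := hDσ i j k
    have := hζn i j
    have := hqn i
    rw [h3]
    nlinarith [sq_nonneg (1 / lam)]
  · filter_upwards [heq, ae_all_iff.2 hψσ,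
      ae_all_iff.2 fun i => ae_all_iff.2 fun j => (hDζ i j).2.2.2] with a h1 h2 h3 i
    exact ⟨h1 i, (h2 i).1, (h2 i).2.1, (h2 i).2.2, fun j => (h3 i j).2⟩
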